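/- **Setting.** Manifolds are smooth and finite-dimensional (without boundary). Let $\pi:P\to M$ be a smooth principal fibre bundle with structure group a Lie group $G$, with Lie algebra $\mathfrak g$; write $r_g$ for the right action of $g\in G$ on $P$. Let $\rho:G\to GL(V)$ be a smooth representation on a real vector space $V$ with $\dim V=\dim M$. A $G$-structure is such a bundle together with a *displacement form* $\theta\in\Omega^1(P;V)$, i.e. a smooth $V$-valued one-form with $r_g^*\theta=\rho(g^{-1})\theta$ for all $g\in G$ whose kernel is exactly the vertical bundle $\ker T\pi$. For a principal connection $\omega\in\Omega^1(P;\mathfrak g)$ with projection $\chi:TP\to\ker\omega$ onto the horizontal bundle, put $d_\omega\Psi=\chi^*d\Psi$; the curvature is $\Omega=d_\omega\omega\in\Omega^2(P;\mathfrak g)$, and $\omega$ is *torsion-free* if $d_\omega\theta=0$. Let $A(\mathfrak g,V)=S(\mathfrak g^*)\otimes\Lambda(V^*)$, with $G$ acting through the coadjoint representation on $\mathfrak g^*$ and through the dual of $\rho$ on $V^*$, and let $A(\mathfrak g,V)^G$ be the subalgebra of invariant elements. For $f\in S^p(\mathfrak g^*)\otimes\Lambda^q(V^*)$ represented by a tensor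 $t\in(\bigotimes^p\mathfrak g^*)\otimes(\bigotimes^qV^*)$, that is, a multilinear form on $\mathfrak g^p\times V^q$, define the form $f(\Omega,\dots,\Omega,\theta,\dots,\theta)\in\Omega^{2p+q}(P)$ by $$f(\Omega,\dots,\Omega,\theta,\dots,\theta)(X_1,\dots,X_{2p+q})=\frac1{2^p}\sum_{\sigma}\operatorname{sign}(\sigma)\,t\bigl(\Omega(X_{\sigma1},X_{\sigma2}),\dots,\Omega(X_{\sigma(2p-1)},X_{\sigma(2p)});\theta(X_{\sigma(2p+1)}),\dots,\theta(X_{\sigma(2p+q)})\bigr),$$ the sum being over all permutations of $\{1,\dots,2p+q\}$; it depends only on $f$. If $f$ is $G$-invariant, it is the pullback under $\pi$ of a unique form on $M$, denoted by the same symbol. **Theorem 3.4 (generalized Chern–Weil homomorphism).** Let $\pi:P\to M$ be a $G$-structure with displacement form $\theta$. 1. For every principal connection $\omega$ on $P$, with curvature $\Omega$, the map $$\mu_\omega:A(\mathfrak g,V)^G\to\Omega(M),\qquad (S^p(\mathfrak g^*)\otimes\Lambda^q(V^*))^G\ni f\mapsto f(\underbrace{\Omega,\dots,\Omega}_{p},\underbrace{\theta,\dots,\theta}_{q})\in\Omega^{2p+q}(M),$$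 is a homomorphism of (unital) associative algebras. 2. If $\omega$ is torsion-free, then all forms in the image of $\mu_\omega$ are closed, and $\mu_\omega$ induces an algebra homomorphism $\mu':A(\mathfrak g,V)^G\to H^*(M)$, $f\mapsto[\mu_\omega(f)]$, into the de Rham cohomology of $M$. 3. The homomorphism $\mu'$ is the same for all torsion-free connections $\omega$ on $P$. -/

import Mathlib

open scoped Manifold ContDiff TensorProduct

noncomputable section

namespace GenChernWeil

/-! ## Differential forms on a manifold

All manifolds are modelled on finite-dimensional real normed spaces, without boundary. -/

section Forms

variable (E : Type*) [NormedAddCommGroup E] [NormedSpace ℝ E]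
  (M : Type*) [TopologicalSpace M] [ChartedSpace E M]
  (F : Type*) [NormedAddCommGroup F] [NormedSpace ℝ F]

/-- Not necessarily smooth `F`-valued differential `k`-forms on `M`: a choice of an alternating
`k`-linear map `T_x M × ⋯ × T_x M → F` for every point `x`. Here `T_x M` is written as `E`, since
Mathlib defines `TangentSpace 𝓘(ℝ, E) x` to be a copy of `E` (the tangent vectors at `x` are
identified with `E` through the derivative of the chart `chartAt E x`). -/
abbrev DiffForm (k : ℕ) : Type _ :=
  M → E [⋀^Fin k]→L[ℝ] F

variable {E M F}

/-- The expression of a form in the chart around `x₀`: its pullback under the inverse chart.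
It is meaningful on the target of the chart, an open subset of `E`. -/
def DiffForm.inChart {k : ℕ} (α : DiffForm E M F k) (x₀ : M) : E → E [⋀^Fin k]→L[ℝ] F :=
  fun y => (α ((chartAt E x₀).symm y)).compContinuousLinearMap
    (mfderiv 𝓘(ℝ, E) 𝓘(ℝ, E) (chartAt E x₀).symm y)

/-- A form is smooth if all its chart expressions are smooth. -/
def DiffForm.IsSmooth {k : ℕ} (α : DiffForm E M F k) : Prop :=
  ∀ x₀ : M, ContDiffOn ℝ ∞ (α.inChart x₀) (chartAt E x₀).target

/-- The exterior derivative, computed at `x` in the chart around `x`. -/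
def DiffForm.d {k : ℕ} (α : DiffForm E M F k) : DiffForm E M F (k + 1) :=
  fun x => (extDeriv (α.inChart x) (chartAt E x x)).compContinuousLinearMap
    (mfderiv 𝓘(ℝ, E) 𝓘(ℝ, E) (chartAt E x) x)

theorem DiffForm.inChart_add {k : ℕ} (α β : DiffForm E M F k) (x₀ : M) :
    DiffForm.inChart (α + β) x₀ = α.inChart x₀ + β.inChart x₀ := rfl

theorem DiffForm.inChart_smul {k : ℕ} (c : ℝ) (α : DiffForm E M F k) (x₀ : M) :
    DiffForm.inChart (c • α) x₀ = c • α.inChart x₀ := rfl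

theorem DiffForm.inChart_zero {k : ℕ} (x₀ : M) :
    DiffForm.inChart (0 : DiffForm E M F k) x₀ = 0 := rfl

theorem DiffForm.IsSmooth.add {k : ℕ} {α β : DiffForm E M F k} (hα : α.IsSmooth)
    (hβ : β.IsSmooth) : DiffForm.IsSmooth (α + β) := fun x₀ => by
  rw [DiffForm.inChart_add]; exact (hα x₀).add (hβ x₀)

theorem DiffForm.IsSmooth.smul {k : ℕ} (c : ℝ) {α : DiffForm E M F k} (hα : α.IsSmooth) :
    DiffForm.IsSmooth (c • α) := fun x₀ => by
  rw [DiffForm.inChart_smul]; exact (hα x₀).const_smul c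

theorem DiffForm.isSmooth_zero {k : ℕ} : DiffForm.IsSmooth (0 : DiffForm E M F k) := fun x₀ => by
  rw [DiffForm.inChart_zero]; exact contDiffOn_const

theorem DiffForm.IsSmooth.differentiableAt {k : ℕ} {α : DiffForm E M F k} (hα : α.IsSmooth)
    (x : M) : DifferentiableAt ℝ (α.inChart x) (chartAt E x x) :=
  ((hα x).contDiffAt ((chartAt E x).open_target.mem_nhds
    (mem_chart_target E x))).differentiableAt (by simp)

theorem DiffForm.d_add {k : ℕ} {α β : DiffForm E M F k} (hα : α.IsSmooth) (hβ : β.IsSmooth) :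
    DiffForm.d (α + β) = α.d + β.d := by
  funext x
  simp only [DiffForm.d, DiffForm.inChart_add,
    extDeriv_add (hα.differentiableAt x) (hβ.differentiableAt x)]
  rfl

theorem DiffForm.d_smul {k : ℕ} (c : ℝ) (α : DiffForm E M F k) :
    DiffForm.d (c • α) = c • α.d := by
  funext x
  simp only [DiffForm.d, DiffForm.inChart_smul, extDeriv_smul]
  rfl

theorem DiffForm.d_zero {k : ℕ} : DiffForm.d (0 : DiffForm E M F k) = 0 := by
  simpa using DiffForm.d_smul 0 (0 : DiffForm E M F k)

end Forms

/-! ## The wedge product, the space `Ω(M)`, and de Rham cohomology -/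

section DeRham

/-- The multilinear map `(X₁, …, X_n) ↦ a(X₁, …, X_k) b(X_{k+1}, …, X_n)`, where `n = k + l`. -/
def mulForms {E : Type*} [NormedAddCommGroup E] [NormedSpace ℝ E] {k l n : ℕ} (h : k + l = n)
    (a : E [⋀^Fin k]→L[ℝ] ℝ) (b : E [⋀^Fin l]→L[ℝ] ℝ) :
    ContinuousMultilinearMap ℝ (fun _ : Fin n => E) ℝ where
  toFun X := a (fun i => X (Fin.cast h (Fin.castAdd l i))) *
    b (fun j => X (Fin.cast h (Fin.natAdd k j)))
  map_update_add' := by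
    subst h
    intro _ X i x y
    obtain rfl : ‹DecidableEq (Fin (k + l))› = instDecidableEqFin _ := Subsingleton.elim _ _
    refine Fin.addCases (fun i => ?_) (fun j => ?_) i
    · have h1 : ∀ z, (fun i' => Function.update X (Fin.castAdd l i) z (Fin.castAdd l i')) =
          Function.update (fun i' => X (Fin.castAdd l i')) i z := fun z =>
        Function.update_comp_eq_of_injective X (Fin.castAdd_injective k l) i z
      have h2 : ∀ z, (fun j => Function.update X (Fin.castAdd l i) z (Fin.natAdd k j)) =
          fun j => X (Fin.natAdd k j) := fun z => by
        funext j; simp [Function.update_apply, Fin.ext_iff]; omega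
      simp [h1, h2, add_mul]
    · have h1 : ∀ z, (fun j' => Function.update X (Fin.natAdd k j) z (Fin.natAdd k j')) =
          Function.update (fun j' => X (Fin.natAdd k j')) j z := fun z =>
        Function.update_comp_eq_of_injective X (Fin.natAdd_injective l k) j z
      have h2 : ∀ z, (fun i => Function.update X (Fin.natAdd k j) z (Fin.castAdd l i)) =
          fun i => X (Fin.castAdd l i) := fun z => by
        funext i; simp [Function.update_apply, Fin.ext_iff]; omega
      simp [h1, h2, mul_add]
  map_update_smul' := by
    subst h
    intro _ X i c x
    obtain rfl : ‹DecidableEq (Fin (k + l))› = instDecidableEqFin _ := Subsingleton.elim _ _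
    refine Fin.addCases (fun i => ?_) (fun j => ?_) i
    · have h1 : ∀ z, (fun i' => Function.update X (Fin.castAdd l i) z (Fin.castAdd l i')) =
          Function.update (fun i' => X (Fin.castAdd l i')) i z := fun z =>
        Function.update_comp_eq_of_injective X (Fin.castAdd_injective k l) i z
      have h2 : ∀ z, (fun j => Function.update X (Fin.castAdd l i) z (Fin.natAdd k j)) =
          fun j => X (Fin.natAdd k j) := fun z => by
        funext j; simp [Function.update_apply, Fin.ext_iff]; omega
      simp [h1, h2, mul_assoc]
    · have h1 : ∀ z, (fun j' => Function.update X (Fin.natAdd k j) z (Fin.natAdd k j')) =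
          Function.update (fun j' => X (Fin.natAdd k j')) j z := fun z =>
        Function.update_comp_eq_of_injective X (Fin.natAdd_injective l k) j z
      have h2 : ∀ z, (fun i => Function.update X (Fin.natAdd k j) z (Fin.castAdd l i)) =
          fun i => X (Fin.castAdd l i) := fun z => by
        funext i; simp [Function.update_apply, Fin.ext_iff]; omega
      simp [h1, h2, mul_left_comm]
  cont := by
    have ha := a.cont
    have hb := b.cont
    exact (ha.comp (continuous_pi fun _ => continuous_apply _)).mul
      (hb.comp (continuous_pi fun _ => continuous_apply _))

/-- The wedge product of alternating maps; for `n = k + l`,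
`(a ∧ b)(X₁, …, X_n) = 1/(k! l!) ∑_σ sign(σ) a(X_{σ1}, …, X_{σk}) b(X_{σ(k+1)}, …, X_{σn})`. -/
def wedge {E : Type*} [NormedAddCommGroup E] [NormedSpace ℝ E] {k l n : ℕ} (h : k + l = n)
    (a : E [⋀^Fin k]→L[ℝ] ℝ) (b : E [⋀^Fin l]→L[ℝ] ℝ) : E [⋀^Fin n]→L[ℝ] ℝ :=
  ((k.factorial : ℝ) * (l.factorial : ℝ))⁻¹ •
    ContinuousMultilinearMap.alternatization (mulForms h a b)

variable (E : Type*) [NormedAddCommGroup E] [NormedSpace ℝ E]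
  (M : Type*) [TopologicalSpace M] [ChartedSpace E M]

/-- Inhomogeneous real-valued forms, given by their homogeneous components. (Forms of degree
larger than `dim M` vanish, so that the product over all degrees is also the direct sum.) -/
def TotalForm : Type _ := (k : ℕ) → DiffForm E M ℝ k

instance : AddCommGroup (TotalForm E M) :=
  inferInstanceAs (AddCommGroup ((k : ℕ) → DiffForm E M ℝ k))

instance : Module ℝ (TotalForm E M) :=
  inferInstanceAs (Module ℝ ((k : ℕ) → DiffForm E M ℝ k))

/-- `Ω(M)`, the space of smooth inhomogeneous differential forms. -/
def smoothForms : Submodule ℝ (TotalForm E M) where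
  carrier := {α | ∀ k, (α k).IsSmooth}
  add_mem' hα hβ k := (hα k).add (hβ k)
  zero_mem' _ := DiffForm.isSmooth_zero
  smul_mem' c _ hα k := (hα k).smul c

variable {E M}

/-- The wedge product of inhomogeneous forms, `(α ∧ β)_n = ∑_{i+j=n} α_i ∧ β_j`. -/
def TotalForm.wedge (α β : TotalForm E M) : TotalForm E M := fun n x =>
  ∑ ij : Finset.HasAntidiagonal.antidiagonal n,
    GenChernWeil.wedge (Finset.HasAntidiagonal.mem_antidiagonal.1 ij.2) (α ij.1.1 x) (β ij.1.2 x)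

/-- The constant function `1`, as a form of degree `0`. -/
def TotalForm.one : TotalForm E M
  | 0 => fun _ => ContinuousAlternatingMap.constOfIsEmpty ℝ _ (Fin 0) 1
  | _ + 1 => 0

variable (E M)

/-- The closed forms in `Ω(M)`. -/
def closedForms : Submodule ℝ (smoothForms E M) where
  carrier := {α | ∀ k, ((α : TotalForm E M) k).d = 0}
  add_mem' {α β} hα hβ k := by
    show DiffForm.d ((α : TotalForm E M) k + (β : TotalForm E M) k) = 0
    rw [DiffForm.d_add (α.2 k) (β.2 k), hα k, hβ k, add_zero]
  zero_mem' _ := DiffForm.d_zero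
  smul_mem' c α hα k := by
    show DiffForm.d (c • (α : TotalForm E M) k) = 0
    rw [DiffForm.d_smul, hα k, smul_zero]

/-- The exact forms in `Ω(M)`: the forms `dβ` with `β` in `Ω(M)`. -/
def exactForms : Submodule ℝ (smoothForms E M) where
  carrier := {α | ∃ β : smoothForms E M, (α : TotalForm E M) 0 = 0 ∧
    ∀ k, (α : TotalForm E M) (k + 1) = ((β : TotalForm E M) k).d}
  add_mem' := by
    rintro α α' ⟨β, h0, h⟩ ⟨β', h0', h'⟩
    refine ⟨β + β', ?_, fun k => ?_⟩
    · show (α : TotalForm E M) 0 + (α' : TotalForm E M) 0 = 0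
      rw [h0, h0', add_zero]
    · show (α : TotalForm E M) (k + 1) + (α' : TotalForm E M) (k + 1) =
        DiffForm.d ((β : TotalForm E M) k + (β' : TotalForm E M) k)
      rw [DiffForm.d_add (β.2 k) (β'.2 k), h k, h' k]
  zero_mem' := ⟨0, rfl, fun _ => DiffForm.d_zero.symm⟩
  smul_mem' := by
    rintro c α ⟨β, h0, h⟩
    refine ⟨c • β, ?_, fun k => ?_⟩
    · show c • (α : TotalForm E M) 0 = 0
      rw [h0, smul_zero]
    · show c • (α : TotalForm E M) (k + 1) = DiffForm.d (c • (β : TotalForm E M) k)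
      rw [DiffForm.d_smul, h k]

/-- De Rham cohomology `H^*(M)`: closed forms modulo exact forms. -/
def DeRham : Type _ := closedForms E M ⧸ (exactForms E M).submoduleOf (closedForms E M)

instance : AddCommGroup (DeRham E M) := inferInstanceAs
  (AddCommGroup (closedForms E M ⧸ (exactForms E M).submoduleOf (closedForms E M)))

instance : Module ℝ (DeRham E M) := inferInstanceAs
  (Module ℝ (closedForms E M ⧸ (exactForms E M).submoduleOf (closedForms E M)))

variable {E M}

/-- The cohomology class of a closed form. -/
def deRhamClass : closedForms E M →ₗ[ℝ] DeRham E M :=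
  ((exactForms E M).submoduleOf (closedForms E M)).mkQ

/-- A linear map from a real algebra `A` to `Ω(M)` is a homomorphism of unital associative
algebras, the product of `Ω(M)` being the wedge product. -/
structure IsFormsAlgHom {A : Type*} [Semiring A] [Algebra ℝ A] (μ : A →ₗ[ℝ] smoothForms E M) :
    Prop where
  map_one : (μ 1 : TotalForm E M) = TotalForm.one
  map_mul : ∀ f g : A, (μ (f * g) : TotalForm E M) = (μ f : TotalForm E M).wedge (μ g)

/-- A linear map from a real algebra `A` to `H^*(M)` is a homomorphism of unital associative
algebras. The unit of `H^*(M)` is the class of the closed form `1`, and the product of two classes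
is the class of the closed form `a ∧ b` for any closed representatives `a`, `b`. -/
structure IsDeRhamAlgHom {A : Type*} [Semiring A] [Algebra ℝ A] (μ : A →ₗ[ℝ] DeRham E M) :
    Prop where
  map_one : ∃ c : closedForms E M,
    ((c : smoothForms E M) : TotalForm E M) = TotalForm.one ∧ deRhamClass c = μ 1
  map_mul : ∀ (f g : A) (a b : closedForms E M), deRhamClass a = μ f → deRhamClass b = μ g →
    ∃ c : closedForms E M, ((c : smoothForms E M) : TotalForm E M) =
      ((a : smoothForms E M) : TotalForm E M).wedge ((b : smoothForms E M) : TotalForm E M) ∧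
      deRhamClass c = μ (f * g)

end DeRham

/-! ## The algebra `A(𝔤, V) = S(𝔤*) ⊗ Λ(V*)` -/

section Algebra

variable (𝔤 V : Type*) [AddCommGroup 𝔤] [Module ℝ 𝔤] [AddCommGroup V] [Module ℝ V]

/-- The algebra `A(𝔤, V) = S(𝔤*) ⊗ Λ(V*)`. (As elements of `S(𝔤*)` have even degree, the graded
tensor product of algebras is the ordinary one.) -/
abbrev AAlg : Type _ :=
  SymmetricAlgebra ℝ (Module.Dual ℝ 𝔤) ⊗[ℝ] ExteriorAlgebra ℝ (Module.Dual ℝ V)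

/-- The tensors `(⨂^p 𝔤*) ⊗ (⨂^q V*)`, which represent elements of `S^p(𝔤*) ⊗ Λ^q(V*)`. -/
abbrev Tensors (p q : ℕ) : Type _ :=
  (⨂[ℝ]^p (Module.Dual ℝ 𝔤)) ⊗[ℝ] (⨂[ℝ]^q (Module.Dual ℝ V))

variable {𝔤 V}

/-- The natural projection `(⨂^p 𝔤*) ⊗ (⨂^q V*) → S^p(𝔤*) ⊗ Λ^q(V*) ⊆ A(𝔤, V)`. -/
def tensorClass {p q : ℕ} : Tensors 𝔤 V p q →ₗ[ℝ] AAlg 𝔤 V :=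
  TensorProduct.map
    ((SymmetricAlgebra.algHom ℝ (Module.Dual ℝ 𝔤)).toLinearMap ∘ₗ TensorPower.toTensorAlgebra)
    ((TensorAlgebra.toExterior (R := ℝ) (M := Module.Dual ℝ V)).toLinearMap ∘ₗ
      TensorPower.toTensorAlgebra)

/-- The value `t(X₁, …, X_p; Y₁, …, Y_q)` of a tensor, regarded as a multilinear form: the tensor
`λ₁ ⊗ ⋯ ⊗ λ_p ⊗ ν₁ ⊗ ⋯ ⊗ ν_q` has the value `λ₁(X₁) ⋯ λ_p(X_p) ν₁(Y₁) ⋯ ν_q(Y_q)`. -/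
def evalTensor {p q : ℕ} (X : Fin p → 𝔤) (Y : Fin q → V) : Tensors 𝔤 V p q →ₗ[ℝ] ℝ :=
  LinearMap.mul' ℝ ℝ ∘ₗ TensorProduct.map
    (PiTensorProduct.lift ((MultilinearMap.mkPiAlgebra ℝ (Fin p) ℝ).compLinearMap
      fun i => Module.Dual.eval ℝ 𝔤 (X i)))
    (PiTensorProduct.lift ((MultilinearMap.mkPiAlgebra ℝ (Fin q) ℝ).compLinearMap
      fun j => Module.Dual.eval ℝ V (Y j)))

/-- The algebra homomorphism of `A(𝔤, V)` induced by linear endomorphisms `a` of `𝔤` and `b` of `V`,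
by substitution: on generators it is `λ ↦ λ ∘ a` and `ν ↦ ν ∘ b`. -/
def AAlg.subst (a : 𝔤 →ₗ[ℝ] 𝔤) (b : V →ₗ[ℝ] V) : AAlg 𝔤 V →ₐ[ℝ] AAlg 𝔤 V :=
  Algebra.TensorProduct.map
    (SymmetricAlgebra.lift (SymmetricAlgebra.ι ℝ (Module.Dual ℝ 𝔤) ∘ₗ a.dualMap))
    (ExteriorAlgebra.map b.dualMap)

end Algebra

/-! ## Principal bundles, connections, and `G`-structures -/

section Bundles

variable {EM EP EG V : Type*}
  [NormedAddCommGroup EM] [NormedSpace ℝ EM] [NormedAddCommGroup EP] [NormedSpace ℝ EP]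
  [NormedAddCommGroup EG] [NormedSpace ℝ EG] [NormedAddCommGroup V] [NormedSpace ℝ V]
  {M P G : Type*} [TopologicalSpace M] [ChartedSpace EM M] [TopologicalSpace P] [ChartedSpace EP P]
  [TopologicalSpace G] [ChartedSpace EG G] [Group G]

/-- The adjoint representation: `Ad(g)` is the derivative at `1` of `x ↦ g x g⁻¹`. The Lie algebra
`𝔤 = T_1 G` is written as `EG`, see `DiffForm`. -/
def Ad (g : G) : EG →L[ℝ] EG :=
  mfderiv 𝓘(ℝ, EG) 𝓘(ℝ, EG) (fun x : G => g * x * g⁻¹) 1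

variable (EM EP EG M P G) in
/-- A smooth principal fibre bundle `P → M` with structure group `G`. -/
structure PrincipalBundle where
  /-- The bundle projection. -/
  proj : P → M
  /-- The principal right action `(u, g) ↦ u g`. -/
  act : P → G → P
  act_one : ∀ u, act u 1 = u
  act_mul : ∀ u g h, act u (g * h) = act (act u g) h
  proj_act : ∀ u g, proj (act u g) = proj u
  contMDiff_proj : ContMDiff 𝓘(ℝ, EP) 𝓘(ℝ, EM) ∞ proj
  contMDiff_act : ContMDiff (𝓘(ℝ, EP).prod 𝓘(ℝ, EG)) 𝓘(ℝ, EP) ∞ (fun z : P × G => act z.1 z.2)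
  /-- Around every point of `M` there is a smooth equivariant local trivialization. -/
  locally_trivial : ∀ x : M, ∃ e : Bundle.Trivialization G proj, x ∈ e.baseSet ∧
    ContMDiffOn 𝓘(ℝ, EP) (𝓘(ℝ, EM).prod 𝓘(ℝ, EG)) ∞ e e.source ∧
    ContMDiffOn (𝓘(ℝ, EM).prod 𝓘(ℝ, EG)) 𝓘(ℝ, EP) ∞ e.toOpenPartialHomeomorph.symm e.target ∧
    ∀ u ∈ e.source, ∀ g : G, e (act u g) = ((e u).1, (e u).2 * g)

/-- The derivative `T_u π : T_u P → T_{π u} M`. -/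
def PrincipalBundle.dproj (B : PrincipalBundle EM EP EG M P G) (u : P) : EP →L[ℝ] EM :=
  mfderiv 𝓘(ℝ, EP) 𝓘(ℝ, EM) B.proj u

/-- The derivative `T_u r_g : T_u P → T_{u g} P` of the right translation by `g`. -/
def PrincipalBundle.dright (B : PrincipalBundle EM EP EG M P G) (g : G) (u : P) : EP →L[ℝ] EP :=
  mfderiv 𝓘(ℝ, EP) 𝓘(ℝ, EP) (fun u' => B.act u' g) u

/-- The fundamental vector fields: `A ∈ 𝔤` is mapped to `ζ_A(u)`, the image of `A` under the
derivative of `g ↦ u g` at `1`. -/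
def PrincipalBundle.fundamental (B : PrincipalBundle EM EP EG M P G) (u : P) : EG →L[ℝ] EP :=
  mfderiv 𝓘(ℝ, EG) 𝓘(ℝ, EP) (B.act u) 1

/-- A principal connection: a smooth `𝔤`-valued one-form on `P` that reproduces the generators of
the fundamental vector fields and is equivariant, `(r_g)^* ω = Ad(g⁻¹) ω`. -/
structure PrincipalConnection (B : PrincipalBundle EM EP EG M P G) where
  /-- The connection form. -/
  form : DiffForm EP P EG 1
  smooth : form.IsSmooth
  form_fundamental : ∀ u (A : EG), form u ![B.fundamental u A] = A
  equivariant : ∀ u g (X : EP), form (B.act u g) ![B.dright g u X] = Ad g⁻¹ (form u ![X])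

namespace PrincipalConnection

variable {B : PrincipalBundle EM EP EG M P G} (γ : PrincipalConnection B)

/-- The projection `χ : TP → HP = ker ω` onto the horizontal bundle, `χ(X) = X - ζ_{ω(X)}`. -/
def horizontal (u : P) : EP →L[ℝ] EP :=
  ContinuousLinearMap.id ℝ EP -
    (B.fundamental u).comp ((ContinuousAlternatingMap.ofSubsingleton ℝ EP EG 0).symm (γ.form u))

/-- The covariant exterior derivative `d_ω Ψ = χ^* dΨ`. -/
def covDeriv {F : Type*} [NormedAddCommGroup F] [NormedSpace ℝ F] {k : ℕ}
    (Ψ : DiffForm EP P F k) : DiffForm EP P F (k + 1) :=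
  fun u => (Ψ.d u).compContinuousLinearMap (γ.horizontal u)

/-- The curvature form `Ω = d_ω ω`. -/
def curvature : DiffForm EP P EG 2 := γ.covDeriv γ.form

end PrincipalConnection

variable (V) in
/-- A `G`-structure on `M`: a principal bundle `P → M` together with a representation `ρ` of `G` in
a real vector space `V` of dimension `dim M` and a displacement form `θ`, a smooth `G`-equivariant
`V`-valued one-form on `P` whose kernel is exactly the vertical bundle. -/
structure GStructure (B : PrincipalBundle EM EP EG M P G) where
  /-- The representation. -/
  ρ : G →* (V →L[ℝ] V)
  smooth_ρ : ContMDiff 𝓘(ℝ, EG) 𝓘(ℝ, V →L[ℝ] V) ∞ ρ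
  finrank_eq : Module.finrank ℝ V = Module.finrank ℝ EM
  /-- The displacement form. -/
  θ : DiffForm EP P V 1
  smooth_θ : θ.IsSmooth
  equivariant : ∀ u g (X : EP), θ (B.act u g) ![B.dright g u X] = ρ g⁻¹ (θ u ![X])
  kernel : ∀ u (X : EP), θ u ![X] = 0 ↔ B.dproj u X = 0

namespace GStructure

variable {B : PrincipalBundle EM EP EG M P G} (S : GStructure V B)

/-- The torsion `τ = d_ω θ` of a connection. -/
def torsion (γ : PrincipalConnection B) : DiffForm EP P V 2 := γ.covDeriv S.θ

/-- The action of `g ∈ G` on `A(𝔤, V)`, induced by the coadjoint representation `λ ↦ λ ∘ Ad(g⁻¹)`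
on `𝔤*` and by the representation `ν ↦ ν ∘ ρ(g⁻¹)` on `V*`. -/
def action (g : G) : AAlg EG V →ₐ[ℝ] AAlg EG V :=
  AAlg.subst (Ad g⁻¹ : EG →L[ℝ] EG).toLinearMap (S.ρ g⁻¹).toLinearMap

/-- The subalgebra `A(𝔤, V)^G` of `G`-invariant elements. -/
def invariants : Subalgebra ℝ (AAlg EG V) :=
  ⨅ g : G, AlgHom.equalizer (S.action g) (AlgHom.id ℝ (AAlg EG V))

/-- The form `t^{Ω,θ} = t(Ω, …, Ω, θ, …, θ) = t ∘ (Ω ⊗_∧ ⋯ ⊗_∧ Ω ⊗_∧ θ ⊗_∧ ⋯ ⊗_∧ θ)` on `P`, for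
`t` in `(⨂^p 𝔤*) ⊗ (⨂^q V*)`, evaluated at tangent vectors `X₀, …, X_{2p+q-1}` at `u`; it is
`1/2^p ∑_σ sign(σ) t(Ω(X_{σ0}, X_{σ1}), Ω(X_{σ2}, X_{σ3}), …; θ(X_{σ(2p)}), θ(X_{σ(2p+1)}), …)`. -/
def charForm (γ : PrincipalConnection B) {p q : ℕ} (t : Tensors EG V p q) (u : P)
    (X : Fin (2 * p + q) → EP) : ℝ :=
  (2 ^ p : ℝ)⁻¹ * ∑ σ : Equiv.Perm (Fin (2 * p + q)), ((Equiv.Perm.sign σ : ℤ) : ℝ) *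
    evalTensor
      (fun i : Fin p => γ.curvature u ![X (σ ⟨2 * i, by omega⟩), X (σ ⟨2 * i + 1, by omega⟩)])
      (fun j : Fin q => S.θ u ![X (σ ⟨2 * p + j, by omega⟩)]) t

/-- The linear map `μ` is `f ↦ f(Ω, …, Ω, θ, …, θ)`: whenever the tensor `t` represents an invariant
element `f` of `S^p(𝔤*) ⊗ Λ^q(V*)`, the form `μ(f)` is homogeneous of degree `2p + q`, and its
pullback to `P` is `t^{Ω,θ}`. -/
def IsCharMap (γ : PrincipalConnection B) (μ : S.invariants →ₗ[ℝ] smoothForms EM M) : Prop :=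
  ∀ (p q : ℕ) (t : Tensors EG V p q) (ht : tensorClass t ∈ S.invariants),
    (∀ (u : P) (X : Fin (2 * p + q) → EP),
      (μ ⟨tensorClass t, ht⟩ : TotalForm EM M) (2 * p + q) (B.proj u)
        (fun i => B.dproj u (X i)) = S.charForm γ t u X) ∧
    ∀ k, k ≠ 2 * p + q → (μ ⟨tensorClass t, ht⟩ : TotalForm EM M) k = 0

end GStructure

end Bundles

end GenChernWeil

end

/-!
The algebra `A(𝔤, V)` is generated by the dual of `𝔤` and the dual of `V`. At a point, a `𝔤`-valued
two-form `W` and a `V`-valued one-form `θ` therefore define an algebra homomorphism from `A(𝔤, V)`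
to the exterior algebra of the cotangent space (`substHom`); it exists since elements of even degree
are central. Read as alternating forms, its values `f(W, …, W, θ, …, θ)` are given by the explicit
alternating sum (`substForm_tensorClass`), so that the sum is multiplicative in `f`
(`substForm_mul`). The curvature and the displacement form are horizontal and equivariant
(`PrincipalConnection.curvature_congr`, `PrincipalConnection.curvature_act`), hence for invariant `f`
the form descends to `M` (`GStructure.baseForm`). Its smoothness is seen by pulling back along
local sections, with the help of Cartan's structure equation
(`PrincipalConnection.curvature_pullback`). This is the homomorphism property.

For the dependence on the connection, let `ω₀` and `ω₁` be torsion-free. Then so is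
`ω_t = (1 - t) ω₀ + t ω₁` for all `t` (`PrincipalConnection.torsion_segment`). The connection on
`P × ℝ` that is `ω_t` on the slices has the curvature `Ω_t + dt ∧ (ω₁ - ω₀)`
(`PrincipalConnection.totalCurvature`), and substituting this curvature and `θ` gives a form on
`M × ℝ`. It is closed (`GStructure.extDeriv_totalCharPullback`): at a given point, pull back along a
section that is horizontal there (`PrincipalConnection.exists_gauge`); then the derivative of the
pulled back curvature vanishes at the point, because the quadratic term of the structure equation
has a double zero, and the derivative of `θ` vanishes because there is no torsion. By the Leibniz
rule the derivative of every polynomial in the curvature and `θ` vanishes at the point. The case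
`ω₀ = ω₁` shows that the characteristic forms are closed.

For a closed form on `M × ℝ`, the derivative in `t` of its restriction to `M × {t}` is the exterior
derivative of its contraction with `∂_t` (`GStructure.hasDerivAt_baseForm`). Integrating over
`[0, 1]` would show that the characteristic forms of `ω₀` and `ω₁` are cohomologous. As everything
is polynomial in `t` of a degree that does not depend on the point
(`GStructure.exists_baseForm_polynomial`), the integral equals a finite weighted sum of values at
fixed times (`exists_quadrature_sub`), so no differentiation under the integral sign is needed
(`GStructure.deRhamClass_charMap_eq`).
-/

noncomputable section

namespace GenChernWeil

/-! ### Antisymmetrization and the wedge product -/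

section Antisymmetrization

variable {E : Type*}

/-- The antisymmetrization `∑_σ sign(σ) R(X_{σ1}, …, X_{σn})` of an arbitrary function of `n`
arguments. -/
def altSum {n : ℕ} (R : (Fin n → E) → ℝ) (X : Fin n → E) : ℝ :=
  ∑ σ : Equiv.Perm (Fin n), ((Equiv.Perm.sign σ : ℤ) : ℝ) * R (X ∘ σ)

/-- The first `k` of `n = k + l` arguments. -/
def leftArgs {k l n : ℕ} (h : k + l = n) (X : Fin n → E) : Fin k → E :=
  fun i => X (Fin.cast h (Fin.castAdd l i))

/-- The last `l` of `n = k + l` arguments. -/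
def rightArgs {k l n : ℕ} (h : k + l = n) (X : Fin n → E) : Fin l → E :=
  fun j => X (Fin.cast h (Fin.natAdd k j))

/-- The product of two functions, the first of which takes the first `k` arguments, and the second
the remaining `l`. -/
def splitMul {k l n : ℕ} (h : k + l = n) (a : (Fin k → E) → ℝ) (b : (Fin l → E) → ℝ)
    (X : Fin n → E) : ℝ :=
  a (leftArgs h X) * b (rightArgs h X)

theorem altSum_comp_perm {n : ℕ} (R : (Fin n → E) → ℝ) (τ : Equiv.Perm (Fin n)) (X : Fin n → E) :
    altSum (fun Y => R (Y ∘ τ)) X = ((Equiv.Perm.sign τ : ℤ) : ℝ) * altSum R X := by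
  unfold altSum
  rw [Finset.mul_sum]
  refine Fintype.sum_equiv (Equiv.mulRight τ) _ _ fun σ => ?_
  have h : ((Equiv.Perm.sign τ : ℤ) : ℝ) * ((Equiv.Perm.sign τ : ℤ) : ℝ) = 1 := by
    rcases Int.units_eq_one_or (Equiv.Perm.sign τ) with h | h <;> simp [h]
  simp only [Equiv.coe_mulRight, Equiv.Perm.sign_mul, Units.val_mul, Int.cast_mul,
    Equiv.Perm.coe_mul]
  change _ * R (X ∘ σ ∘ τ) = _ * (_ * R (X ∘ σ ∘ τ))
  linear_combination (-((Equiv.Perm.sign σ : ℤ) : ℝ) * R (X ∘ σ ∘ τ)) * h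

theorem altSum_sum {n : ℕ} {ι : Type*} (s : Finset ι) (R : ι → (Fin n → E) → ℝ) (X : Fin n → E) :
    altSum (fun Y => ∑ i ∈ s, R i Y) X = ∑ i ∈ s, altSum (R i) X := by
  unfold altSum
  simp_rw [Finset.mul_sum]
  exact Finset.sum_comm

theorem altSum_const_mul {n : ℕ} (c : ℝ) (R : (Fin n → E) → ℝ) (X : Fin n → E) :
    altSum (fun Y => c * R Y) X = c * altSum R X := by
  unfold altSum
  rw [Finset.mul_sum]
  exact Finset.sum_congr rfl fun σ _ => by ring

/-- Antisymmetrizing in the last `l` arguments before antisymmetrizing in all arguments only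
produces the factor `l!`. -/
theorem altSum_altSum_right {k l n : ℕ} (h : k + l = n) (R : (Fin k → E) → (Fin l → E) → ℝ)
    (X : Fin n → E) :
    altSum (fun Y => altSum (R (leftArgs h Y)) (rightArgs h Y)) X =
      (l.factorial : ℝ) * altSum (fun Y => R (leftArgs h Y) (rightArgs h Y)) X := by
  subst h
  -- extend a permutation of the last `l` arguments by the identity
  let e : Equiv.Perm (Fin l) → Equiv.Perm (Fin (k + l)) := fun τ =>
    finSumFinEquiv.permCongr (Equiv.sumCongr (1 : Equiv.Perm (Fin k)) τ)
  have he : ∀ τ, Equiv.Perm.sign (e τ) = Equiv.Perm.sign τ := fun τ => by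
    simp only [e, Equiv.Perm.sign_permCongr]
    simp
  have key : (fun Y : Fin (k + l) → E => altSum (R (leftArgs rfl Y)) (rightArgs rfl Y)) = fun Y =>
      ∑ τ : Equiv.Perm (Fin l), ((Equiv.Perm.sign τ : ℤ) : ℝ) *
        R (leftArgs rfl (Y ∘ e τ)) (rightArgs rfl (Y ∘ e τ)) := by
    funext Y
    rw [altSum]
    refine Finset.sum_congr rfl fun τ _ => ?_
    have h1 : leftArgs rfl (Y ∘ e τ) = leftArgs rfl Y := by
      funext i; simp [e, Equiv.permCongr_apply, leftArgs]
    have h2 : rightArgs rfl (Y ∘ e τ) = rightArgs rfl Y ∘ τ := by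
      funext i; simp [e, Equiv.permCongr_apply, rightArgs]
    rw [h1, h2]
  rw [key, altSum_sum]
  have : ∀ τ : Equiv.Perm (Fin l), altSum (fun Y : Fin (k + l) → E =>
      ((Equiv.Perm.sign τ : ℤ) : ℝ) * R (leftArgs rfl (Y ∘ e τ)) (rightArgs rfl (Y ∘ e τ))) X =
      altSum (fun Y => R (leftArgs rfl Y) (rightArgs rfl Y)) X := fun τ => by
    rw [altSum_const_mul, altSum_comp_perm (fun Y => R (leftArgs rfl Y) (rightArgs rfl Y)), he,
      ← mul_assoc]
    rcases Int.units_eq_one_or (Equiv.Perm.sign τ) with h | h <;> simp [h]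
  simp [this, Fintype.card_perm]

/-- Antisymmetrizing in the first `k` arguments before antisymmetrizing in all arguments only
produces the factor `k!`. -/
theorem altSum_altSum_left {k l n : ℕ} (h : k + l = n) (R : (Fin k → E) → (Fin l → E) → ℝ)
    (X : Fin n → E) :
    altSum (fun Y => altSum (fun Z => R Z (rightArgs h Y)) (leftArgs h Y)) X =
      (k.factorial : ℝ) * altSum (fun Y => R (leftArgs h Y) (rightArgs h Y)) X := by
  subst h
  -- extend a permutation of the first `k` arguments by the identity
  let e : Equiv.Perm (Fin k) → Equiv.Perm (Fin (k + l)) := fun τ =>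
    finSumFinEquiv.permCongr (Equiv.sumCongr τ (1 : Equiv.Perm (Fin l)))
  have he : ∀ τ, Equiv.Perm.sign (e τ) = Equiv.Perm.sign τ := fun τ => by
    simp only [e, Equiv.Perm.sign_permCongr]
    simp
  have key : (fun Y : Fin (k + l) → E =>
      altSum (fun Z => R Z (rightArgs rfl Y)) (leftArgs rfl Y)) = fun Y =>
      ∑ τ : Equiv.Perm (Fin k), ((Equiv.Perm.sign τ : ℤ) : ℝ) *
        R (leftArgs rfl (Y ∘ e τ)) (rightArgs rfl (Y ∘ e τ)) := by
    funext Y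
    rw [altSum]
    refine Finset.sum_congr rfl fun τ _ => ?_
    have h1 : rightArgs rfl (Y ∘ e τ) = rightArgs rfl Y := by
      funext i; simp [e, Equiv.permCongr_apply, rightArgs]
    have h2 : leftArgs rfl (Y ∘ e τ) = leftArgs rfl Y ∘ τ := by
      funext i; simp [e, Equiv.permCongr_apply, leftArgs]
    rw [h1, h2]
  rw [key, altSum_sum]
  have : ∀ τ : Equiv.Perm (Fin k), altSum (fun Y : Fin (k + l) → E =>
      ((Equiv.Perm.sign τ : ℤ) : ℝ) * R (leftArgs rfl (Y ∘ e τ)) (rightArgs rfl (Y ∘ e τ))) X =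
      altSum (fun Y => R (leftArgs rfl Y) (rightArgs rfl Y)) X := fun τ => by
    rw [altSum_const_mul, altSum_comp_perm (fun Y => R (leftArgs rfl Y) (rightArgs rfl Y)), he,
      ← mul_assoc]
    rcases Int.units_eq_one_or (Equiv.Perm.sign τ) with h | h <;> simp [h]
  simp [this, Fintype.card_perm]

theorem altSum_splitMul_altSum_right {k l n : ℕ} (h : k + l = n) (a : (Fin k → E) → ℝ)
    (b : (Fin l → E) → ℝ) (X : Fin n → E) :
    altSum (splitMul h a (altSum b)) X = (l.factorial : ℝ) * altSum (splitMul h a b) X := by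
  refine Eq.trans ?_ (altSum_altSum_right h (fun Y Z => a Y * b Z) X)
  congr 1
  funext Y
  rw [altSum_const_mul]
  rfl

theorem altSum_splitMul_altSum_left {k l n : ℕ} (h : k + l = n) (a : (Fin k → E) → ℝ)
    (b : (Fin l → E) → ℝ) (X : Fin n → E) :
    altSum (splitMul h (altSum a) b) X = (k.factorial : ℝ) * altSum (splitMul h a b) X := by
  refine Eq.trans ?_ (altSum_altSum_left h (fun Y Z => a Y * b Z) X)
  congr 1
  funext Y
  simp_rw [mul_comm (a _)]
  rw [altSum_const_mul, mul_comm]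
  rfl

end Antisymmetrization

section Wedge

variable {E E' : Type*} [NormedAddCommGroup E] [NormedSpace ℝ E]
  [NormedAddCommGroup E'] [NormedSpace ℝ E']

theorem wedge_apply {k l n : ℕ} (h : k + l = n) (a : E [⋀^Fin k]→L[ℝ] ℝ)
    (b : E [⋀^Fin l]→L[ℝ] ℝ) (X : Fin n → E) :
    wedge h a b X = ((k.factorial : ℝ) * (l.factorial : ℝ))⁻¹ * altSum (splitMul h a b) X := by
  unfold wedge altSum
  rw [ContinuousAlternatingMap.smul_apply,
    ContinuousMultilinearMap.alternatization_apply_apply, smul_eq_mul]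
  congr 1
  refine Finset.sum_congr rfl fun σ _ => ?_
  rw [Units.smul_def, zsmul_eq_mul]
  rfl

theorem wedge_add_left {k l n : ℕ} (h : k + l = n) (a a' : E [⋀^Fin k]→L[ℝ] ℝ)
    (b : E [⋀^Fin l]→L[ℝ] ℝ) : wedge h (a + a') b = wedge h a b + wedge h a' b := by
  ext X
  simp only [wedge_apply, ContinuousAlternatingMap.add_apply, altSum, splitMul, add_mul, mul_add,
    Finset.sum_add_distrib]

theorem wedge_add_right {k l n : ℕ} (h : k + l = n) (a : E [⋀^Fin k]→L[ℝ] ℝ)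
    (b b' : E [⋀^Fin l]→L[ℝ] ℝ) : wedge h a (b + b') = wedge h a b + wedge h a b' := by
  ext X
  simp only [wedge_apply, ContinuousAlternatingMap.add_apply, altSum, splitMul, mul_add,
    Finset.sum_add_distrib]

theorem wedge_smul_left {k l n : ℕ} (h : k + l = n) (c : ℝ) (a : E [⋀^Fin k]→L[ℝ] ℝ)
    (b : E [⋀^Fin l]→L[ℝ] ℝ) : wedge h (c • a) b = c • wedge h a b := by
  ext X
  simp only [wedge_apply, ContinuousAlternatingMap.smul_apply, altSum, splitMul, smul_eq_mul,
    Finset.mul_sum]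
  exact Finset.sum_congr rfl fun σ _ => by ring

theorem wedge_smul_right {k l n : ℕ} (h : k + l = n) (c : ℝ) (a : E [⋀^Fin k]→L[ℝ] ℝ)
    (b : E [⋀^Fin l]→L[ℝ] ℝ) : wedge h a (c • b) = c • wedge h a b := by
  ext X
  simp only [wedge_apply, ContinuousAlternatingMap.smul_apply, altSum, splitMul, smul_eq_mul,
    Finset.mul_sum]
  exact Finset.sum_congr rfl fun σ _ => by ring

theorem wedge_compContinuousLinearMap {k l n : ℕ} (h : k + l = n) (a : E [⋀^Fin k]→L[ℝ] ℝ)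
    (b : E [⋀^Fin l]→L[ℝ] ℝ) (L : E' →L[ℝ] E) :
    (wedge h a b).compContinuousLinearMap L =
      wedge h (a.compContinuousLinearMap L) (b.compContinuousLinearMap L) := by
  ext X
  rw [ContinuousAlternatingMap.compContinuousLinearMap_apply, wedge_apply, wedge_apply]
  rfl

theorem norm_wedge_le {k l n : ℕ} (h : k + l = n) (a : E [⋀^Fin k]→L[ℝ] ℝ)
    (b : E [⋀^Fin l]→L[ℝ] ℝ) : ‖wedge h a b‖ ≤ (n.factorial : ℝ) * ‖a‖ * ‖b‖ := by
  subst h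
  refine ContinuousAlternatingMap.opNorm_le_bound _ (by positivity) fun X => ?_
  rw [wedge_apply, norm_mul]
  have h1 : ‖((k.factorial : ℝ) * (l.factorial : ℝ))⁻¹‖ ≤ 1 := by
    rw [Real.norm_of_nonneg (by positivity)]
    refine inv_le_one_of_one_le₀ ?_
    exact_mod_cast Nat.one_le_iff_ne_zero.2
      (Nat.mul_ne_zero (Nat.factorial_ne_zero k) (Nat.factorial_ne_zero l))
  have h2 : ‖altSum (splitMul rfl a b) X‖ ≤ ((k + l).factorial : ℝ) * ‖a‖ * ‖b‖ * ∏ i, ‖X i‖ := by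
    refine (norm_sum_le _ _).trans ?_
    have : ∀ σ ∈ (Finset.univ : Finset (Equiv.Perm (Fin (k + l)))),
        ‖((Equiv.Perm.sign σ : ℤ) : ℝ) * splitMul rfl a b (X ∘ σ)‖ ≤
          ‖a‖ * ‖b‖ * ∏ i, ‖X i‖ := fun σ _ => by
      have hs : ‖((Equiv.Perm.sign σ : ℤ) : ℝ)‖ = 1 := by
        rcases Int.units_eq_one_or (Equiv.Perm.sign σ) with h | h <;> simp [h]
      rw [norm_mul, hs, one_mul, splitMul, norm_mul, ← Equiv.prod_comp σ (fun i => ‖X i‖),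
        Fin.prod_univ_add]
      calc _ ≤ (‖a‖ * ∏ i, ‖(X ∘ σ) (Fin.castAdd l i)‖) *
          (‖b‖ * ∏ i, ‖(X ∘ σ) (Fin.natAdd k i)‖) :=
            mul_le_mul (a.le_opNorm _) (b.le_opNorm _) (norm_nonneg _) (by positivity)
        _ = _ := by simp only [Function.comp]; ring
    refine (Finset.sum_le_sum this).trans (le_of_eq ?_)
    simp [Fintype.card_perm]; ring
  calc _ ≤ 1 * (((k + l).factorial : ℝ) * ‖a‖ * ‖b‖ * ∏ i, ‖X i‖) :=
        mul_le_mul h1 h2 (norm_nonneg _) zero_le_one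
    _ = _ := one_mul _

/-- The wedge product as a continuous bilinear map. -/
def wedgeCLM (E : Type*) [NormedAddCommGroup E] [NormedSpace ℝ E] {k l n : ℕ} (h : k + l = n) :
    (E [⋀^Fin k]→L[ℝ] ℝ) →L[ℝ] (E [⋀^Fin l]→L[ℝ] ℝ) →L[ℝ] (E [⋀^Fin n]→L[ℝ] ℝ) :=
  LinearMap.mkContinuous₂ (LinearMap.mk₂ ℝ (wedge h) (wedge_add_left h) (wedge_smul_left h)
    (wedge_add_right h) (fun c a b => wedge_smul_right h c a b)) (n.factorial : ℝ)
    (norm_wedge_le h)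

@[simp]
theorem wedgeCLM_apply {k l n : ℕ} (h : k + l = n) (a : E [⋀^Fin k]→L[ℝ] ℝ)
    (b : E [⋀^Fin l]→L[ℝ] ℝ) : wedgeCLM E h a b = wedge h a b := rfl

@[simp]
theorem wedge_zero_left {k l n : ℕ} (h : k + l = n) (b : E [⋀^Fin l]→L[ℝ] ℝ) :
    wedge h (0 : E [⋀^Fin k]→L[ℝ] ℝ) b = 0 := by
  rw [← wedgeCLM_apply]; simp

@[simp]
theorem wedge_zero_right {k l n : ℕ} (h : k + l = n) (a : E [⋀^Fin k]→L[ℝ] ℝ) :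
    wedge h a (0 : E [⋀^Fin l]→L[ℝ] ℝ) = 0 :=
  (wedgeCLM E h a).map_zero

/-- The component of degree `n` of the product of two inhomogeneous alternating forms. -/
def wedgeSum (a b : ∀ k : ℕ, E [⋀^Fin k]→L[ℝ] ℝ) (n : ℕ) : E [⋀^Fin n]→L[ℝ] ℝ :=
  ∑ ij : Finset.HasAntidiagonal.antidiagonal n,
    wedge (Finset.HasAntidiagonal.mem_antidiagonal.1 ij.2) (a ij.1.1) (b ij.1.2)

theorem wedgeSum_congr {a a' b b' : ∀ k : ℕ, E [⋀^Fin k]→L[ℝ] ℝ} (ha : ∀ k, a k = a' k)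
    (hb : ∀ k, b k = b' k) (n : ℕ) : wedgeSum a b n = wedgeSum a' b' n := by
  rw [funext ha, funext hb]

theorem wedgeSum_eq_of_ne_zero {a b : ∀ k : ℕ, E [⋀^Fin k]→L[ℝ] ℝ} {k l n : ℕ} (h : k + l = n)
    (ha : ∀ i, i ≠ k → a i = 0) : wedgeSum a b n = wedge h (a k) (b l) := by
  unfold wedgeSum
  rw [Finset.sum_eq_single
    (⟨(k, l), Finset.HasAntidiagonal.mem_antidiagonal.2 h⟩ :
      (Finset.HasAntidiagonal.antidiagonal n : Finset (ℕ × ℕ)))]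
  · rintro ⟨⟨i, j⟩, hij⟩ - hne
    have : i ≠ k := by
      rintro rfl
      have := Finset.HasAntidiagonal.mem_antidiagonal.1 hij
      apply hne
      simp only [Subtype.mk.injEq, Prod.mk.injEq, true_and]
      omega
    simp [ha i this]
  · simp

theorem wedgeSum_eq_zero_of_lt {a b : ∀ k : ℕ, E [⋀^Fin k]→L[ℝ] ℝ} {k n : ℕ} (h : n < k)
    (ha : ∀ i, i ≠ k → a i = 0) : wedgeSum a b n = 0 := by
  refine Finset.sum_eq_zero ?_
  rintro ⟨⟨i, j⟩, hij⟩ -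
  have h1 := Finset.HasAntidiagonal.mem_antidiagonal.1 hij
  have : i ≠ k := by
    rintro rfl
    simp only at h1
    omega
  simp [ha i this]

end Wedge

/-! ### Two-forms as bilinear maps -/

section TwoForms

variable {E F : Type*} [NormedAddCommGroup E] [NormedSpace ℝ E]
  [NormedAddCommGroup F] [NormedSpace ℝ F]

/-- A two-form as a bilinear map. -/
def twoFormBilin (w : E [⋀^Fin 2]→L[ℝ] F) : E →ₗ[ℝ] E →ₗ[ℝ] F :=
  have hl : ∀ s v : E, w ![v, s] = w.toContinuousLinearMap ![0, s] 0 v := fun s v =>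
    congrArg w (by ext i; fin_cases i <;> simp)
  have hr : ∀ s v : E, w ![s, v] = w.toContinuousLinearMap ![s, 0] 1 v := fun s v =>
    congrArg w (by ext i; fin_cases i <;> simp)
  LinearMap.mk₂ ℝ (fun v v' => w ![v, v'])
    (fun v v' s => by rw [hl, hl, hl, map_add]) (fun c v s => by rw [hl, hl, map_smul])
    (fun s v v' => by rw [hr, hr, hr, map_add]) (fun c s v => by rw [hr, hr, map_smul])

theorem twoFormBilin_apply (w : E [⋀^Fin 2]→L[ℝ] F) (v v' : E) :
    twoFormBilin w v v' = w ![v, v'] := rfl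

theorem twoForm_swap (w : E [⋀^Fin 2]→L[ℝ] F) (v v' : E) : w ![v', v] = - w ![v, v'] := by
  have := w.toAlternatingMap.map_swap ![v, v'] (i := 0) (j := 1) (by decide)
  have h2 : ![v, v'] ∘ (Equiv.swap (0 : Fin 2) 1) = ![v', v] := by
    ext i; fin_cases i <;> rfl
  rw [h2] at this
  exact this

end TwoForms

/-! ### From the exterior algebra of the dual space to alternating forms -/

section ExteriorToForms

variable {E : Type*} [NormedAddCommGroup E] [NormedSpace ℝ E]

/-- The alternating form `λ₁ ∧ ⋯ ∧ λ_n`, i.e. `X ↦ det (λ_i (X_j))`, as an alternating function of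
the covectors `λ_i`. -/
def covectorWedge (E : Type*) [NormedAddCommGroup E] [NormedSpace ℝ E] (n : ℕ) :
    (E →L[ℝ] ℝ) [⋀^Fin n]→ₗ[ℝ] (E [⋀^Fin n]→L[ℝ] ℝ) :=
  have key : ∀ (l : Fin n → E →L[ℝ] ℝ) (X : Fin n → E),
      ContinuousMultilinearMap.alternatization
        ((ContinuousMultilinearMap.mkPiAlgebra ℝ (Fin n) ℝ).compContinuousLinearMap l) X =
      (Matrix.detRowAlternating (R := ℝ) (n := Fin n)).compLinearMap
        (LinearMap.pi fun j => (ContinuousLinearMap.apply ℝ ℝ (X j)).toLinearMap) l := by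
    intro l X
    rw [ContinuousMultilinearMap.alternatization_apply_apply, AlternatingMap.compLinearMap_apply]
    change _ = Matrix.det (Matrix.of fun i j => l i (X j))
    rw [← Matrix.det_transpose, Matrix.det_apply]
    simp [Matrix.transpose]
  { toFun := fun l => ContinuousMultilinearMap.alternatization
      ((ContinuousMultilinearMap.mkPiAlgebra ℝ (Fin n) ℝ).compContinuousLinearMap l)
    map_update_add' := by
      intro _ l i x y
      ext X
      rw [ContinuousAlternatingMap.add_apply, key, key, key]
      exact AlternatingMap.map_update_add _ _ _ _ _
    map_update_smul' := by
      intro _ l i c x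
      ext X
      rw [ContinuousAlternatingMap.smul_apply, key, key]
      exact AlternatingMap.map_update_smul _ _ _ _ _
    map_eq_zero_of_eq' := by
      intro l i j h hij
      ext X
      rw [key]
      exact AlternatingMap.map_eq_zero_of_eq _ _ h hij }

theorem covectorWedge_apply {n : ℕ} (l : Fin n → E →L[ℝ] ℝ) (X : Fin n → E) :
    covectorWedge E n l X = altSum (fun Y => ∏ i, l i (Y i)) X := by
  change ContinuousMultilinearMap.alternatization _ X = _
  rw [ContinuousMultilinearMap.alternatization_apply_apply]
  unfold altSum
  refine Finset.sum_congr rfl fun σ _ => ?_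
  rw [Units.smul_def, zsmul_eq_mul]
  rfl

theorem wedge_covectorWedge {k l n : ℕ} (h : k + l = n) (a : Fin k → E →L[ℝ] ℝ)
    (b : Fin l → E →L[ℝ] ℝ) :
    wedge h (covectorWedge E k a) (covectorWedge E l b) =
      covectorWedge E n (fun i => Fin.append a b (Fin.cast h.symm i)) := by
  ext X
  have hk : (k.factorial : ℝ) ≠ 0 := by exact_mod_cast Nat.factorial_ne_zero k
  have hl : (l.factorial : ℝ) ≠ 0 := by exact_mod_cast Nat.factorial_ne_zero l
  rw [wedge_apply, funext (covectorWedge_apply a), funext (covectorWedge_apply b)]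
  change _ * altSum (splitMul h (altSum fun Y => ∏ i, a i (Y i))
    (altSum fun Y => ∏ i, b i (Y i))) X = _
  rw [altSum_splitMul_altSum_left, altSum_splitMul_altSum_right, covectorWedge_apply]
  subst h
  have : splitMul rfl (fun Y : Fin k → E => ∏ i, a i (Y i)) (fun Y : Fin l → E => ∏ i, b i (Y i)) =
      fun Y : Fin (k + l) → E => ∏ i, (Fin.append a b (Fin.cast rfl i)) (Y i) := by
    funext Y
    simp [splitMul, leftArgs, rightArgs, Fin.prod_univ_add]
  rw [this]
  field_simp

/-- The component of degree `n` of the alternating form corresponding to an element of the exterior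
algebra of the dual space. -/
def extForm (E : Type*) [NormedAddCommGroup E] [NormedSpace ℝ E] (n : ℕ) :
    ExteriorAlgebra ℝ (E →L[ℝ] ℝ) →ₗ[ℝ] (E [⋀^Fin n]→L[ℝ] ℝ) :=
  ExteriorAlgebra.liftAlternating (Pi.single n (covectorWedge E n))

theorem extForm_ιMulti_self {n : ℕ} (l : Fin n → E →L[ℝ] ℝ) :
    extForm E n (ExteriorAlgebra.ιMulti ℝ n l) = covectorWedge E n l := by
  rw [extForm, ExteriorAlgebra.liftAlternating_apply_ιMulti, Pi.single_eq_same]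

theorem extForm_ιMulti_of_ne {k n : ℕ} (h : k ≠ n) (l : Fin k → E →L[ℝ] ℝ) :
    extForm E n (ExteriorAlgebra.ιMulti ℝ k l) = 0 := by
  rw [extForm, ExteriorAlgebra.liftAlternating_apply_ιMulti, Pi.single_eq_of_ne h]
  rfl

/-- The correspondence between the exterior algebra and alternating forms is multiplicative. By
linearity it suffices to compare products of covectors. -/
theorem extForm_mul (x y : ExteriorAlgebra ℝ (E →L[ℝ] ℝ)) (n : ℕ) :
    extForm E n (x * y) = wedgeSum (fun k => extForm E k x) (fun k => extForm E k y) n := by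
  have hx := ExteriorAlgebra.ιMulti_span ℝ (E →L[ℝ] ℝ)
  have hx' : x ∈ Submodule.span ℝ (Set.range fun z : Σ k, (Fin k → (E →L[ℝ] ℝ)) =>
      ExteriorAlgebra.ιMulti ℝ z.1 z.2) := by rw [hx]; trivial
  have hy' : y ∈ Submodule.span ℝ (Set.range fun z : Σ k, (Fin k → (E →L[ℝ] ℝ)) =>
      ExteriorAlgebra.ιMulti ℝ z.1 z.2) := by rw [hx]; trivial
  clear hx
  induction hx' using Submodule.span_induction with
  | mem x hx =>
    obtain ⟨⟨k, a⟩, rfl⟩ := hx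
    induction hy' using Submodule.span_induction with
    | mem y hy =>
      obtain ⟨⟨l, b⟩, rfl⟩ := hy
      have h0 : ∀ i, i ≠ k → extForm E i (ExteriorAlgebra.ιMulti ℝ k a) = 0 :=
        fun i hi => extForm_ιMulti_of_ne hi.symm a
      simp only
      rw [ExteriorAlgebra.ιMulti_mul_ιMulti]
      by_cases hn : k + l = n
      · rw [wedgeSum_eq_of_ne_zero hn h0, extForm_ιMulti_self, extForm_ιMulti_self,
          wedge_covectorWedge]
        subst hn
        exact extForm_ιMulti_self _
      · rw [extForm_ιMulti_of_ne hn]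
        rcases lt_or_ge n k with hlt | hge
        · rw [wedgeSum_eq_zero_of_lt hlt h0]
        · obtain ⟨j, rfl⟩ := Nat.exists_eq_add_of_le hge
          rw [wedgeSum_eq_of_ne_zero rfl h0, extForm_ιMulti_of_ne (by omega : l ≠ j),
            wedge_zero_right]
    | zero => simp [wedgeSum]
    | add y y' _ _ hy hy' =>
      rw [mul_add, map_add, hy, hy']
      simp [wedgeSum, wedge_add_right, Finset.sum_add_distrib]
    | smul c y _ hy =>
      rw [mul_smul_comm, map_smul, hy]
      simp [wedgeSum, wedge_smul_right, Finset.smul_sum]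
  | zero => simp [wedgeSum]
  | add x x' _ _ hx hx' =>
    rw [add_mul, map_add, hx, hx']
    simp [wedgeSum, wedge_add_left, Finset.sum_add_distrib]
  | smul c x _ hx =>
    rw [smul_mul_assoc, map_smul, hx]
    simp [wedgeSum, wedge_smul_left, Finset.smul_sum]

theorem extForm_algebraMap_zero (r : ℝ) :
    extForm E 0 (algebraMap ℝ _ r) = ContinuousAlternatingMap.constOfIsEmpty ℝ _ (Fin 0) r := by
  rw [Algebra.algebraMap_eq_smul_one, ← ExteriorAlgebra.ιMulti_zero_apply (R := ℝ) 0, map_smul,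
    extForm_ιMulti_self]
  ext X
  simp [covectorWedge_apply, altSum]

theorem extForm_algebraMap_of_ne {n : ℕ} (hn : n ≠ 0) (r : ℝ) :
    extForm E n (algebraMap ℝ _ r) = 0 := by
  rw [Algebra.algebraMap_eq_smul_one, ← ExteriorAlgebra.ιMulti_zero_apply (R := ℝ) 0, map_smul,
    extForm_ιMulti_of_ne hn.symm, smul_zero]

theorem ιMulti_one (l : E →L[ℝ] ℝ) :
    ExteriorAlgebra.ιMulti ℝ 1 ![l] = ExteriorAlgebra.ι ℝ l := by
  simp [ExteriorAlgebra.ιMulti_apply]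

theorem extForm_ι_one (l : E →L[ℝ] ℝ) :
    extForm E 1 (ExteriorAlgebra.ι ℝ l) = ContinuousAlternatingMap.ofSubsingleton ℝ E ℝ 0 l := by
  rw [← ιMulti_one, extForm_ιMulti_self]
  ext X
  simp [covectorWedge_apply, altSum]

theorem extForm_ι_of_ne {n : ℕ} (hn : n ≠ 1) (l : E →L[ℝ] ℝ) :
    extForm E n (ExteriorAlgebra.ι ℝ l) = 0 := by
  rw [← ιMulti_one, extForm_ιMulti_of_ne hn.symm]

theorem ι_mul_ι_mul_eq (a b c : E →L[ℝ] ℝ) :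
    ExteriorAlgebra.ι ℝ a * ExteriorAlgebra.ι ℝ b * ExteriorAlgebra.ι ℝ c =
      ExteriorAlgebra.ι ℝ c * (ExteriorAlgebra.ι ℝ a * ExteriorAlgebra.ι ℝ b) := by
  have h1 := eq_neg_of_add_eq_zero_left (ExteriorAlgebra.ι_add_mul_swap (R := ℝ) b c)
  have h2 := eq_neg_of_add_eq_zero_left (ExteriorAlgebra.ι_add_mul_swap (R := ℝ) a c)
  rw [mul_assoc, h1, mul_neg, ← mul_assoc, h2, neg_mul, neg_neg, mul_assoc]

/-- Elements of degree two of the exterior algebra are central, as a product of two covectors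
commutes with every covector. -/
theorem ι_mul_ι_mem_center (a b : E →L[ℝ] ℝ) :
    ExteriorAlgebra.ι ℝ a * ExteriorAlgebra.ι ℝ b ∈
      Subalgebra.center ℝ (ExteriorAlgebra ℝ (E →L[ℝ] ℝ)) := by
  rw [Subalgebra.mem_center_iff]
  intro x
  induction x using ExteriorAlgebra.induction with
  | algebraMap r => exact Algebra.commutes r _
  | ι c => exact (ι_mul_ι_mul_eq a b c).symm
  | mul x y hx hy => rw [mul_assoc, hy, ← mul_assoc, hx, mul_assoc]
  | add x y hx hy => rw [add_mul, mul_add, hx, hy]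

variable [FiniteDimensional ℝ E]

/-- The coordinates of a basis of `E`, as continuous covectors. -/
def coord (E : Type*) [NormedAddCommGroup E] [NormedSpace ℝ E] [FiniteDimensional ℝ E]
    (i : Fin (Module.finrank ℝ E)) : E →L[ℝ] ℝ :=
  LinearMap.toContinuousLinearMap ((Module.finBasis ℝ E).coord i)

/-- The central element of the exterior algebra corresponding to a two-form `w`, that is,
`1/2 ∑ w(e_i, e_j) e^i e^j`. -/
def twoFormElt (E : Type*) [NormedAddCommGroup E] [NormedSpace ℝ E] [FiniteDimensional ℝ E] :
    (E [⋀^Fin 2]→L[ℝ] ℝ) →ₗ[ℝ] Subalgebra.center ℝ (ExteriorAlgebra ℝ (E →L[ℝ] ℝ)) where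
  toFun w := ∑ i, ∑ j, (2⁻¹ * w ![Module.finBasis ℝ E i, Module.finBasis ℝ E j]) •
    ⟨ExteriorAlgebra.ι ℝ (coord E i) * ExteriorAlgebra.ι ℝ (coord E j),
      ι_mul_ι_mem_center _ _⟩
  map_add' w w' := by
    simp only [ContinuousAlternatingMap.add_apply, mul_add, add_smul, Finset.sum_add_distrib]
  map_smul' c w := by
    simp only [ContinuousAlternatingMap.smul_apply, smul_eq_mul, mul_left_comm _ c, mul_smul,
      Finset.smul_sum, RingHom.id_apply]

theorem coe_twoFormElt (w : E [⋀^Fin 2]→L[ℝ] ℝ) :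
    (twoFormElt E w : ExteriorAlgebra ℝ (E →L[ℝ] ℝ)) =
      ∑ i, ∑ j, (2⁻¹ * w ![Module.finBasis ℝ E i, Module.finBasis ℝ E j]) •
        ExteriorAlgebra.ιMulti ℝ 2 ![coord E i, coord E j] := by
  simp only [twoFormElt, LinearMap.coe_mk, AddHom.coe_mk, AddSubmonoidClass.coe_finsetSum,
    Subalgebra.coe_smul]
  simp [ExteriorAlgebra.ιMulti_apply]

theorem extForm_twoFormElt_of_ne {n : ℕ} (hn : n ≠ 2) (w : E [⋀^Fin 2]→L[ℝ] ℝ) :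
    extForm E n (twoFormElt E w) = 0 := by
  rw [coe_twoFormElt, map_sum]
  refine Finset.sum_eq_zero fun i _ => ?_
  rw [map_sum]
  refine Finset.sum_eq_zero fun j _ => ?_
  rw [map_smul, extForm_ιMulti_of_ne hn.symm, smul_zero]

theorem extForm_two_twoFormElt (w : E [⋀^Fin 2]→L[ℝ] ℝ) : extForm E 2 (twoFormElt E w) = w := by
  rw [coe_twoFormElt]
  ext X
  have hX : ∀ v : E, v = ∑ i, coord E i v • Module.finBasis ℝ E i := fun v =>
    ((Module.finBasis ℝ E).sum_repr v).symm
  have hw : ∀ v v' : E, w ![v, v'] = ∑ i, ∑ j, (coord E i v * coord E j v') *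
      w ![Module.finBasis ℝ E i, Module.finBasis ℝ E j] := by
    intro v v'
    conv_lhs => rw [hX v, hX v']
    have e1 : ∀ (s : E), ∀ (f : Fin (Module.finrank ℝ E) → ℝ),
        w ![∑ i, f i • Module.finBasis ℝ E i, s] =
          ∑ i, f i * w ![Module.finBasis ℝ E i, s] := fun s f => by
      simp only [← twoFormBilin_apply, map_sum, map_smul, LinearMap.sum_apply,
        LinearMap.smul_apply, smul_eq_mul]
    have e2 : ∀ (s : E), ∀ (f : Fin (Module.finrank ℝ E) → ℝ),
        w ![s, ∑ i, f i • Module.finBasis ℝ E i] =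
          ∑ i, f i * w ![s, Module.finBasis ℝ E i] := fun s f => by
      simp only [← twoFormBilin_apply, map_sum, map_smul, smul_eq_mul]
    rw [e1]
    refine Finset.sum_congr rfl fun i _ => ?_
    rw [e2, Finset.mul_sum]
    exact Finset.sum_congr rfl fun j _ => by ring
  have hX2 : X = ![X 0, X 1] := by ext i; fin_cases i <;> rfl
  have hswap : w ![X 1, X 0] = - w ![X 0, X 1] := twoForm_swap w _ _
  simp only [map_sum, map_smul, extForm_ιMulti_self, ContinuousAlternatingMap.sum_apply,
    ContinuousAlternatingMap.smul_apply, covectorWedge_apply]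
  have hs : ∀ i j, altSum (fun Y : Fin 2 → E => ∏ k, ![coord E i, coord E j] k (Y k)) X =
      coord E i (X 0) * coord E j (X 1) - coord E i (X 1) * coord E j (X 0) := by
    intro i j
    unfold altSum
    rw [show (Finset.univ : Finset (Equiv.Perm (Fin 2))) = {1, Equiv.swap 0 1} from by decide,
      Finset.sum_insert (by decide), Finset.sum_singleton]
    simp
    ring
  simp only [hs, smul_eq_mul]
  conv_rhs => rw [hX2, show w ![X 0, X 1] = 2⁻¹ * (w ![X 0, X 1] - w ![X 1, X 0]) by
    rw [hswap]; ring, hw, hw, ← Finset.sum_sub_distrib, Finset.mul_sum]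
  refine Finset.sum_congr rfl fun i _ => ?_
  rw [← Finset.sum_sub_distrib, Finset.mul_sum]
  exact Finset.sum_congr rfl fun j _ => by ring

end ExteriorToForms

/-! ### Substituting forms into elements of `A(𝔤, V)` -/

section Substitution

/-- To prove a property of all elements of `A(𝔤, V)`, it suffices to prove it for the generators and
that it is compatible with sums and products. -/
theorem AAlg.induction {𝔤 V : Type*} [AddCommGroup 𝔤] [Module ℝ 𝔤] [AddCommGroup V] [Module ℝ V]
    {p : AAlg 𝔤 V → Prop} (halg : ∀ r : ℝ, p (algebraMap ℝ _ r))
    (hsymm : ∀ l : Module.Dual ℝ 𝔤, p (SymmetricAlgebra.ι ℝ _ l ⊗ₜ 1))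
    (hext : ∀ l : Module.Dual ℝ V, p (1 ⊗ₜ ExteriorAlgebra.ι ℝ l))
    (hmul : ∀ f g, p f → p g → p (f * g)) (hadd : ∀ f g, p f → p g → p (f + g))
    (f : AAlg 𝔤 V) : p f := by
  induction f using TensorProduct.induction_on with
  | zero => simpa using halg 0
  | add f g hf hg => exact hadd f g hf hg
  | tmul x y =>
    have h : x ⊗ₜ[ℝ] y = (x ⊗ₜ[ℝ] (1 : ExteriorAlgebra ℝ (Module.Dual ℝ V))) *
        ((1 : SymmetricAlgebra ℝ (Module.Dual ℝ 𝔤)) ⊗ₜ[ℝ] y) := by simp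
    rw [h]
    refine hmul _ _ ?_ ?_
    · induction x using SymmetricAlgebra.induction with
      | algebraMap r => exact halg r
      | ι l => exact hsymm l
      | mul a b ha hb =>
        have := hmul _ _ (ha (by simp)) (hb (by simp))
        simpa using this
      | add a b ha hb =>
        rw [TensorProduct.add_tmul]
        exact hadd _ _ (ha (by simp)) (hb (by simp))
    · clear h
      induction y using ExteriorAlgebra.induction with
      | algebraMap r =>
        have := halg r
        rwa [Algebra.TensorProduct.algebraMap_apply'] at this
      | ι l => exact hext l
      | mul a b ha hb =>
        have := hmul _ _ ha hb
        simpa using this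
      | add a b ha hb =>
        rw [TensorProduct.tmul_add]
        exact hadd _ _ ha hb

theorem tensorClass_tprod {𝔤 V : Type*} [AddCommGroup 𝔤] [Module ℝ 𝔤] [AddCommGroup V]
    [Module ℝ V] {p q : ℕ}
    (a : Fin p → Module.Dual ℝ 𝔤) (b : Fin q → Module.Dual ℝ V) :
    tensorClass (PiTensorProduct.tprod ℝ a ⊗ₜ PiTensorProduct.tprod ℝ b) =
      (List.ofFn fun i => SymmetricAlgebra.ι ℝ _ (a i)).prod ⊗ₜ
        (List.ofFn fun i => ExteriorAlgebra.ι ℝ (b i)).prod := by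
  simp only [tensorClass, TensorProduct.map_tmul, LinearMap.comp_apply,
    TensorPower.toTensorAlgebra_tprod, TensorAlgebra.tprod_apply, AlgHom.toLinearMap_apply,
    map_list_prod, List.map_ofFn]
  congr 3
  funext i
  simp

theorem Tensors.induction {𝔤 V : Type*} [AddCommGroup 𝔤] [Module ℝ 𝔤] [AddCommGroup V]
    [Module ℝ V] {p q : ℕ} {P : Tensors 𝔤 V p q → Prop}
    (htprod : ∀ (a : Fin p → Module.Dual ℝ 𝔤) (b : Fin q → Module.Dual ℝ V),
      P (PiTensorProduct.tprod ℝ a ⊗ₜ PiTensorProduct.tprod ℝ b))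
    (hadd : ∀ t t', P t → P t' → P (t + t')) (hsmul : ∀ (c : ℝ) t, P t → P (c • t))
    (t : Tensors 𝔤 V p q) : P t := by
  have h0 : P 0 := by
    have := hsmul 0 _ (htprod 0 0)
    rwa [zero_smul] at this
  induction t using TensorProduct.induction_on with
  | zero => exact h0
  | add t t' h h' => exact hadd t t' h h'
  | tmul x y =>
    induction x using PiTensorProduct.induction_on with
    | smul_tprod c a =>
      rw [← TensorProduct.smul_tmul']
      apply hsmul
      induction y using PiTensorProduct.induction_on with
      | smul_tprod c b =>
        rw [TensorProduct.tmul_smul]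
        exact hsmul _ _ (htprod a b)
      | add y y' h h' =>
        rw [TensorProduct.tmul_add]
        exact hadd _ _ h h'
    | add x x' h h' =>
      rw [TensorProduct.add_tmul]
      exact hadd _ _ h h'

variable {𝔤 V E E' : Type*} [NormedAddCommGroup 𝔤] [NormedSpace ℝ 𝔤] [FiniteDimensional ℝ 𝔤]
  [NormedAddCommGroup V] [NormedSpace ℝ V] [FiniteDimensional ℝ V]
  [NormedAddCommGroup E] [NormedSpace ℝ E] [NormedAddCommGroup E'] [NormedSpace ℝ E']

/-- The composition `l ∘ w` of a linear form `l` with a vector-valued alternating form `w`, which is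
linear in `l`. -/
def dualComp {F : Type*} [NormedAddCommGroup F] [NormedSpace ℝ F] [FiniteDimensional ℝ F] {k : ℕ}
    (w : E [⋀^Fin k]→L[ℝ] F) : Module.Dual ℝ F →ₗ[ℝ] (E [⋀^Fin k]→L[ℝ] ℝ) where
  toFun l := (LinearMap.toContinuousLinearMap l).compContinuousAlternatingMap w
  map_add' l l' := by ext; simp
  map_smul' c l := by ext; simp

@[simp]
theorem dualComp_apply {F : Type*} [NormedAddCommGroup F] [NormedSpace ℝ F]
    [FiniteDimensional ℝ F] {k : ℕ} (w : E [⋀^Fin k]→L[ℝ] F) (l : Module.Dual ℝ F)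
    (X : Fin k → E) : dualComp w l X = l (w X) := rfl

/-- One-forms as covectors. -/
def covector (E : Type*) [NormedAddCommGroup E] [NormedSpace ℝ E] :
    (E [⋀^Fin 1]→L[ℝ] ℝ) →ₗ[ℝ] (E →L[ℝ] ℝ) where
  toFun a := (ContinuousAlternatingMap.ofSubsingleton ℝ E ℝ 0).symm a
  map_add' _ _ := rfl
  map_smul' _ _ := rfl

theorem wedgeSum_compContinuousLinearMap (a b : ∀ k : ℕ, E [⋀^Fin k]→L[ℝ] ℝ) (n : ℕ)
    (L : E' →L[ℝ] E) :
    (wedgeSum a b n).compContinuousLinearMap L =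
      wedgeSum (fun k => (a k).compContinuousLinearMap L)
        (fun k => (b k).compContinuousLinearMap L) n := by
  simp only [wedgeSum, ← wedge_compContinuousLinearMap]
  ext X
  simp [ContinuousAlternatingMap.sum_apply]

/-- The part of `substHom` on the exterior algebra. -/
def substExt (θ : E [⋀^Fin 1]→L[ℝ] V) :
    ExteriorAlgebra ℝ (Module.Dual ℝ V) →ₐ[ℝ] ExteriorAlgebra ℝ (E →L[ℝ] ℝ) :=
  ExteriorAlgebra.lift ℝ ⟨ExteriorAlgebra.ι ℝ ∘ₗ covector E ∘ₗ dualComp θ,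
    fun _ => ExteriorAlgebra.ι_sq_zero _⟩

theorem substExt_ι (θ : E [⋀^Fin 1]→L[ℝ] V) (l : Module.Dual ℝ V) :
    substExt θ (ExteriorAlgebra.ι ℝ l) = ExteriorAlgebra.ι ℝ (covector E (dualComp θ l)) := by
  simp [substExt]

variable [FiniteDimensional ℝ E] [FiniteDimensional ℝ E']

/-- The part of `substHom` on the symmetric algebra. Its values are in the center. -/
def substSymm (W : E [⋀^Fin 2]→L[ℝ] 𝔤) : SymmetricAlgebra ℝ (Module.Dual ℝ 𝔤) →ₐ[ℝ]
    Subalgebra.center ℝ (ExteriorAlgebra ℝ (E →L[ℝ] ℝ)) :=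
  SymmetricAlgebra.lift (twoFormElt E ∘ₗ dualComp W)

theorem commute_substSymm (W : E [⋀^Fin 2]→L[ℝ] 𝔤) (x : SymmetricAlgebra ℝ (Module.Dual ℝ 𝔤))
    (z : ExteriorAlgebra ℝ (E →L[ℝ] ℝ)) :
    Commute (((Subalgebra.center ℝ (ExteriorAlgebra ℝ (E →L[ℝ] ℝ))).val.comp (substSymm W)) x) z :=
  (Subalgebra.mem_center_iff.1 (substSymm W x).2 z).symm

/-- The algebra homomorphism from `A(𝔤, V)` to the exterior algebra of the dual of `E` obtained by
substituting a `𝔤`-valued two-form `W` and a `V`-valued one-form `θ` on `E` for the arguments. It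
exists since the even elements of the exterior algebra are central. -/
def substHom (W : E [⋀^Fin 2]→L[ℝ] 𝔤) (θ : E [⋀^Fin 1]→L[ℝ] V) :
    AAlg 𝔤 V →ₐ[ℝ] ExteriorAlgebra ℝ (E →L[ℝ] ℝ) :=
  Algebra.TensorProduct.lift
    ((Subalgebra.center ℝ (ExteriorAlgebra ℝ (E →L[ℝ] ℝ))).val.comp (substSymm W)) (substExt θ)
    (fun x _ => commute_substSymm W x _)

theorem substHom_tmul (W : E [⋀^Fin 2]→L[ℝ] 𝔤) (θ : E [⋀^Fin 1]→L[ℝ] V)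
    (x : SymmetricAlgebra ℝ (Module.Dual ℝ 𝔤)) (y : ExteriorAlgebra ℝ (Module.Dual ℝ V)) :
    substHom W θ (x ⊗ₜ y) = (substSymm W x : ExteriorAlgebra ℝ (E →L[ℝ] ℝ)) * substExt θ y :=
  Algebra.TensorProduct.lift_tmul _ _ _ x y

theorem substSymm_ι (W : E [⋀^Fin 2]→L[ℝ] 𝔤) (l : Module.Dual ℝ 𝔤) :
    substSymm W (SymmetricAlgebra.ι ℝ _ l) = twoFormElt E (dualComp W l) := by
  simp [substSymm]

theorem substHom_symm (W : E [⋀^Fin 2]→L[ℝ] 𝔤) (θ : E [⋀^Fin 1]→L[ℝ] V) (l : Module.Dual ℝ 𝔤) :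
    substHom W θ (SymmetricAlgebra.ι ℝ _ l ⊗ₜ 1) = twoFormElt E (dualComp W l) := by
  rw [substHom_tmul, substSymm_ι, map_one, mul_one]

theorem substHom_ext (W : E [⋀^Fin 2]→L[ℝ] 𝔤) (θ : E [⋀^Fin 1]→L[ℝ] V) (l : Module.Dual ℝ V) :
    substHom W θ (1 ⊗ₜ ExteriorAlgebra.ι ℝ l) =
      ExteriorAlgebra.ι ℝ (covector E (dualComp θ l)) := by
  rw [substHom_tmul, substExt_ι, map_one, OneMemClass.coe_one, one_mul]

/-- The form `f(W, …, W, θ, …, θ)` for an element `f` of `A(𝔤, V)`, more precisely its component of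
degree `n`. -/
def substForm (W : E [⋀^Fin 2]→L[ℝ] 𝔤) (θ : E [⋀^Fin 1]→L[ℝ] V) (n : ℕ) :
    AAlg 𝔤 V →ₗ[ℝ] (E [⋀^Fin n]→L[ℝ] ℝ) :=
  extForm E n ∘ₗ (substHom W θ).toLinearMap

/-- Substitution is multiplicative; this is the pointwise form of the homomorphism property. -/
theorem substForm_mul (W : E [⋀^Fin 2]→L[ℝ] 𝔤) (θ : E [⋀^Fin 1]→L[ℝ] V) (n : ℕ)
    (f g : AAlg 𝔤 V) :
    substForm W θ n (f * g) =
      wedgeSum (fun k => substForm W θ k f) (fun k => substForm W θ k g) n := by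
  simp only [substForm, LinearMap.comp_apply, AlgHom.toLinearMap_apply, map_mul, extForm_mul]

theorem substForm_algebraMap_zero (W : E [⋀^Fin 2]→L[ℝ] 𝔤) (θ : E [⋀^Fin 1]→L[ℝ] V) (r : ℝ) :
    substForm W θ 0 (algebraMap ℝ _ r) = ContinuousAlternatingMap.constOfIsEmpty ℝ _ (Fin 0) r := by
  simp only [substForm, LinearMap.comp_apply, AlgHom.toLinearMap_apply, AlgHom.commutes,
    extForm_algebraMap_zero]

theorem substForm_algebraMap_of_ne (W : E [⋀^Fin 2]→L[ℝ] 𝔤) (θ : E [⋀^Fin 1]→L[ℝ] V) (r : ℝ)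
    {n : ℕ} (hn : n ≠ 0) : substForm W θ n (algebraMap ℝ _ r) = 0 := by
  simp only [substForm, LinearMap.comp_apply, AlgHom.toLinearMap_apply, AlgHom.commutes,
    extForm_algebraMap_of_ne hn]

theorem substForm_symm_two (W : E [⋀^Fin 2]→L[ℝ] 𝔤) (θ : E [⋀^Fin 1]→L[ℝ] V)
    (l : Module.Dual ℝ 𝔤) :
    substForm W θ 2 (SymmetricAlgebra.ι ℝ _ l ⊗ₜ 1) = dualComp W l := by
  rw [substForm, LinearMap.comp_apply, AlgHom.toLinearMap_apply, substHom_symm,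
    extForm_two_twoFormElt]

theorem substForm_symm_of_ne (W : E [⋀^Fin 2]→L[ℝ] 𝔤) (θ : E [⋀^Fin 1]→L[ℝ] V)
    (l : Module.Dual ℝ 𝔤) {n : ℕ} (hn : n ≠ 2) :
    substForm W θ n (SymmetricAlgebra.ι ℝ _ l ⊗ₜ 1) = 0 := by
  rw [substForm, LinearMap.comp_apply, AlgHom.toLinearMap_apply, substHom_symm,
    extForm_twoFormElt_of_ne hn]

theorem substForm_ext_one (W : E [⋀^Fin 2]→L[ℝ] 𝔤) (θ : E [⋀^Fin 1]→L[ℝ] V)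
    (l : Module.Dual ℝ V) :
    substForm W θ 1 (1 ⊗ₜ ExteriorAlgebra.ι ℝ l) = dualComp θ l := by
  rw [substForm, LinearMap.comp_apply, AlgHom.toLinearMap_apply, substHom_ext, extForm_ι_one]
  exact (ContinuousAlternatingMap.ofSubsingleton ℝ E ℝ 0).apply_symm_apply _

theorem substForm_ext_of_ne (W : E [⋀^Fin 2]→L[ℝ] 𝔤) (θ : E [⋀^Fin 1]→L[ℝ] V)
    (l : Module.Dual ℝ V) {n : ℕ} (hn : n ≠ 1) :
    substForm W θ n (1 ⊗ₜ ExteriorAlgebra.ι ℝ l) = 0 := by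
  rw [substForm, LinearMap.comp_apply, AlgHom.toLinearMap_apply, substHom_ext,
    extForm_ι_of_ne hn]

/-- Substitution commutes with pullback along linear maps: both sides are multiplicative in `f`, so
it suffices to compare them on the generators. -/
theorem substForm_comp (W : E [⋀^Fin 2]→L[ℝ] 𝔤) (θ : E [⋀^Fin 1]→L[ℝ] V) (L : E' →L[ℝ] E)
    (f : AAlg 𝔤 V) (n : ℕ) :
    substForm (W.compContinuousLinearMap L) (θ.compContinuousLinearMap L) n f =
      (substForm W θ n f).compContinuousLinearMap L := by
  induction f using AAlg.induction generalizing n with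
  | halg r =>
    by_cases hn : n = 0
    · subst hn
      rw [substForm_algebraMap_zero, substForm_algebraMap_zero]; ext; simp
    · rw [substForm_algebraMap_of_ne _ _ _ hn, substForm_algebraMap_of_ne _ _ _ hn]; ext; simp
  | hsymm l =>
    by_cases hn : n = 2
    · subst hn
      rw [substForm_symm_two, substForm_symm_two]; ext; simp
    · rw [substForm_symm_of_ne _ _ _ hn, substForm_symm_of_ne _ _ _ hn]; ext; simp
  | hext l =>
    by_cases hn : n = 1
    · subst hn
      rw [substForm_ext_one, substForm_ext_one]; ext; simp
    · rw [substForm_ext_of_ne _ _ _ hn, substForm_ext_of_ne _ _ _ hn]; ext; simp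
  | hmul f g hf hg =>
    rw [substForm_mul, substForm_mul, wedgeSum_compContinuousLinearMap]
    exact wedgeSum_congr hf hg n
  | hadd f g hf hg => rw [map_add, map_add, hf, hg]; ext; simp

/-- The action of `a` and `b` on `f` can be shifted to the forms that are substituted. -/
theorem substForm_subst (W : E [⋀^Fin 2]→L[ℝ] 𝔤) (θ : E [⋀^Fin 1]→L[ℝ] V) (a : 𝔤 →L[ℝ] 𝔤)
    (b : V →L[ℝ] V) (f : AAlg 𝔤 V) (n : ℕ) :
    substForm W θ n (AAlg.subst a.toLinearMap b.toLinearMap f) =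
      substForm (a.compContinuousAlternatingMap W) (b.compContinuousAlternatingMap θ) n f := by
  induction f using AAlg.induction generalizing n with
  | halg r =>
    rw [AlgHom.commutes]
    by_cases hn : n = 0
    · subst hn
      rw [substForm_algebraMap_zero, substForm_algebraMap_zero]
    · rw [substForm_algebraMap_of_ne _ _ _ hn, substForm_algebraMap_of_ne _ _ _ hn]
  | hsymm l =>
    have h : AAlg.subst a.toLinearMap b.toLinearMap (SymmetricAlgebra.ι ℝ _ l ⊗ₜ 1) =
        (SymmetricAlgebra.ι ℝ _ (l ∘ₗ a.toLinearMap)) ⊗ₜ 1 := by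
      simp [AAlg.subst, LinearMap.dualMap_apply']
    rw [h]
    by_cases hn : n = 2
    · subst hn
      rw [substForm_symm_two, substForm_symm_two]; ext; simp
    · rw [substForm_symm_of_ne _ _ _ hn, substForm_symm_of_ne _ _ _ hn]
  | hext l =>
    have h : AAlg.subst a.toLinearMap b.toLinearMap
        ((1 : SymmetricAlgebra ℝ (Module.Dual ℝ 𝔤)) ⊗ₜ ExteriorAlgebra.ι ℝ l) =
        1 ⊗ₜ ExteriorAlgebra.ι ℝ (l ∘ₗ b.toLinearMap) := by
      simp [AAlg.subst, LinearMap.dualMap_apply']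
    rw [h]
    by_cases hn : n = 1
    · subst hn
      rw [substForm_ext_one, substForm_ext_one]; ext; simp
    · rw [substForm_ext_of_ne _ _ _ hn, substForm_ext_of_ne _ _ _ hn]
  | hmul f g hf hg =>
    rw [map_mul, substForm_mul, substForm_mul]
    exact wedgeSum_congr hf hg n
  | hadd f g hf hg => rw [map_add, map_add, map_add, hf, hg]

/-- The products of two-forms and covectors, as explicit alternating sums. -/
theorem extForm_prod_mul_ιMulti (p q : ℕ) (w : Fin p → E [⋀^Fin 2]→L[ℝ] ℝ)
    (l : Fin q → E →L[ℝ] ℝ) (X : Fin (2 * p + q) → E) :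
    extForm E (2 * p + q) ((List.ofFn fun i =>
      (twoFormElt E (w i) : ExteriorAlgebra ℝ (E →L[ℝ] ℝ))).prod * ExteriorAlgebra.ιMulti ℝ q l) X =
    (2 ^ p : ℝ)⁻¹ * altSum (fun Y : Fin (2 * p + q) → E =>
      (∏ i : Fin p, w i ![Y ⟨2 * i, by omega⟩, Y ⟨2 * i + 1, by omega⟩]) *
        ∏ j : Fin q, l j (Y ⟨2 * p + j, by omega⟩)) X := by
  induction p with
  | zero =>
    have : ∀ (n : ℕ) (h : n = q) (X : Fin n → E), extForm E n (ExteriorAlgebra.ιMulti ℝ q l) X =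
        altSum (fun Y : Fin n → E => ∏ j : Fin q, l j (Y (Fin.cast h.symm j))) X := by
      rintro n rfl X
      rw [extForm_ιMulti_self, covectorWedge_apply]
      rfl
    simp only [List.ofFn_zero, List.prod_nil, one_mul]
    rw [this _ (by simp)]
    simp only [pow_zero, inv_one, one_mul, Finset.univ_eq_empty, Finset.prod_empty]
    congr 1
    funext Y
    refine Finset.prod_congr rfl fun j _ => ?_
    congr 2
    simp [Fin.ext_iff]
  | succ p ih =>
    have h : 2 + (2 * p + q) = 2 * (p + 1) + q := by ring
    have hf : ((2 * p + q).factorial : ℝ) ≠ 0 := by exact_mod_cast Nat.factorial_ne_zero _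
    rw [List.ofFn_succ, List.prod_cons, mul_assoc, extForm_mul,
      wedgeSum_eq_of_ne_zero h (fun i hi => extForm_twoFormElt_of_ne hi _), wedge_apply,
      extForm_two_twoFormElt, funext (ih (fun i => w i.succ))]
    set R : (Fin (2 * p + q) → E) → ℝ := fun Y =>
      (∏ i : Fin p, w i.succ ![Y ⟨2 * i, by omega⟩, Y ⟨2 * i + 1, by omega⟩]) *
        ∏ j : Fin q, l j (Y ⟨2 * p + j, by omega⟩) with hR
    have h1 : splitMul h (w 0) (fun Y => (2 ^ p : ℝ)⁻¹ * altSum R Y) =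
        fun Y => (2 ^ p : ℝ)⁻¹ * splitMul h (w 0) (altSum R) Y := by
      funext Y; unfold splitMul; ring
    rw [h1, altSum_const_mul, altSum_splitMul_altSum_right]
    have h2 : splitMul h (w 0) R = fun Y : Fin (2 * (p + 1) + q) → E =>
        (∏ i : Fin (p + 1), w i ![Y ⟨2 * i, by omega⟩, Y ⟨2 * i + 1, by omega⟩]) *
          ∏ j : Fin q, l j (Y ⟨2 * (p + 1) + j, by omega⟩) := by
      funext Y
      rw [Fin.prod_univ_succ, mul_assoc]
      unfold splitMul
      congr 1
      · congr 1
        ext i; fin_cases i <;> rfl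
      · rw [hR]
        refine congrArg₂ (· * ·) ?_ ?_
        · refine Finset.prod_congr rfl fun i _ => ?_
          congr 1
          ext j; fin_cases j
          · simp only [Fin.val_succ]
            exact congrArg Y (Fin.ext (by simp; ring))
          · simp only [Fin.val_succ]
            exact congrArg Y (Fin.ext (by simp; ring))
        · refine Finset.prod_congr rfl fun i _ => ?_
          congr 1
          exact congrArg Y (Fin.ext (by simp; ring))
    rw [h2]
    simp only [Nat.factorial, pow_succ]
    field_simp
    push_cast
    ring

theorem extForm_prod_mul_ιMulti_of_ne (p q n : ℕ) (hn : n ≠ 2 * p + q)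
    (w : Fin p → E [⋀^Fin 2]→L[ℝ] ℝ) (l : Fin q → E →L[ℝ] ℝ) :
    extForm E n ((List.ofFn fun i =>
      (twoFormElt E (w i) : ExteriorAlgebra ℝ (E →L[ℝ] ℝ))).prod *
        ExteriorAlgebra.ιMulti ℝ q l) = 0 := by
  induction p generalizing n with
  | zero =>
    simp only [List.ofFn_zero, List.prod_nil, one_mul]
    exact extForm_ιMulti_of_ne (by omega) l
  | succ p ih =>
    rw [List.ofFn_succ, List.prod_cons, mul_assoc, extForm_mul]
    rcases lt_or_ge n 2 with hlt | hge
    · exact wedgeSum_eq_zero_of_lt hlt (fun i hi => extForm_twoFormElt_of_ne hi _)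
    · obtain ⟨j, rfl⟩ := Nat.exists_eq_add_of_le hge
      rw [wedgeSum_eq_of_ne_zero rfl (fun i hi => extForm_twoFormElt_of_ne hi _),
        ih _ (by omega), wedge_zero_right]

theorem substHom_tensorClass_tprod (W : E [⋀^Fin 2]→L[ℝ] 𝔤) (θ : E [⋀^Fin 1]→L[ℝ] V) {p q : ℕ}
    (a : Fin p → Module.Dual ℝ 𝔤) (b : Fin q → Module.Dual ℝ V) :
    substHom W θ (tensorClass (PiTensorProduct.tprod ℝ a ⊗ₜ PiTensorProduct.tprod ℝ b)) =
      (List.ofFn fun i => (twoFormElt E (dualComp W (a i)) :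
        ExteriorAlgebra ℝ (E →L[ℝ] ℝ))).prod *
        ExteriorAlgebra.ιMulti ℝ q (fun j => covector E (dualComp θ (b j))) := by
  rw [tensorClass_tprod, substHom_tmul, ExteriorAlgebra.ιMulti_apply]
  congr 1
  · rw [map_list_prod, List.map_ofFn, ← Subalgebra.coe_val, map_list_prod, List.map_ofFn]
    congr 2
    funext i
    simp only [Function.comp_apply, substSymm_ι]
  · rw [map_list_prod, List.map_ofFn]
    congr 2
    funext i
    simp only [Function.comp_apply, substExt_ι]

/-- The explicit formula for `f(W, …, W, θ, …, θ)` if `f` is represented by a tensor. -/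
theorem substForm_tensorClass (W : E [⋀^Fin 2]→L[ℝ] 𝔤) (θ : E [⋀^Fin 1]→L[ℝ] V) {p q : ℕ}
    (t : Tensors 𝔤 V p q) (X : Fin (2 * p + q) → E) :
    substForm W θ (2 * p + q) (tensorClass t) X =
      (2 ^ p : ℝ)⁻¹ * ∑ σ : Equiv.Perm (Fin (2 * p + q)), ((Equiv.Perm.sign σ : ℤ) : ℝ) *
        evalTensor
          (fun i : Fin p => W ![X (σ ⟨2 * i, by omega⟩), X (σ ⟨2 * i + 1, by omega⟩)])
          (fun j : Fin q => θ ![X (σ ⟨2 * p + j, by omega⟩)]) t := by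
  induction t using Tensors.induction with
  | htprod a b =>
    rw [substForm, LinearMap.comp_apply, AlgHom.toLinearMap_apply, substHom_tensorClass_tprod,
      extForm_prod_mul_ιMulti]
    unfold altSum
    congr 1
    refine Finset.sum_congr rfl fun σ _ => ?_
    congr 1
    simp only [evalTensor, LinearMap.comp_apply, TensorProduct.map_tmul,
      PiTensorProduct.lift.tprod, LinearMap.mul'_apply, MultilinearMap.compLinearMap_apply,
      MultilinearMap.mkPiAlgebra_apply, Module.Dual.eval_apply, dualComp_apply]
    congr 1
    refine Finset.prod_congr rfl fun j _ => ?_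
    change dualComp θ (b j) _ = _
    rw [dualComp_apply]
    congr 2
    ext i
    fin_cases i
    rfl
  | hadd t t' h h' =>
    simp only [map_add, ContinuousAlternatingMap.add_apply, h, h', mul_add,
      Finset.sum_add_distrib]
  | hsmul c t h =>
    simp only [map_smul, ContinuousAlternatingMap.smul_apply, h, smul_eq_mul, Finset.mul_sum]
    exact Finset.sum_congr rfl fun σ _ => by ring

theorem substForm_tensorClass_of_ne (W : E [⋀^Fin 2]→L[ℝ] 𝔤) (θ : E [⋀^Fin 1]→L[ℝ] V) {p q n : ℕ}
    (hn : n ≠ 2 * p + q) (t : Tensors 𝔤 V p q) : substForm W θ n (tensorClass t) = 0 := by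
  induction t using Tensors.induction with
  | htprod a b =>
    rw [substForm, LinearMap.comp_apply, AlgHom.toLinearMap_apply, substHom_tensorClass_tprod,
      extForm_prod_mul_ιMulti_of_ne _ _ _ hn]
  | hadd t t' h h' => rw [map_add, map_add, h, h', add_zero]
  | hsmul c t h => rw [map_smul, map_smul, h, smul_zero]

end Substitution

/-! ### The exterior derivative on a vector space and the wedge product -/

section Leibniz

variable {E : Type*} [NormedAddCommGroup E] [NormedSpace ℝ E]

theorem altSum_eq_factorial_mul {n : ℕ} (a : E [⋀^Fin n]→L[ℝ] ℝ) (X : Fin n → E) :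
    altSum a X = (n.factorial : ℝ) * a X := by
  unfold altSum
  have : ∀ σ : Equiv.Perm (Fin n), ((Equiv.Perm.sign σ : ℤ) : ℝ) * a (X ∘ σ) = a X := fun σ => by
    have h := a.toAlternatingMap.map_perm X σ
    change a (X ∘ σ) = Equiv.Perm.sign σ • a X at h
    rw [h, Units.smul_def, zsmul_eq_mul, ← mul_assoc]
    rcases Int.units_eq_one_or (Equiv.Perm.sign σ) with h | h <;> simp [h]
  simp [this, Fintype.card_perm]

/-- The antisymmetrization defining the exterior derivative, in terms of all permutations. -/
theorem altSum_apply_zero_tail {n : ℕ} (f : E →L[ℝ] E [⋀^Fin n]→L[ℝ] ℝ) (X : Fin (n + 1) → E) :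
    altSum (fun Y => f (Y 0) (Fin.tail Y)) X =
      (n.factorial : ℝ) * ContinuousAlternatingMap.alternatizeUncurryFin f X := by
  have h1 := altSum_eq_factorial_mul (ContinuousAlternatingMap.alternatizeUncurryFin f) X
  have h2 : (⇑(ContinuousAlternatingMap.alternatizeUncurryFin f) : (Fin (n + 1) → E) → ℝ) =
      fun Y => ∑ i : Fin (n + 1), (-1 : ℝ) ^ (i : ℕ) *
        (fun Z => f (Z 0) (Fin.tail Z)) (Y ∘ (Fin.cycleRange i).symm) := by
    funext Y
    rw [ContinuousAlternatingMap.alternatizeUncurryFin_apply]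
    refine Finset.sum_congr rfl fun i _ => ?_
    have h3 : Fin.tail (Y ∘ (Fin.cycleRange i).symm) = i.removeNth Y := by
      funext j; simp [Fin.tail, Fin.removeNth]
    simp [h3]
  have h4 : ∀ i : Fin (n + 1), altSum (fun Y : Fin (n + 1) → E => (-1 : ℝ) ^ (i : ℕ) *
        (fun Z => f (Z 0) (Fin.tail Z)) (Y ∘ (Fin.cycleRange i).symm)) X =
      altSum (fun Y => f (Y 0) (Fin.tail Y)) X := fun i => by
    rw [altSum_const_mul, altSum_comp_perm (fun Z => f (Z 0) (Fin.tail Z)),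
      Equiv.Perm.sign_symm, Fin.sign_cycleRange, ← mul_assoc]
    rcases neg_one_pow_eq_or ℤ (i : ℕ) with h | h <;>
    rcases neg_one_pow_eq_or ℝ (i : ℕ) with h' | h' <;> simp [← mul_pow]
  rw [h2, altSum_sum, Finset.sum_congr rfl (fun i _ => h4 i), ← h2] at h1
  rw [Finset.sum_const, Finset.card_univ, Fintype.card_fin, nsmul_eq_mul, Nat.factorial_succ,
    Nat.cast_mul, mul_assoc] at h1
  exact mul_left_cancel₀ (by exact_mod_cast Nat.succ_ne_zero n) h1

/-- The part of the Leibniz rule for `d(a ∧ b)` in which `a` is differentiated. -/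
theorem alternatizeUncurryFin_wedge_left {k l n : ℕ} (h : k + l = n) (h' : k + 1 + l = n + 1)
    (f : E →L[ℝ] E [⋀^Fin k]→L[ℝ] ℝ) (b : E [⋀^Fin l]→L[ℝ] ℝ) :
    ContinuousAlternatingMap.alternatizeUncurryFin (((wedgeCLM E h).flip b).comp f) =
      wedge h' (ContinuousAlternatingMap.alternatizeUncurryFin f) b := by
  have hk : (k.factorial : ℝ) ≠ 0 := by exact_mod_cast Nat.factorial_ne_zero k
  have hl : (l.factorial : ℝ) ≠ 0 := by exact_mod_cast Nat.factorial_ne_zero l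
  have hn : (n.factorial : ℝ) ≠ 0 := by exact_mod_cast Nat.factorial_ne_zero n
  have hk' : ((k + 1).factorial : ℝ) ≠ 0 := by exact_mod_cast Nat.factorial_ne_zero (k + 1)
  have h₀ : 1 + n = n + 1 := by omega
  ext X
  refine mul_left_cancel₀ hn ?_
  rw [← altSum_apply_zero_tail]
  simp only [ContinuousLinearMap.comp_apply, ContinuousLinearMap.flip_apply, wedgeCLM_apply,
    wedge_apply]
  rw [altSum_const_mul]
  have h1 := altSum_altSum_right h₀
    (fun (Y : Fin 1 → E) => splitMul h (f (Y 0)) b) X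
  have h2 : (fun Y : Fin (n + 1) → E => altSum (splitMul h (f (Y 0)) b) (Fin.tail Y)) =
      fun Y => altSum (splitMul h (f (leftArgs h₀ Y 0)) b)
        (rightArgs h₀ Y) := by
    funext Y
    congr 1
    funext i
    exact congrArg Y (Fin.ext (by simp))
  rw [h2, h1]
  have h3 : ∀ Y, (ContinuousAlternatingMap.alternatizeUncurryFin f) Y =
      (k.factorial : ℝ)⁻¹ * altSum (fun Y => f (Y 0) (Fin.tail Y)) Y := fun Y => by
    rw [altSum_apply_zero_tail, inv_mul_cancel_left₀ hk]
  have h4 : splitMul h' (ContinuousAlternatingMap.alternatizeUncurryFin f) b =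
      fun Y => (k.factorial : ℝ)⁻¹ *
        splitMul h' (altSum (fun Y => f (Y 0) (Fin.tail Y))) b Y := by
    funext Y; unfold splitMul; rw [h3]; ring
  rw [h4, altSum_const_mul, altSum_splitMul_altSum_left]
  have h5 : (fun Y : Fin (n + 1) → E =>
      splitMul h (f (leftArgs h₀ Y 0)) b (rightArgs h₀ Y)) =
      splitMul h' (fun Y => f (Y 0) (Fin.tail Y)) b := by
    funext Y
    unfold splitMul
    congr 1
    · congr 1
      funext i
      exact congrArg Y (Fin.ext (by simp))
    · congr 1
      funext i
      exact congrArg Y (Fin.ext (by simp; ring))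
  rw [h5]
  field_simp

/-- The part of the Leibniz rule for `d(a ∧ b)` in which `b` is differentiated; the sign comes from
moving the first argument past the `k` arguments of `a`. -/
theorem alternatizeUncurryFin_wedge_right {k l n : ℕ} (h : k + l = n) (h' : k + (l + 1) = n + 1)
    (a : E [⋀^Fin k]→L[ℝ] ℝ) (g : E →L[ℝ] E [⋀^Fin l]→L[ℝ] ℝ) :
    ContinuousAlternatingMap.alternatizeUncurryFin ((wedgeCLM E h a).comp g) =
      (-1 : ℝ) ^ k • wedge h' a (ContinuousAlternatingMap.alternatizeUncurryFin g) := by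
  have hk : (k.factorial : ℝ) ≠ 0 := by exact_mod_cast Nat.factorial_ne_zero k
  have hl : (l.factorial : ℝ) ≠ 0 := by exact_mod_cast Nat.factorial_ne_zero l
  have hn : (n.factorial : ℝ) ≠ 0 := by exact_mod_cast Nat.factorial_ne_zero n
  have hl' : ((l + 1).factorial : ℝ) ≠ 0 := by exact_mod_cast Nat.factorial_ne_zero (l + 1)
  have h₀ : 1 + n = n + 1 := by omega
  ext X
  refine mul_left_cancel₀ hn ?_
  rw [← altSum_apply_zero_tail]
  simp only [ContinuousLinearMap.comp_apply, wedgeCLM_apply, wedge_apply,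
    ContinuousAlternatingMap.smul_apply, smul_eq_mul]
  rw [altSum_const_mul]
  have h1 := altSum_altSum_right h₀
    (fun (Y : Fin 1 → E) => splitMul h a (g (Y 0))) X
  have h2 : (fun Y : Fin (n + 1) → E => altSum (splitMul h a (g (Y 0))) (Fin.tail Y)) =
      fun Y => altSum (splitMul h a (g (leftArgs h₀ Y 0)))
        (rightArgs h₀ Y) := by
    funext Y
    congr 1
    funext i
    exact congrArg Y (Fin.ext (by simp))
  rw [h2, h1]
  have h3 : ∀ Y, (ContinuousAlternatingMap.alternatizeUncurryFin g) Y =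
      (l.factorial : ℝ)⁻¹ * altSum (fun Y => g (Y 0) (Fin.tail Y)) Y := fun Y => by
    rw [altSum_apply_zero_tail, inv_mul_cancel_left₀ hl]
  have h4 : splitMul h' a (ContinuousAlternatingMap.alternatizeUncurryFin g) =
      fun Y => (l.factorial : ℝ)⁻¹ *
        splitMul h' a (altSum (fun Y => g (Y 0) (Fin.tail Y))) Y := by
    funext Y; unfold splitMul; rw [h3]; ring
  rw [h4, altSum_const_mul, altSum_splitMul_altSum_right]
  have hkn : k < n + 1 := by omega
  -- Moving the argument at position `k` to the front is a cyclic permutation of sign `(-1)^k`.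
  have h5 : splitMul h' a (fun Y => g (Y 0) (Fin.tail Y)) = fun Y : Fin (n + 1) → E =>
      (fun Y : Fin (n + 1) → E => splitMul h a (g (leftArgs h₀ Y 0))
        (rightArgs h₀ Y)) (Y ∘ (Fin.cycleRange ⟨k, hkn⟩).symm) := by
    funext Y
    have hz : (Y ∘ (Fin.cycleRange ⟨k, hkn⟩).symm) 0 = Y ⟨k, hkn⟩ := by simp
    have hs : ∀ j : Fin n, (Y ∘ (Fin.cycleRange ⟨k, hkn⟩).symm) j.succ =
        Y (Fin.succAbove ⟨k, hkn⟩ j) := fun j => by simp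
    have hz' : leftArgs h₀ (Y ∘ (Fin.cycleRange ⟨k, hkn⟩).symm) 0 =
        Y ⟨k, hkn⟩ := hz
    have hs' : ∀ j : Fin n, rightArgs h₀
        (Y ∘ (Fin.cycleRange ⟨k, hkn⟩).symm) j = Y (Fin.succAbove ⟨k, hkn⟩ j) := fun j => by
      rw [← hs]
      exact congrArg (Y ∘ (Fin.cycleRange ⟨k, hkn⟩).symm)
        (Fin.ext (by simp) : Fin.cast h₀ (Fin.natAdd 1 j) = j.succ)
    simp only [splitMul]
    rw [hz']
    congr 1
    · congr 1
      funext i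
      simp only [leftArgs]
      rw [hs']
      refine congrArg Y (Fin.ext ?_)
      rw [Fin.succAbove_of_castSucc_lt _ _ (by simp [Fin.lt_def])]
      simp
    · have e1 : (rightArgs h' Y) 0 = Y ⟨k, hkn⟩ := congrArg Y (Fin.ext (by simp))
      rw [e1]
      congr 1
      funext i
      simp only [rightArgs, Fin.tail]
      refine Eq.trans ?_ (hs' _).symm
      refine congrArg Y (Fin.ext ?_)
      rw [Fin.succAbove_of_le_castSucc _ _ (by simp [Fin.le_def])]
      simp; ring
  rw [h5, altSum_comp_perm (fun Y : Fin (n + 1) → E =>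
    splitMul h a (g (leftArgs h₀ Y 0)) (rightArgs h₀ Y)),
    Equiv.Perm.sign_symm, Fin.sign_cycleRange]
  have hsq : (-1 : ℝ) ^ k * (-1) ^ k = 1 := by rw [← mul_pow]; simp
  push_cast
  field_simp
  rw [pow_two, hsq, mul_one]

/-- The graded Leibniz rule. -/
theorem extDeriv_wedge {k l n : ℕ} (h : k + l = n) (h₁ : k + 1 + l = n + 1)
    (h₂ : k + (l + 1) = n + 1) {a : E → E [⋀^Fin k]→L[ℝ] ℝ} {b : E → E [⋀^Fin l]→L[ℝ] ℝ} {x : E}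
    (ha : DifferentiableAt ℝ a x) (hb : DifferentiableAt ℝ b x) :
    extDeriv (fun y => wedge h (a y) (b y)) x =
      wedge h₁ (extDeriv a x) (b x) + (-1 : ℝ) ^ k • wedge h₂ (a x) (extDeriv b x) := by
  have hd : HasFDerivAt (fun y => wedge h (a y) (b y)) _ x :=
    (wedgeCLM E h).hasFDerivAt_of_bilinear ha.hasFDerivAt hb.hasFDerivAt
  rw [extDeriv, hd.fderiv]
  have e1 : (wedgeCLM E h).precompR E (a x) (fderiv ℝ b x) =
      (wedgeCLM E h (a x)).comp (fderiv ℝ b x) := by ext v; simp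
  have e2 : (wedgeCLM E h).precompL E (fderiv ℝ a x) (b x) =
      ((wedgeCLM E h).flip (b x)).comp (fderiv ℝ a x) := by ext v; simp
  rw [ContinuousAlternatingMap.alternatizeUncurryFin_add, e1, e2,
    alternatizeUncurryFin_wedge_left h h₁, alternatizeUncurryFin_wedge_right h h₂]
  exact add_comm _ _

theorem differentiableAt_wedge {E'' : Type*} [NormedAddCommGroup E''] [NormedSpace ℝ E'']
    {k l n : ℕ} (h : k + l = n) {a : E'' → E [⋀^Fin k]→L[ℝ] ℝ}
    {b : E'' → E [⋀^Fin l]→L[ℝ] ℝ} {x : E''} (ha : DifferentiableAt ℝ a x)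
    (hb : DifferentiableAt ℝ b x) : DifferentiableAt ℝ (fun y => wedge h (a y) (b y)) x :=
  ((wedgeCLM E h).hasFDerivAt_of_bilinear ha.hasFDerivAt hb.hasFDerivAt).differentiableAt

theorem contDiffAt_bilinear {X Y Z E'' : Type*} [NormedAddCommGroup X] [NormedSpace ℝ X]
    [NormedAddCommGroup Y] [NormedSpace ℝ Y] [NormedAddCommGroup Z] [NormedSpace ℝ Z]
    [NormedAddCommGroup E''] [NormedSpace ℝ E''] {r : WithTop ℕ∞} (B : X →L[ℝ] Y →L[ℝ] Z)
    {a : E'' → X} {b : E'' → Y} {x : E''} (ha : ContDiffAt ℝ r a x) (hb : ContDiffAt ℝ r b x) :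
    ContDiffAt ℝ r (fun y => B (a y) (b y)) x :=
  (ha.continuousLinearMap_comp B).clm_apply hb

theorem contDiffAt_wedge {E'' : Type*} [NormedAddCommGroup E''] [NormedSpace ℝ E'']
    {r : WithTop ℕ∞} {k l n : ℕ} (h : k + l = n) {a : E'' → E [⋀^Fin k]→L[ℝ] ℝ}
    {b : E'' → E [⋀^Fin l]→L[ℝ] ℝ} {x : E''} (ha : ContDiffAt ℝ r a x)
    (hb : ContDiffAt ℝ r b x) : ContDiffAt ℝ r (fun y => wedge h (a y) (b y)) x :=
  contDiffAt_bilinear (wedgeCLM E h) ha hb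

end Leibniz

/-! ### Smoothness and closedness of substituted forms -/

section SubstitutionCalculus

variable {E E'' : Type*} [NormedAddCommGroup E] [NormedSpace ℝ E]
  [NormedAddCommGroup E''] [NormedSpace ℝ E'']

theorem contDiffAt_wedgeSum {r : WithTop ℕ∞} {a b : E'' → ∀ k : ℕ, E [⋀^Fin k]→L[ℝ] ℝ} {x : E''}
    (ha : ∀ k, ContDiffAt ℝ r (fun y => a y k) x) (hb : ∀ k, ContDiffAt ℝ r (fun y => b y k) x)
    (n : ℕ) : ContDiffAt ℝ r (fun y => wedgeSum (a y) (b y) n) x := by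
  unfold wedgeSum
  exact ContDiffAt.sum fun ij _ => contDiffAt_wedge _ (ha _) (hb _)

theorem differentiableAt_wedgeSum {a b : E'' → ∀ k : ℕ, E [⋀^Fin k]→L[ℝ] ℝ} {x : E''}
    (ha : ∀ k, DifferentiableAt ℝ (fun y => a y k) x)
    (hb : ∀ k, DifferentiableAt ℝ (fun y => b y k) x)
    (n : ℕ) : DifferentiableAt ℝ (fun y => wedgeSum (a y) (b y) n) x := by
  unfold wedgeSum
  exact DifferentiableAt.fun_sum fun ij _ => differentiableAt_wedge _ (ha _) (hb _)

theorem extDeriv_sum {k : ℕ} {ι : Type*} {s : Finset ι} {a : ι → E → E [⋀^Fin k]→L[ℝ] ℝ} {x : E}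
    (ha : ∀ i ∈ s, DifferentiableAt ℝ (a i) x) :
    extDeriv (fun y => ∑ i ∈ s, a i y) x = ∑ i ∈ s, extDeriv (a i) x := by
  simp only [extDeriv, fderiv_fun_sum ha, ← ContinuousAlternatingMap.alternatizeUncurryFinCLM_apply,
    map_sum]

theorem extDeriv_wedgeSum_eq_zero {a b : E → ∀ k : ℕ, E [⋀^Fin k]→L[ℝ] ℝ} {x : E}
    (ha : ∀ k, DifferentiableAt ℝ (fun y => a y k) x)
    (hb : ∀ k, DifferentiableAt ℝ (fun y => b y k) x)
    (ha' : ∀ k, extDeriv (fun y => a y k) x = 0) (hb' : ∀ k, extDeriv (fun y => b y k) x = 0)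
    (n : ℕ) : extDeriv (fun y => wedgeSum (a y) (b y) n) x = 0 := by
  unfold wedgeSum
  rw [extDeriv_sum fun ij _ => differentiableAt_wedge _ (ha _) (hb _)]
  refine Finset.sum_eq_zero ?_
  rintro ⟨⟨i, j⟩, hij⟩ -
  have h := Finset.HasAntidiagonal.mem_antidiagonal.1 hij
  simp only at h
  rw [extDeriv_wedge h (by omega) (by omega) (ha _) (hb _), ha', hb']
  simp

theorem extDeriv_clm_comp {F F' : Type*} [NormedAddCommGroup F] [NormedSpace ℝ F]
    [NormedAddCommGroup F'] [NormedSpace ℝ F'] {k : ℕ} (l : F →L[ℝ] F')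
    {w : E → E [⋀^Fin k]→L[ℝ] F} {x : E} (hw : DifferentiableAt ℝ w x) :
    extDeriv (fun y => l.compContinuousAlternatingMap (w y)) x =
      l.compContinuousAlternatingMap (extDeriv w x) := by
  have hd : HasFDerivAt (fun y => l.compContinuousAlternatingMap (w y))
      ((ContinuousLinearMap.compContinuousAlternatingMapCLM ℝ E F F' (Fin k) l).comp
        (fderiv ℝ w x)) x :=
    (ContinuousLinearMap.compContinuousAlternatingMapCLM ℝ E F F' (Fin k) l).hasFDerivAt.comp x
      hw.hasFDerivAt
  ext X
  rw [extDeriv, hd.fderiv, extDeriv, ContinuousLinearMap.compContinuousAlternatingMap_coe,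
    Function.comp_apply, ContinuousAlternatingMap.alternatizeUncurryFin_apply,
    ContinuousAlternatingMap.alternatizeUncurryFin_apply, map_sum]
  refine Finset.sum_congr rfl fun i _ => ?_
  rw [map_zsmul]
  rfl

theorem contDiffAt_clm_comp {F F' : Type*} [NormedAddCommGroup F] [NormedSpace ℝ F]
    [NormedAddCommGroup F'] [NormedSpace ℝ F'] {k : ℕ} {r : WithTop ℕ∞} (l : F →L[ℝ] F')
    {w : E'' → E [⋀^Fin k]→L[ℝ] F} {x : E''} (hw : ContDiffAt ℝ r w x) :
    ContDiffAt ℝ r (fun y => l.compContinuousAlternatingMap (w y)) x :=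
  (ContinuousLinearMap.compContinuousAlternatingMapCLM ℝ E F F' (Fin k) l).contDiff.contDiffAt.comp
    x hw

theorem extDeriv_const {F : Type*} [NormedAddCommGroup F] [NormedSpace ℝ F] {k : ℕ}
    (c : E [⋀^Fin k]→L[ℝ] F) (x : E) : extDeriv (fun _ : E => c) x = 0 := by
  rw [extDeriv, fderiv_fun_const]
  exact map_zero (ContinuousAlternatingMap.alternatizeUncurryFinCLM ℝ E F)

variable {𝔤 V : Type*} [NormedAddCommGroup 𝔤] [NormedSpace ℝ 𝔤] [FiniteDimensional ℝ 𝔤]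
  [NormedAddCommGroup V] [NormedSpace ℝ V] [FiniteDimensional ℝ V] [FiniteDimensional ℝ E]

theorem contDiffAt_substForm {r : WithTop ℕ∞} {W : E'' → E [⋀^Fin 2]→L[ℝ] 𝔤}
    {θ : E'' → E [⋀^Fin 1]→L[ℝ] V} {x : E''} (hW : ContDiffAt ℝ r W x) (hθ : ContDiffAt ℝ r θ x)
    (n : ℕ) (f : AAlg 𝔤 V) : ContDiffAt ℝ r (fun y => substForm (W y) (θ y) n f) x := by
  induction f using AAlg.induction generalizing n with
  | halg c =>
    by_cases hn : n = 0
    · subst hn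
      simp only [substForm_algebraMap_zero]
      exact contDiffAt_const
    · simp only [substForm_algebraMap_of_ne _ _ _ hn]
      exact contDiffAt_const
  | hsymm l =>
    by_cases hn : n = 2
    · subst hn
      simp only [substForm_symm_two]
      exact contDiffAt_clm_comp (LinearMap.toContinuousLinearMap l) hW
    · simp only [substForm_symm_of_ne _ _ _ hn]
      exact contDiffAt_const
  | hext l =>
    by_cases hn : n = 1
    · subst hn
      simp only [substForm_ext_one]
      exact contDiffAt_clm_comp (LinearMap.toContinuousLinearMap l) hθ
    · simp only [substForm_ext_of_ne _ _ _ hn]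
      exact contDiffAt_const
  | hmul f g hf hg =>
    simp only [substForm_mul]
    exact contDiffAt_wedgeSum hf hg n
  | hadd f g hf hg =>
    simp only [map_add]
    exact (hf n).add (hg n)

/-- If `dW` and `dθ` vanish at a point, so does the exterior derivative of `f(W, …, θ)`, by the
Leibniz rule. -/
theorem extDeriv_substForm_eq_zero {W : E → E [⋀^Fin 2]→L[ℝ] 𝔤} {θ : E → E [⋀^Fin 1]→L[ℝ] V}
    {x : E} (hW : DifferentiableAt ℝ W x) (hθ : DifferentiableAt ℝ θ x) (hW' : extDeriv W x = 0)
    (hθ' : extDeriv θ x = 0) (n : ℕ) (f : AAlg 𝔤 V) :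
    DifferentiableAt ℝ (fun y => substForm (W y) (θ y) n f) x ∧
      extDeriv (fun y => substForm (W y) (θ y) n f) x = 0 := by
  induction f using AAlg.induction generalizing n with
  | halg c =>
    by_cases hn : n = 0
    · subst hn
      simp only [substForm_algebraMap_zero]
      exact ⟨differentiableAt_const _, extDeriv_const _ _⟩
    · simp only [substForm_algebraMap_of_ne _ _ _ hn]
      exact ⟨differentiableAt_const _, extDeriv_const _ _⟩
  | hsymm l =>
    by_cases hn : n = 2
    · subst hn
      simp only [substForm_symm_two]
      refine ⟨(ContinuousLinearMap.compContinuousAlternatingMapCLM ℝ E 𝔤 ℝ (Fin 2)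
        (LinearMap.toContinuousLinearMap l)).differentiableAt.comp x hW, ?_⟩
      refine (extDeriv_clm_comp (LinearMap.toContinuousLinearMap l) hW).trans ?_
      rw [hW']; ext; simp
    · simp only [substForm_symm_of_ne _ _ _ hn]
      exact ⟨differentiableAt_const _, extDeriv_const _ _⟩
  | hext l =>
    by_cases hn : n = 1
    · subst hn
      simp only [substForm_ext_one]
      refine ⟨(ContinuousLinearMap.compContinuousAlternatingMapCLM ℝ E V ℝ (Fin 1)
        (LinearMap.toContinuousLinearMap l)).differentiableAt.comp x hθ, ?_⟩
      refine (extDeriv_clm_comp (LinearMap.toContinuousLinearMap l) hθ).trans ?_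
      rw [hθ']; ext; simp
    · simp only [substForm_ext_of_ne _ _ _ hn]
      exact ⟨differentiableAt_const _, extDeriv_const _ _⟩
  | hmul f g hf hg =>
    simp only [substForm_mul]
    exact ⟨differentiableAt_wedgeSum (fun k => (hf k).1) (fun k => (hg k).1) n,
      extDeriv_wedgeSum_eq_zero (fun k => (hf k).1) (fun k => (hg k).1) (fun k => (hf k).2)
        (fun k => (hg k).2) n⟩
  | hadd f g hf hg =>
    simp only [map_add]
    refine ⟨(hf n).1.add (hg n).1, ?_⟩
    refine (extDeriv_add (hf n).1 (hg n).1).trans ?_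
    rw [(hf n).2, (hg n).2, add_zero]

end SubstitutionCalculus

/-! ### Polynomial dependence on a parameter -/

section Polynomial

/-- A quadrature rule that integrates the derivatives of polynomials of bounded degree from `0` to
`1` exactly. -/
theorem exists_quadrature (N : ℕ) :
    ∃ w : Fin N → ℝ, ∀ i : Fin N, ∑ j : Fin N, w j * ((i : ℝ) + 1) * (j : ℝ) ^ (i : ℕ) = 1 := by
  -- the weights solve a system of linear equations whose matrix is a Vandermonde matrix
  have hdet : IsUnit (Matrix.vandermonde fun j : Fin N => (j : ℝ)).det := by
    rw [isUnit_iff_ne_zero]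
    refine Matrix.det_vandermonde_ne_zero_iff.2 fun a b hab => ?_
    exact Fin.ext (by exact_mod_cast hab)
  refine ⟨Matrix.vecMul (fun i : Fin N => ((i : ℝ) + 1)⁻¹)
    (Matrix.vandermonde fun j : Fin N => (j : ℝ))⁻¹, fun i => ?_⟩
  have h : Matrix.vecMul (Matrix.vecMul (fun i : Fin N => ((i : ℝ) + 1)⁻¹)
      (Matrix.vandermonde fun j : Fin N => (j : ℝ))⁻¹)
      (Matrix.vandermonde fun j : Fin N => (j : ℝ)) i = ((i : ℝ) + 1)⁻¹ := by
    rw [Matrix.vecMul_vecMul, Matrix.nonsing_inv_mul _ hdet, Matrix.vecMul_one]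
  have hi : ((i : ℝ) + 1) ≠ 0 := by positivity
  refine Eq.trans ?_ ((congrArg (fun x => ((i : ℝ) + 1) * x) h).trans (mul_inv_cancel₀ hi))
  conv_rhs => rw [Matrix.vecMul, dotProduct, Finset.mul_sum]
  refine Finset.sum_congr rfl fun j _ => ?_
  rw [Matrix.vandermonde_apply]
  ring

/-- For a vector-valued polynomial `F` of bounded degree, `F(1) - F(0)` is a fixed linear
combination of values of the derivative of `F`. -/
theorem exists_quadrature_sub (N : ℕ) :
    ∃ w : Fin N → ℝ, ∀ {Z : Type*} [NormedAddCommGroup Z] [NormedSpace ℝ Z] (F F' : ℝ → Z)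
      (_ : ∀ t, HasDerivAt F (F' t) t) (c : ℕ → Z)
      (_ : ∀ t, F t = ∑ i ∈ Finset.range (N + 1), t ^ i • c i),
      F 1 - F 0 = ∑ j : Fin N, w j • F' (j : ℝ) := by
  obtain ⟨w, hw⟩ := exists_quadrature N
  refine ⟨w, fun {Z} _ _ F F' hF c hc => ?_⟩
  have hd : ∀ t : ℝ, F' t = ∑ i : Fin N, (((i : ℝ) + 1) * t ^ (i : ℕ)) • c (i + 1) := by
    intro t
    have h1 : HasDerivAt F (∑ i ∈ Finset.range (N + 1), ((i : ℝ) * t ^ (i - 1)) • c i) t := by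
      rw [funext hc]
      exact HasDerivAt.fun_sum fun i _ => (hasDerivAt_pow i t).smul_const (c i)
    rw [(hF t).unique h1, Finset.sum_range_succ', Finset.sum_range]
    simp
  have e1 : F 1 - F 0 = ∑ i : Fin N, c (i + 1) := by
    rw [hc, hc, Finset.sum_range_succ', Finset.sum_range_succ', Finset.sum_range,
      Finset.sum_range]
    simp
  rw [e1]
  simp only [hd, Finset.smul_sum, smul_smul]
  rw [Finset.sum_comm]
  refine Finset.sum_congr rfl fun i _ => ?_
  rw [← Finset.sum_smul]
  simp only [← mul_assoc, hw i, one_smul]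

theorem exists_coeff_bilinear {X Y Z : Type*} [NormedAddCommGroup X] [NormedSpace ℝ X]
    [NormedAddCommGroup Y] [NormedSpace ℝ Y] [NormedAddCommGroup Z] [NormedSpace ℝ Z]
    (b : X →L[ℝ] Y →L[ℝ] Z) (N₁ N₂ : ℕ) (c : ℕ → X) (d : ℕ → Y) :
    ∃ e : ℕ → Z, ∀ t : ℝ, b (∑ i ∈ Finset.range N₁, t ^ i • c i)
      (∑ j ∈ Finset.range N₂, t ^ j • d j) = ∑ m ∈ Finset.range (N₁ + N₂), t ^ m • e m := by
  refine ⟨fun m => ∑ ij ∈ Finset.range N₁ ×ˢ Finset.range N₂ with ij.1 + ij.2 = m,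
    b (c ij.1) (d ij.2), fun t => ?_⟩
  have h1 : b (∑ i ∈ Finset.range N₁, t ^ i • c i) (∑ j ∈ Finset.range N₂, t ^ j • d j) =
      ∑ ij ∈ Finset.range N₁ ×ˢ Finset.range N₂, t ^ (ij.1 + ij.2) • b (c ij.1) (d ij.2) := by
    rw [Finset.sum_product_right, map_sum]
    refine Finset.sum_congr rfl fun j _ => ?_
    rw [map_sum, sum_apply]
    refine Finset.sum_congr rfl fun i _ => ?_
    simp [pow_add, smul_smul, mul_comm]
  rw [h1, ← Finset.sum_fiberwise_of_maps_to (t := Finset.range (N₁ + N₂))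
    (g := fun ij : ℕ × ℕ => ij.1 + ij.2)]
  · refine Finset.sum_congr rfl fun m _ => ?_
    rw [Finset.smul_sum]
    refine Finset.sum_congr rfl fun ij hij => ?_
    rw [(Finset.mem_filter.1 hij).2]
  · intro ij hij
    simp only [Finset.mem_product, Finset.mem_range] at hij ⊢
    omega

theorem exists_coeff_mono {Z : Type*} [NormedAddCommGroup Z] [NormedSpace ℝ Z] {N N' : ℕ}
    (h : N ≤ N') (c : ℕ → Z) : ∃ d : ℕ → Z, ∀ t : ℝ,
      ∑ i ∈ Finset.range N, t ^ i • c i = ∑ i ∈ Finset.range N', t ^ i • d i := by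
  refine ⟨fun i => if i < N then c i else 0, fun t => ?_⟩
  rw [← Finset.sum_subset (Finset.range_mono h) (f := fun i => t ^ i • if i < N then c i else 0)]
  · refine Finset.sum_congr rfl fun i hi => ?_
    rw [if_pos (Finset.mem_range.1 hi)]
  · intro i _ hi
    rw [if_neg (by simpa using hi), smul_zero]

variable {𝔤 V E : Type*} [NormedAddCommGroup 𝔤] [NormedSpace ℝ 𝔤] [FiniteDimensional ℝ 𝔤]
  [NormedAddCommGroup V] [NormedSpace ℝ V] [FiniteDimensional ℝ V]
  [NormedAddCommGroup E] [NormedSpace ℝ E] [FiniteDimensional ℝ E]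

variable (E) in
/-- If the two-form `W` depends polynomially on a parameter, then so does `f(W, …, W, θ, …, θ)`, and
its degree is bounded in terms of `f` and the degree of `W`. -/
theorem exists_substForm_polynomial (D : ℕ) (f : AAlg 𝔤 V) :
    ∃ N : ℕ, ∀ (w : ℕ → E [⋀^Fin 2]→L[ℝ] 𝔤) (θ : E [⋀^Fin 1]→L[ℝ] V) (n : ℕ),
      ∃ c : ℕ → E [⋀^Fin n]→L[ℝ] ℝ, ∀ t : ℝ,
        substForm (∑ i ∈ Finset.range D, t ^ i • w i) θ n f =
          ∑ i ∈ Finset.range N, t ^ i • c i := by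
  have hconst : ∀ {n : ℕ} (F : ℝ → E [⋀^Fin n]→L[ℝ] ℝ) (a : E [⋀^Fin n]→L[ℝ] ℝ),
      (∀ t, F t = a) → ∃ c : ℕ → E [⋀^Fin n]→L[ℝ] ℝ, ∀ t : ℝ,
        F t = ∑ i ∈ Finset.range 1, t ^ i • c i :=
    fun F a ha => ⟨fun _ => a, fun t => by simp [ha]⟩
  induction f using AAlg.induction with
  | halg r =>
    refine ⟨1, fun w θ n => ?_⟩
    by_cases hn : n = 0
    · subst hn
      exact hconst _ _ fun t => substForm_algebraMap_zero _ _ _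
    · exact hconst _ _ fun t => substForm_algebraMap_of_ne _ _ _ hn
  | hsymm l =>
    refine ⟨D + 1, fun w θ n => ?_⟩
    by_cases hn : n = 2
    · subst hn
      obtain ⟨d, hd⟩ := exists_coeff_mono (Nat.le_succ D) (fun i => dualComp (w i) l)
      refine ⟨d, fun t => ?_⟩
      rw [substForm_symm_two, ← hd]
      ext X
      simp [ContinuousAlternatingMap.sum_apply]
    · obtain ⟨c, hc⟩ := hconst (fun t => substForm (∑ i ∈ Finset.range D, t ^ i • w i) θ n
        (SymmetricAlgebra.ι ℝ _ l ⊗ₜ 1)) _ fun t => substForm_symm_of_ne _ _ _ hn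
      obtain ⟨d, hd⟩ := exists_coeff_mono (by omega : 1 ≤ D + 1) c
      exact ⟨d, fun t => (hc t).trans (hd t)⟩
  | hext l =>
    refine ⟨1, fun w θ n => ?_⟩
    by_cases hn : n = 1
    · subst hn
      exact hconst _ _ fun t => substForm_ext_one _ _ _
    · exact hconst _ _ fun t => substForm_ext_of_ne _ _ _ hn
  | hmul f g hf hg =>
    obtain ⟨N₁, h₁⟩ := hf
    obtain ⟨N₂, h₂⟩ := hg
    refine ⟨N₁ + N₂, fun w θ n => ?_⟩
    choose c hc using h₁ w θ
    choose d hd using h₂ w θ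
    have hex : ∀ ij : Finset.HasAntidiagonal.antidiagonal n,
        ∃ e : ℕ → E [⋀^Fin n]→L[ℝ] ℝ, ∀ t : ℝ,
          wedge (Finset.HasAntidiagonal.mem_antidiagonal.1 ij.2)
            (∑ i ∈ Finset.range N₁, t ^ i • c ij.1.1 i)
            (∑ i ∈ Finset.range N₂, t ^ i • d ij.1.2 i) =
            ∑ m ∈ Finset.range (N₁ + N₂), t ^ m • e m := fun ij =>
      exists_coeff_bilinear (wedgeCLM E (Finset.HasAntidiagonal.mem_antidiagonal.1 ij.2)) N₁ N₂
        (c ij.1.1) (d ij.1.2)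
    choose e he using hex
    refine ⟨fun m => ∑ ij, e ij m, fun t => ?_⟩
    rw [substForm_mul]
    unfold wedgeSum
    simp only [hc, hd, he, Finset.smul_sum]
    exact Finset.sum_comm
  | hadd f g hf hg =>
    obtain ⟨N₁, h₁⟩ := hf
    obtain ⟨N₂, h₂⟩ := hg
    refine ⟨max N₁ N₂, fun w θ n => ?_⟩
    obtain ⟨c, hc⟩ := h₁ w θ n
    obtain ⟨d, hd⟩ := h₂ w θ n
    obtain ⟨c', hc'⟩ := exists_coeff_mono (le_max_left N₁ N₂) c
    obtain ⟨d', hd'⟩ := exists_coeff_mono (le_max_right N₁ N₂) d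
    refine ⟨fun i => c' i + d' i, fun t => ?_⟩
    rw [map_add, hc, hd, hc', hd', ← Finset.sum_add_distrib]
    exact Finset.sum_congr rfl fun i _ => (smul_add _ _ _).symm

end Polynomial

/-! ### The wedge product of forms on a manifold and de Rham cohomology -/

section WedgeSum

variable {E : Type*} [NormedAddCommGroup E] [NormedSpace ℝ E]

/-- The term `a_i ∧ b_j` of the sum `wedgeSum a b n`, which is `0` if `i + j ≠ n`. -/
def wedgeTerm (a b : ∀ k : ℕ, E [⋀^Fin k]→L[ℝ] ℝ) (n : ℕ) (ij : ℕ × ℕ) : E [⋀^Fin n]→L[ℝ] ℝ :=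
  if h : ij.1 + ij.2 = n then wedge h (a ij.1) (b ij.2) else 0

theorem wedgeSum_eq_sum_wedgeTerm (a b : ∀ k : ℕ, E [⋀^Fin k]→L[ℝ] ℝ) (n : ℕ) :
    wedgeSum a b n = ∑ ij ∈ Finset.HasAntidiagonal.antidiagonal n, wedgeTerm a b n ij := by
  rw [← Finset.sum_coe_sort]
  refine Finset.sum_congr rfl fun ij _ => ?_
  rw [wedgeTerm, dif_pos (Finset.HasAntidiagonal.mem_antidiagonal.1 ij.2)]

theorem wedgeSum_add_left (a a' b : ∀ k : ℕ, E [⋀^Fin k]→L[ℝ] ℝ) (n : ℕ) :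
    wedgeSum (a + a') b n = wedgeSum a b n + wedgeSum a' b n := by
  simp only [wedgeSum, Pi.add_apply, wedge_add_left, Finset.sum_add_distrib]

theorem wedgeSum_add_right (a b b' : ∀ k : ℕ, E [⋀^Fin k]→L[ℝ] ℝ) (n : ℕ) :
    wedgeSum a (b + b') n = wedgeSum a b n + wedgeSum a b' n := by
  simp only [wedgeSum, Pi.add_apply, wedge_add_right, Finset.sum_add_distrib]

/-- The exterior derivative of a family of forms, one of each degree. -/
def extDerivFamily (a : E → ∀ k : ℕ, E [⋀^Fin k]→L[ℝ] ℝ) (x : E) : ∀ k : ℕ, E [⋀^Fin k]→L[ℝ] ℝ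
  | 0 => 0
  | k + 1 => extDeriv (fun y => a y k) x

/-- The graded Leibniz rule for inhomogeneous forms. -/
theorem extDeriv_wedgeSum {a b : E → ∀ k : ℕ, E [⋀^Fin k]→L[ℝ] ℝ} {x : E}
    (ha : ∀ k, DifferentiableAt ℝ (fun y => a y k) x)
    (hb : ∀ k, DifferentiableAt ℝ (fun y => b y k) x) (n : ℕ) :
    extDeriv (fun y => wedgeSum (a y) (b y) n) x =
      wedgeSum (extDerivFamily a x) (b x) (n + 1) +
        wedgeSum (fun k => (-1 : ℝ) ^ k • a x k) (extDerivFamily b x) (n + 1) := by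
  have hsum : (fun y => wedgeSum (a y) (b y) n) = fun y =>
      ∑ ij : Finset.HasAntidiagonal.antidiagonal n,
        wedge (Finset.HasAntidiagonal.mem_antidiagonal.1 ij.2) (a y ij.1.1) (b y ij.1.2) := rfl
  rw [hsum, extDeriv_sum fun ij _ => differentiableAt_wedge _ (ha _) (hb _),
    wedgeSum_eq_sum_wedgeTerm, wedgeSum_eq_sum_wedgeTerm, Finset.Nat.sum_antidiagonal_succ,
    Finset.Nat.sum_antidiagonal_succ']
  have h0 : wedgeTerm (extDerivFamily a x) (b x) (n + 1) (0, n + 1) = 0 := by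
    rw [wedgeTerm]; split_ifs <;> simp [extDerivFamily]
  have h0' : wedgeTerm (fun k => (-1 : ℝ) ^ k • a x k) (extDerivFamily b x) (n + 1) (n + 1, 0) =
      0 := by
    rw [wedgeTerm]; split_ifs <;> simp [extDerivFamily]
  rw [h0, h0', zero_add, zero_add, ← Finset.sum_add_distrib,
    ← Finset.sum_coe_sort (Finset.HasAntidiagonal.antidiagonal n)]
  refine Finset.sum_congr rfl ?_
  rintro ⟨⟨i, j⟩, hij⟩ -
  have h := Finset.HasAntidiagonal.mem_antidiagonal.1 hij
  simp only at h
  rw [extDeriv_wedge h (by omega) (by omega) (ha _) (hb _), wedgeTerm, wedgeTerm,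
    dif_pos (by simp only; omega), dif_pos (by simp only; omega)]
  simp only [wedge_smul_left]
  rfl

end WedgeSum

section TotalForms

variable {E : Type*} [NormedAddCommGroup E] [NormedSpace ℝ E] {M : Type*}

theorem TotalForm.wedge_apply (α β : TotalForm E M) (n : ℕ) (x : M) :
    α.wedge β n x = wedgeSum (fun k => α k x) (fun k => β k x) n := rfl

/-- The grade involution of inhomogeneous forms, which is `(-1)^k` in degree `k`. -/
def TotalForm.involute (α : TotalForm E M) : TotalForm E M := fun k => (-1 : ℝ) ^ k • α k

theorem TotalForm.wedge_add_left (α α' β : TotalForm E M) :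
    (α + α').wedge β = α.wedge β + α'.wedge β := by
  funext n x
  exact wedgeSum_add_left (fun k => α k x) (fun k => α' k x) (fun k => β k x) n

theorem TotalForm.wedge_add_right (α β β' : TotalForm E M) :
    α.wedge (β + β') = α.wedge β + α.wedge β' := by
  funext n x
  exact wedgeSum_add_right (fun k => α k x) (fun k => β k x) (fun k => β' k x) n

theorem TotalForm.wedge_zero_left (β : TotalForm E M) : (0 : TotalForm E M).wedge β = 0 := by
  funext n x
  rw [TotalForm.wedge_apply, wedgeSum]
  exact Finset.sum_eq_zero fun ij _ => GenChernWeil.wedge_zero_left _ _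

theorem TotalForm.wedge_zero_right (α : TotalForm E M) : α.wedge (0 : TotalForm E M) = 0 := by
  funext n x
  rw [TotalForm.wedge_apply, wedgeSum]
  exact Finset.sum_eq_zero fun ij _ => GenChernWeil.wedge_zero_right _ _

theorem TotalForm.involute_involute (α : TotalForm E M) : α.involute.involute = α := by
  funext k
  simp [TotalForm.involute, smul_smul, ← mul_pow]

end TotalForms

section Forms

variable {E : Type*} [NormedAddCommGroup E] [NormedSpace ℝ E]
  {M : Type*} [TopologicalSpace M] [ChartedSpace E M]

/-- The derivative at `x` of the chart around `x₀`. -/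
def chartDeriv (x₀ x : M) : E →L[ℝ] E := mfderiv 𝓘(ℝ, E) 𝓘(ℝ, E) (chartAt E x₀) x

/-- The derivative at `y` of the inverse of the chart around `x₀`. -/
def chartSymmDeriv (x₀ : M) (y : E) : E →L[ℝ] E :=
  mfderiv 𝓘(ℝ, E) 𝓘(ℝ, E) (chartAt E x₀).symm y

theorem chartSymmDeriv_comp_chartDeriv [IsManifold 𝓘(ℝ, E) ∞ M] (x₀ : M) {x : M}
    (hx : x ∈ (chartAt E x₀).source) :
    (chartSymmDeriv x₀ (chartAt E x₀ x)).comp (chartDeriv x₀ x) = ContinuousLinearMap.id ℝ E := by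
  have : IsManifold 𝓘(ℝ, E) 1 M := IsManifold.of_le (n := ∞) (by simp)
  exact (mdifferentiable_chart (I := 𝓘(ℝ, E)) x₀).symm_comp_deriv hx

theorem DiffForm.inChart_apply {F : Type*} [NormedAddCommGroup F] [NormedSpace ℝ F] {k : ℕ}
    (α : DiffForm E M F k) (x₀ : M) (y : E) : α.inChart x₀ y =
      (α ((chartAt E x₀).symm y)).compContinuousLinearMap (chartSymmDeriv x₀ y) := rfl

theorem DiffForm.d_apply {F : Type*} [NormedAddCommGroup F] [NormedSpace ℝ F] {k : ℕ}
    (α : DiffForm E M F k) (x : M) : α.d x =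
      (extDeriv (α.inChart x) (chartAt E x x)).compContinuousLinearMap (chartDeriv x x) := rfl

theorem DiffForm.inChart_comp_chartDeriv [IsManifold 𝓘(ℝ, E) ∞ M] {F : Type*}
    [NormedAddCommGroup F] [NormedSpace ℝ F] {k : ℕ} (α : DiffForm E M F k) (x₀ : M) {x : M}
    (hx : x ∈ (chartAt E x₀).source) :
    (α.inChart x₀ (chartAt E x₀ x)).compContinuousLinearMap (chartDeriv x₀ x) = α x := by
  rw [DiffForm.inChart_apply, (chartAt E x₀).left_inv hx]
  ext X
  simp only [ContinuousAlternatingMap.compContinuousLinearMap_apply]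
  congr 1
  funext i
  exact DFunLike.congr_fun (chartSymmDeriv_comp_chartDeriv x₀ hx) (X i)

/-- The exterior derivative of inhomogeneous forms. -/
def TotalForm.d (α : TotalForm E M) : TotalForm E M
  | 0 => 0
  | k + 1 => (α k).d

theorem TotalForm.inChart_wedge (α β : TotalForm E M) (n : ℕ) (x₀ : M) (y : E) :
    (α.wedge β n).inChart x₀ y =
      wedgeSum (fun k => (α k).inChart x₀ y) (fun k => (β k).inChart x₀ y) n := by
  rw [DiffForm.inChart_apply, TotalForm.wedge_apply, wedgeSum_compContinuousLinearMap]
  simp only [DiffForm.inChart_apply]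

theorem TotalForm.isSmooth_wedge {α β : TotalForm E M} (hα : ∀ k, (α k).IsSmooth)
    (hβ : ∀ k, (β k).IsSmooth) (n : ℕ) : (α.wedge β n).IsSmooth := by
  intro x₀ y hy
  have hn := (chartAt E x₀).open_target.mem_nhds hy
  refine ContDiffAt.contDiffWithinAt ?_
  rw [funext (TotalForm.inChart_wedge α β n x₀)]
  exact contDiffAt_wedgeSum (fun k => (hα k x₀).contDiffAt hn) (fun k => (hβ k x₀).contDiffAt hn) n

theorem TotalForm.isSmooth_involute {α : TotalForm E M} (hα : ∀ k, (α k).IsSmooth) (k : ℕ) :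
    (α.involute k).IsSmooth := (hα k).smul _

theorem TotalForm.d_wedge [IsManifold 𝓘(ℝ, E) ∞ M] {α β : TotalForm E M}
    (hα : ∀ k, (α k).IsSmooth) (hβ : ∀ k, (β k).IsSmooth) :
    (α.wedge β).d = α.d.wedge β + α.involute.wedge β.d := by
  have keyd : ∀ (γ : TotalForm E M) (x : M) (k : ℕ),
      (extDerivFamily (fun y k => (γ k).inChart x y) (chartAt E x x) k).compContinuousLinearMap
        (chartDeriv x x) = γ.d k x := by
    intro γ x k
    cases k with
    | zero => rfl
    | succ k => rfl
  funext n x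
  have hR : (α.d.wedge β + α.involute.wedge β.d) n x =
      wedgeSum (fun k => α.d k x) (fun k => β k x) n +
        wedgeSum (fun k => α.involute k x) (fun k => β.d k x) n := rfl
  rw [hR]
  cases n with
  | zero =>
    rw [wedgeSum_eq_sum_wedgeTerm, wedgeSum_eq_sum_wedgeTerm]
    simp [wedgeTerm, TotalForm.d]
  | succ n =>
    have hL : (α.wedge β).d (n + 1) x = (extDeriv ((α.wedge β n).inChart x)
      (chartAt E x x)).compContinuousLinearMap (chartDeriv x x) := rfl
    rw [hL, funext (TotalForm.inChart_wedge α β n x),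
      extDeriv_wedgeSum (fun k => (hα k).differentiableAt x) (fun k => (hβ k).differentiableAt x)]
    have hadd : ∀ (a b : E [⋀^Fin (n + 1)]→L[ℝ] ℝ) (L : E →L[ℝ] E),
        (a + b).compContinuousLinearMap L =
          a.compContinuousLinearMap L + b.compContinuousLinearMap L := fun a b L => rfl
    rw [hadd, wedgeSum_compContinuousLinearMap, wedgeSum_compContinuousLinearMap]
    refine congrArg₂ (· + ·) ?_ ?_
    · exact wedgeSum_congr (keyd α x)
        (fun k => (β k).inChart_comp_chartDeriv x (mem_chart_source E x)) _
    · exact wedgeSum_congr (fun k => congrArg (fun z => (-1 : ℝ) ^ k • z)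
        ((α k).inChart_comp_chartDeriv x (mem_chart_source E x))) (keyd β x) _

theorem TotalForm.d_eq_zero_iff {α : TotalForm E M} : α.d = 0 ↔ ∀ k, (α k).d = 0 :=
  ⟨fun h k => congrFun h (k + 1), fun h => funext fun k => by
    cases k with
    | zero => rfl
    | succ k => exact h k⟩

theorem TotalForm.d_involute_eq_zero {α : TotalForm E M} (h : α.d = 0) : α.involute.d = 0 := by
  rw [TotalForm.d_eq_zero_iff] at h ⊢
  intro k
  change DiffForm.d ((-1 : ℝ) ^ k • α k) = 0
  rw [DiffForm.d_smul, h, smul_zero]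

theorem mem_exactForms_iff {α : smoothForms E M} :
    α ∈ exactForms E M ↔ ∃ β : smoothForms E M, (α : TotalForm E M) = (β : TotalForm E M).d := by
  refine exists_congr fun β => ⟨fun h => funext fun k => ?_, fun h => ⟨congrFun h 0, fun k =>
    congrFun h (k + 1)⟩⟩
  cases k with
  | zero => exact h.1
  | succ k => exact h.2 k

theorem deRhamClass_eq_iff {a b : closedForms E M} :
    deRhamClass a = deRhamClass b ↔ ∃ β : smoothForms E M,
      ((a : smoothForms E M) : TotalForm E M) =
        ((b : smoothForms E M) : TotalForm E M) + (β : TotalForm E M).d := by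
  have h : deRhamClass a = deRhamClass b ↔ (a : smoothForms E M) - b ∈ exactForms E M :=
    Submodule.Quotient.eq _
  rw [h, mem_exactForms_iff]
  refine exists_congr fun β => ?_
  rw [Submodule.coe_sub, sub_eq_iff_eq_add']

theorem TotalForm.d_add {α β : TotalForm E M} (hα : ∀ k, (α k).IsSmooth)
    (hβ : ∀ k, (β k).IsSmooth) : (α + β).d = α.d + β.d := by
  funext k
  cases k with
  | zero => exact (add_zero _).symm
  | succ k => exact DiffForm.d_add (hα k) (hβ k)

/-- An algebra homomorphism to `Ω(M)` whose values are closed induces an algebra homomorphism to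
the de Rham cohomology. -/
theorem isDeRhamAlgHom_of_isFormsAlgHom [IsManifold 𝓘(ℝ, E) ∞ M] {A : Type*} [Semiring A]
    [Algebra ℝ A] {μ : A →ₗ[ℝ] smoothForms E M} (hμ : IsFormsAlgHom μ)
    (hc : ∀ f, μ f ∈ closedForms E M) :
    IsDeRhamAlgHom (deRhamClass ∘ₗ μ.codRestrict (closedForms E M) hc) where
  map_one := ⟨⟨μ 1, hc 1⟩, hμ.map_one, rfl⟩
  map_mul f g a b ha hb := by
    obtain ⟨β, hβ⟩ := deRhamClass_eq_iff.1 ha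
    obtain ⟨ξ, hξ⟩ := deRhamClass_eq_iff.1 hb
    change _ = (μ f : TotalForm E M) + _ at hβ
    change _ = (μ g : TotalForm E M) + _ at hξ
    have hda : ((a : smoothForms E M) : TotalForm E M).d = 0 := TotalForm.d_eq_zero_iff.2 a.2
    have hdb : ((b : smoothForms E M) : TotalForm E M).d = 0 := TotalForm.d_eq_zero_iff.2 b.2
    have hdf : (μ f : TotalForm E M).d = 0 := TotalForm.d_eq_zero_iff.2 (hc f)
    have hs : ∀ k, (((a : smoothForms E M) : TotalForm E M).wedge
        ((b : smoothForms E M) : TotalForm E M) k).IsSmooth :=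
      TotalForm.isSmooth_wedge (a : smoothForms E M).2 (b : smoothForms E M).2
    have hcl : (((a : smoothForms E M) : TotalForm E M).wedge
        ((b : smoothForms E M) : TotalForm E M)).d = 0 := by
      rw [TotalForm.d_wedge (a : smoothForms E M).2 (b : smoothForms E M).2, hda, hdb,
        TotalForm.wedge_zero_left, TotalForm.wedge_zero_right, add_zero]
    refine ⟨⟨⟨_, hs⟩, TotalForm.d_eq_zero_iff.1 hcl⟩, rfl, deRhamClass_eq_iff.2 ?_⟩
    have h1 := TotalForm.isSmooth_wedge β.2 (b : smoothForms E M).2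
    have h2 := TotalForm.isSmooth_wedge (TotalForm.isSmooth_involute (μ f).2) ξ.2
    refine ⟨⟨_, h1⟩ + ⟨_, h2⟩, ?_⟩
    change _ = (μ (f * g) : TotalForm E M) + TotalForm.d (_ + _)
    rw [TotalForm.d_add h1 h2, TotalForm.d_wedge β.2 (b : smoothForms E M).2, hdb,
      TotalForm.wedge_zero_right, add_zero,
      TotalForm.d_wedge (TotalForm.isSmooth_involute (μ f).2) ξ.2,
      TotalForm.d_involute_eq_zero hdf, TotalForm.wedge_zero_left, zero_add,
      TotalForm.involute_involute, hμ.map_mul]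
    change ((a : smoothForms E M) : TotalForm E M).wedge ((b : smoothForms E M) : TotalForm E M) = _
    nth_rewrite 1 [hβ]
    rw [TotalForm.wedge_add_left]
    nth_rewrite 1 [hξ]
    rw [TotalForm.wedge_add_right]
    abel

end Forms

/-! ### Pulling back forms from a manifold to a vector space -/

section CompSmooth

variable {E E' F X : Type*} [NormedAddCommGroup E] [NormedSpace ℝ E]
  [NormedAddCommGroup E'] [NormedSpace ℝ E'] [NormedAddCommGroup F] [NormedSpace ℝ F]
  [NormedAddCommGroup X] [NormedSpace ℝ X]

/-- The normalized antisymmetrization, a continuous projection from the multilinear to the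
alternating maps. -/
def altProj (E F : Type*) [NormedAddCommGroup E] [NormedSpace ℝ E] [NormedAddCommGroup F]
    [NormedSpace ℝ F] (k : ℕ) :
    ContinuousMultilinearMap ℝ (fun _ : Fin k => E) F →L[ℝ] E [⋀^Fin k]→L[ℝ] F :=
  LinearMap.mkContinuous
    { toFun := fun f => ((k.factorial : ℝ)⁻¹) • ContinuousMultilinearMap.alternatization f
      map_add' := fun f g => by rw [map_add, smul_add]
      map_smul' := fun c f => by
        ext v
        simp only [ContinuousAlternatingMap.smul_apply, RingHom.id_apply,
          ContinuousMultilinearMap.alternatization_apply_apply, Finset.smul_sum,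
          smul_apply]
        refine Finset.sum_congr rfl fun σ _ => ?_
        rw [smul_comm (Equiv.Perm.sign σ) c, smul_comm _ c] } 1 (fun f => by
    rw [one_mul]
    refine ContinuousAlternatingMap.opNorm_le_bound _ (norm_nonneg f) fun v => ?_
    have hk : (0 : ℝ) < (k.factorial : ℝ) := by exact_mod_cast Nat.factorial_pos k
    rw [LinearMap.coe_mk, AddHom.coe_mk, ContinuousAlternatingMap.smul_apply, norm_smul,
      ContinuousMultilinearMap.alternatization_apply_apply, norm_inv,
      Real.norm_of_nonneg hk.le, inv_mul_le_iff₀ hk]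
    refine (norm_sum_le _ _).trans ?_
    have : ∀ σ ∈ (Finset.univ : Finset (Equiv.Perm (Fin k))),
        ‖Equiv.Perm.sign σ • f (v ∘ σ)‖ ≤ ‖f‖ * ∏ i, ‖v i‖ := fun σ _ => by
      rw [← Equiv.prod_comp σ (fun i => ‖v i‖)]
      have h1 : ‖Equiv.Perm.sign σ • f (v ∘ σ)‖ = ‖f (v ∘ σ)‖ := by
        rcases Int.units_eq_one_or (Equiv.Perm.sign σ) with h | h <;> simp [h]
      rw [h1]
      exact f.le_opNorm _
    refine (Finset.sum_le_sum this).trans (le_of_eq ?_)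
    simp [Fintype.card_perm])

theorem altProj_apply {k : ℕ} (a : E [⋀^Fin k]→L[ℝ] F) :
    altProj E F k a.toContinuousMultilinearMap = a := by
  ext v
  have hk : (k.factorial : ℝ) ≠ 0 := by exact_mod_cast Nat.factorial_ne_zero k
  change ((k.factorial : ℝ)⁻¹) • (ContinuousMultilinearMap.alternatization
    a.toContinuousMultilinearMap) v = a v
  rw [ContinuousMultilinearMap.alternatization_apply_apply]
  have : ∀ σ : Equiv.Perm (Fin k),
      Equiv.Perm.sign σ • a.toContinuousMultilinearMap (v ∘ σ) = a v := fun σ => by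
    have h : a.toContinuousMultilinearMap (v ∘ σ) = Equiv.Perm.sign σ • a v :=
      a.toAlternatingMap.map_perm v σ
    rw [h, smul_smul]
    simp
  simp only [this, Finset.sum_const, Finset.card_univ, Fintype.card_perm, Fintype.card_fin]
  rw [← Nat.cast_smul_eq_nsmul ℝ, smul_smul, inv_mul_cancel₀ hk, one_smul]

theorem contDiffAt_compContinuousLinearMap {r : WithTop ℕ∞} {k : ℕ}
    {a : X → E [⋀^Fin k]→L[ℝ] F} {L : X → E' →L[ℝ] E} {x : X} (ha : ContDiffAt ℝ r a x)
    (hL : ContDiffAt ℝ r L x) :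
    ContDiffAt ℝ r (fun y => (a y).compContinuousLinearMap (L y)) x := by
  have h1 : ContDiffAt ℝ r (fun y =>
      ContinuousMultilinearMap.compContinuousLinearMapContinuousMultilinear ℝ
        (fun _ : Fin k => E') (fun _ : Fin k => E) F (fun _ => L y)) x :=
    (ContinuousMultilinearMap.contDiff _).contDiffAt.comp x (contDiffAt_pi.2 fun _ => hL)
  have h2 : ContDiffAt ℝ r (fun y => (a y).toContinuousMultilinearMap) x :=
    (ContinuousAlternatingMap.toContinuousMultilinearMapLI (𝕜 := ℝ) (E := E) (F := F)
      (ι := Fin k)).contDiff.contDiffAt.comp x ha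
  have h3 := (altProj E' F k).contDiff.contDiffAt.comp x (h1.clm_apply h2)
  refine h3.congr_of_eventuallyEq (Filter.Eventually.of_forall fun y => ?_)
  exact (altProj_apply ((a y).compContinuousLinearMap (L y))).symm

end CompSmooth

section Pullback

variable {E F X N : Type*} [NormedAddCommGroup E] [NormedSpace ℝ E]
  [NormedAddCommGroup F] [NormedSpace ℝ F] [NormedAddCommGroup X] [NormedSpace ℝ X]
  [TopologicalSpace N] [ChartedSpace E N]

/-- The derivative of a map from a vector space to a manifold. -/
def tderiv (E : Type*) [NormedAddCommGroup E] [NormedSpace ℝ E] {N : Type*} [TopologicalSpace N]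
    [ChartedSpace E N] (s : X → N) (x : X) : X →L[ℝ] E := mfderiv 𝓘(ℝ, X) 𝓘(ℝ, E) s x

/-- The pullback of a form under a map from a vector space to a manifold. -/
def DiffForm.pullback {k : ℕ} (α : DiffForm E N F k) (s : X → N) : X → X [⋀^Fin k]→L[ℝ] F :=
  fun x => (α (s x)).compContinuousLinearMap (tderiv E s x)

/-- A map from a vector space to a manifold that is smooth near a point. -/
def SmoothNear (E : Type*) [NormedAddCommGroup E] [NormedSpace ℝ E] {N : Type*} [TopologicalSpace N]
    [ChartedSpace E N] (s : X → N) (x : X) : Prop :=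
  ∀ᶠ y in nhds x, ContMDiffAt 𝓘(ℝ, X) 𝓘(ℝ, E) ∞ s y

theorem SmoothNear.eventually {s : X → N} {x : X} (h : SmoothNear E s x) :
    ∀ᶠ y in nhds x, SmoothNear E s y := eventually_eventually_nhds.2 h

theorem SmoothNear.contMDiffAt {s : X → N} {x : X} (h : SmoothNear E s x) :
    ContMDiffAt 𝓘(ℝ, X) 𝓘(ℝ, E) ∞ s x := h.self_of_nhds

theorem SmoothNear.mdifferentiableAt {s : X → N} {x : X} (h : SmoothNear E s x) :
    MDifferentiableAt 𝓘(ℝ, X) 𝓘(ℝ, E) s x := h.contMDiffAt.mdifferentiableAt (by simp)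

variable [IsManifold 𝓘(ℝ, E) ∞ N]

theorem contMDiffAt_chartAt {x₀ x : N} (hx : x ∈ (chartAt E x₀).source) :
    ContMDiffAt 𝓘(ℝ, E) 𝓘(ℝ, E) ∞ (chartAt E x₀) x :=
  (contMDiffOn_chart (I := 𝓘(ℝ, E)) (x := x₀)).contMDiffAt
    ((chartAt E x₀).open_source.mem_nhds hx)

/-- Near a point, the pullback of a form is the pullback of its expression in a chart. -/
theorem DiffForm.pullback_eventuallyEq {k : ℕ} (α : DiffForm E N F k) {s : X → N} {x : X}
    (hs : SmoothNear E s x) :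
    α.pullback s =ᶠ[nhds x] fun y => (α.inChart (s x) (chartAt E (s x) (s y))
      ).compContinuousLinearMap (fderiv ℝ (fun y => chartAt E (s x) (s y)) y) := by
  have hsrc : ∀ᶠ y in nhds x, s y ∈ (chartAt E (s x)).source :=
    hs.contMDiffAt.continuousAt.eventually_mem
      ((chartAt E (s x)).open_source.mem_nhds (mem_chart_source E (s x)))
  filter_upwards [hs, hsrc] with y hy hsy
  have h1 : fderiv ℝ (fun y => chartAt E (s x) (s y)) y =
      (chartDeriv (s x) (s y)).comp (tderiv E s y) := by
    rw [← mfderiv_eq_fderiv]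
    exact mfderiv_comp y ((contMDiffAt_chartAt hsy).mdifferentiableAt (by simp))
      (hy.mdifferentiableAt (by simp))
  rw [h1, DiffForm.pullback]
  conv_lhs => rw [← α.inChart_comp_chartDeriv (s x) hsy]
  rfl

theorem contDiffAt_chartAt_comp {s : X → N} {x : X} (hs : SmoothNear E s x) :
    ContDiffAt ℝ ∞ (fun y => chartAt E (s x) (s y)) x := by
  have h := (contMDiffAt_chartAt (mem_chart_source E (s x))).comp x hs.contMDiffAt
  exact h.contDiffAt

theorem DiffForm.IsSmooth.contDiffAt_pullback {k : ℕ} {α : DiffForm E N F k} (hα : α.IsSmooth)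
    {s : X → N} {x : X} (hs : SmoothNear E s x) : ContDiffAt ℝ ∞ (α.pullback s) x := by
  refine ContDiffAt.congr_of_eventuallyEq ?_ (α.pullback_eventuallyEq hs)
  have h1 := contDiffAt_chartAt_comp hs
  refine contDiffAt_compContinuousLinearMap ?_ (h1.fderiv_right (by simp))
  exact ((hα (s x)).contDiffAt ((chartAt E (s x)).open_target.mem_nhds
    (mem_chart_target E (s x)))).comp x h1

/-- The exterior derivative commutes with pullback along smooth maps from a vector space. -/
theorem DiffForm.IsSmooth.extDeriv_pullback {k : ℕ} {α : DiffForm E N F k} (hα : α.IsSmooth)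
    {s : X → N} {x : X} (hs : SmoothNear E s x) :
    extDeriv (α.pullback s) x = α.d.pullback s x := by
  have h1 := contDiffAt_chartAt_comp hs
  rw [(α.pullback_eventuallyEq hs).extDeriv_eq,
    _root_.extDeriv_pullback (f := fun y => chartAt E (s x) (s y)) (hα.differentiableAt (s x)) h1
      (by rw [minSmoothness_of_isRCLikeNormedField]; exact WithTop.coe_le_coe.2 le_top)]
  have h2 : fderiv ℝ (fun y => chartAt E (s x) (s y)) x =
      (chartDeriv (s x) (s x)).comp (tderiv E s x) := by
    rw [← mfderiv_eq_fderiv]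
    exact mfderiv_comp x ((contMDiffAt_chartAt (mem_chart_source E (s x))).mdifferentiableAt
      (by simp)) hs.mdifferentiableAt
  rw [h2, DiffForm.pullback, DiffForm.d_apply]
  rfl

end Pullback

/-! ### Derivatives of the principal action -/

section ManifoldDerivative

variable {E E' E'' : Type*} [NormedAddCommGroup E] [NormedSpace ℝ E]
  [NormedAddCommGroup E'] [NormedSpace ℝ E'] [NormedAddCommGroup E''] [NormedSpace ℝ E'']
  {M N L : Type*} [TopologicalSpace M] [ChartedSpace E M] [TopologicalSpace N] [ChartedSpace E' N]
  [TopologicalSpace L] [ChartedSpace E'' L]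

/-- The derivative of a map of manifolds, regarded as a linear map between the model spaces. -/
def mder (E E' : Type*) [NormedAddCommGroup E] [NormedSpace ℝ E]
    [NormedAddCommGroup E'] [NormedSpace ℝ E'] {M N : Type*} [TopologicalSpace M]
    [ChartedSpace E M] [TopologicalSpace N] [ChartedSpace E' N] (f : M → N) (x : M) : E →L[ℝ] E' :=
  mfderiv 𝓘(ℝ, E) 𝓘(ℝ, E') f x

theorem mder_comp {g : N → L} {f : M → N} {x : M}
    (hg : MDifferentiableAt 𝓘(ℝ, E') 𝓘(ℝ, E'') g (f x))
    (hf : MDifferentiableAt 𝓘(ℝ, E) 𝓘(ℝ, E') f x) :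
    mder E E'' (fun z => g (f z)) x = (mder E' E'' g (f x)).comp (mder E E' f x) :=
  mfderiv_comp x hg hf

theorem mder_const (c : N) (x : M) : mder E E' (fun _ : M => c) x = 0 := mfderiv_const

theorem mder_id (x : M) : mder E E (fun z => z) x = ContinuousLinearMap.id ℝ E := mfderiv_id

theorem mder_congr {f g : M → N} {x : M} (h : f =ᶠ[nhds x] g) : mder E E' f x = mder E E' g x :=
  h.mfderiv_eq

end ManifoldDerivative

section Action

variable {EM EP EG EN : Type*}
  [NormedAddCommGroup EM] [NormedSpace ℝ EM] [NormedAddCommGroup EP] [NormedSpace ℝ EP]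
  [NormedAddCommGroup EG] [NormedSpace ℝ EG] [NormedAddCommGroup EN] [NormedSpace ℝ EN]
  {M P G N : Type*}
  [TopologicalSpace M] [ChartedSpace EM M]
  [TopologicalSpace P] [ChartedSpace EP P]
  [TopologicalSpace G] [ChartedSpace EG G] [Group G]
  [TopologicalSpace N] [ChartedSpace EN N]

/-- The Maurer-Cartan form: the derivative at `g` of the left translation by `g⁻¹`. -/
def maurerCartan (EG : Type*) [NormedAddCommGroup EG] [NormedSpace ℝ EG] {G : Type*}
    [TopologicalSpace G] [ChartedSpace EG G] [Group G] (g : G) : EG →L[ℝ] EG :=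
  mder EG EG (fun x : G => g⁻¹ * x) g

theorem maurerCartan_one : maurerCartan EG (1 : G) = ContinuousLinearMap.id ℝ EG := by
  have h : (fun x : G => (1 : G)⁻¹ * x) = id := by funext x; simp
  rw [maurerCartan, h]
  exact mfderiv_id

namespace PrincipalBundle

variable (B : PrincipalBundle EM EP EG M P G)

theorem mdifferentiableAt_proj (u : P) : MDifferentiableAt 𝓘(ℝ, EP) 𝓘(ℝ, EM) B.proj u :=
  (B.contMDiff_proj u).mdifferentiableAt (by simp)

theorem contMDiff_act_left (g : G) :
    ContMDiff 𝓘(ℝ, EP) 𝓘(ℝ, EP) ∞ (fun u => B.act u g) :=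
  B.contMDiff_act.comp (contMDiff_id.prodMk contMDiff_const)

theorem contMDiff_act_right (u : P) : ContMDiff 𝓘(ℝ, EG) 𝓘(ℝ, EP) ∞ (B.act u) :=
  B.contMDiff_act.comp (contMDiff_const.prodMk contMDiff_id)

theorem mdifferentiableAt_act_left (g : G) (u : P) :
    MDifferentiableAt 𝓘(ℝ, EP) 𝓘(ℝ, EP) (fun u => B.act u g) u :=
  (B.contMDiff_act_left g u).mdifferentiableAt (by simp)

theorem mdifferentiableAt_act_right (u : P) (g : G) :
    MDifferentiableAt 𝓘(ℝ, EG) 𝓘(ℝ, EP) (B.act u) g :=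
  (B.contMDiff_act_right u g).mdifferentiableAt (by simp)

theorem dproj_dright (g : G) (u : P) (X : EP) :
    B.dproj (B.act u g) (B.dright g u X) = B.dproj u X := by
  have h1 := mder_comp (g := B.proj) (B.mdifferentiableAt_proj _)
    (B.mdifferentiableAt_act_left g u)
  simp only [B.proj_act] at h1
  exact (congrArg (fun L => L X) h1).symm

theorem dproj_fundamental (u : P) (A : EG) : B.dproj u (B.fundamental u A) = 0 := by
  have h1 := mder_comp (g := B.proj) (B.mdifferentiableAt_proj _)
    (B.mdifferentiableAt_act_right u 1)
  simp only [B.proj_act, mder_const, B.act_one] at h1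
  exact (congrArg (fun L => L A) h1).symm

theorem dright_one (u : P) : B.dright 1 u = ContinuousLinearMap.id ℝ EP := by
  have h : (fun u' : P => B.act u' 1) = id := by funext x; simp [B.act_one]
  rw [dright, h]
  exact mfderiv_id

theorem surjective_proj (x : M) : ∃ u, B.proj u = x := by
  obtain ⟨e, he, -⟩ := B.locally_trivial x
  exact ⟨_, e.proj_symm_apply (x := (x, (1 : G))) (e.mem_target.2 he)⟩

/-- The derivative of a local section is a lift of the derivative of the inverse chart. -/
theorem dproj_comp_tderiv {s : EM → P} {x₀ : M} {y : EM} (hs : SmoothNear EP s y)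
    (h : ∀ᶠ y in nhds y, B.proj (s y) = (chartAt EM x₀).symm y) :
    (B.dproj (s y)).comp (tderiv EP s y) = chartSymmDeriv x₀ y := by
  have h1 := mder_comp (g := B.proj) (f := s) (x := y) (B.mdifferentiableAt_proj _)
    hs.mdifferentiableAt
  exact h1.symm.trans (mder_congr h)

theorem exists_act_eq {u u' : P} (h : B.proj u = B.proj u') : ∃ g, B.act u g = u' := by
  obtain ⟨e, he, -, -, hee⟩ := B.locally_trivial (B.proj u)
  have hu : u ∈ e.source := e.mem_source.2 he
  have hu' : u' ∈ e.source := e.mem_source.2 (h ▸ he)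
  refine ⟨(e u).2⁻¹ * (e u').2, e.injOn (e.mem_source.2 ?_) hu' ?_⟩
  · rwa [B.proj_act]
  · change e (B.act _ _) = e u'
    rw [hee _ hu]
    refine Prod.ext ?_ (by simp)
    rw [e.coe_fst hu, e.coe_fst hu', h]

variable [LieGroup 𝓘(ℝ, EG) ∞ G]

/-- The derivative of `g ↦ u g` at an arbitrary point. -/
theorem mder_act_right (u : P) (g : G) :
    mder EG EP (B.act u) g = (B.fundamental (B.act u g)).comp (maurerCartan EG g) := by
  have h : B.act u = fun x => B.act (B.act u g) (g⁻¹ * x) := by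
    funext x
    simp [← B.act_mul]
  have h1 := mder_comp (g := B.act (B.act u g)) (f := fun x : G => g⁻¹ * x) (x := g)
    (B.mdifferentiableAt_act_right _ _)
    ((contMDiff_mul_left (I := 𝓘(ℝ, EG)) (n := ∞) (a := g⁻¹) g).mdifferentiableAt (by simp))
  rw [← h, inv_mul_cancel] at h1
  exact h1

/-- The derivative of a product `n ↦ σ(n) h(n)` of a map to `P` and a map to `G`. -/
theorem mder_act_comp {σ : N → P} {h : N → G} {n : N}
    (hσ : MDifferentiableAt 𝓘(ℝ, EN) 𝓘(ℝ, EP) σ n)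
    (hh : MDifferentiableAt 𝓘(ℝ, EN) 𝓘(ℝ, EG) h n) :
    mder EN EP (fun z => B.act (σ z) (h z)) n =
      (B.dright (h n) (σ n)).comp (mder EN EP σ n) +
      (B.fundamental (B.act (σ n) (h n))).comp ((maurerCartan EG (h n)).comp
        (mder EN EG h n)) := by
  have hact : MDifferentiableAt (𝓘(ℝ, EP).prod 𝓘(ℝ, EG)) 𝓘(ℝ, EP)
      (fun z : P × G => B.act z.1 z.2) (σ n, h n) :=
    (B.contMDiff_act (σ n, h n)).mdifferentiableAt (by simp)
  ext X
  have h1 := mfderiv_comp_apply n (g := fun z : P × G => B.act z.1 z.2)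
    (f := fun z => (σ z, h z)) hact (hσ.prodMk hh) X
  have h2 : mfderiv 𝓘(ℝ, EN) 𝓘(ℝ, EP)
      ((fun z : P × G => B.act z.1 z.2) ∘ fun z => (σ z, h z)) n X =
      B.dright (h n) (σ n) (mder EN EP σ n X) +
        mder EG EP (B.act (σ n)) (h n) (mder EN EG h n X) := by
    refine h1.trans ?_
    rw [mfderiv_prodMk hσ hh]
    exact mfderiv_prod_eq_add_apply hact
  rw [B.mder_act_right] at h2
  exact h2

/-- `T r_g` maps the fundamental field of `A` to the one of `Ad(g⁻¹) A`. -/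
theorem dright_fundamental (g : G) (u : P) (A : EG) :
    B.dright g u (B.fundamental u A) = B.fundamental (B.act u g) (Ad g⁻¹ A) := by
  have h1 := mder_comp (g := fun u' => B.act u' g) (f := B.act u) (x := (1 : G))
    (B.mdifferentiableAt_act_left g _) (B.mdifferentiableAt_act_right u 1)
  have hc : ContMDiff 𝓘(ℝ, EG) 𝓘(ℝ, EG) ∞ (fun x : G => g⁻¹ * x * g⁻¹⁻¹) :=
    (contMDiff_const.mul contMDiff_id).mul contMDiff_const
  have h2 := mder_comp (g := B.act (B.act u g)) (f := fun x : G => g⁻¹ * x * g⁻¹⁻¹) (x := (1 : G))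
    (B.mdifferentiableAt_act_right _ _) ((hc 1).mdifferentiableAt (by simp))
  have h : (fun x => B.act (B.act u x) g) = fun x => B.act (B.act u g) (g⁻¹ * x * g⁻¹⁻¹) := by
    funext x
    simp [← B.act_mul, mul_assoc]
  have h3 : g⁻¹ * 1 * g⁻¹⁻¹ = 1 := by simp
  rw [h, h2, h3, B.act_one] at h1
  exact (congrArg (fun L => L A) h1).symm

/-! ### Local sections -/

/-- Through every point of `P` there is a smooth local section, written in a chart of the base,
and near this point every element of `P` is a smooth multiple of the value of the section. -/
theorem exists_localSection [IsManifold 𝓘(ℝ, EM) ∞ M] (u : P) {x₀ : M}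
    (hu : B.proj u ∈ (chartAt EM x₀).source) :
    ∃ (s : EM → P) (h : P → G), SmoothNear EP s (chartAt EM x₀ (B.proj u)) ∧
      s (chartAt EM x₀ (B.proj u)) = u ∧
      (∀ᶠ y in nhds (chartAt EM x₀ (B.proj u)), B.proj (s y) = (chartAt EM x₀).symm y) ∧
      MDifferentiableAt 𝓘(ℝ, EP) 𝓘(ℝ, EG) h u ∧ h u = 1 ∧
      ∀ᶠ u' in nhds u, B.act (s (chartAt EM x₀ (B.proj u'))) (h u') = u' := by
  obtain ⟨e, he, hes, het, hee⟩ := B.locally_trivial (B.proj u)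
  have hus : u ∈ e.source := e.mem_source.2 he
  have hy : chartAt EM x₀ (B.proj u) ∈ (chartAt EM x₀).target := (chartAt EM x₀).map_source hu
  have hbase : ∀ᶠ y in nhds (chartAt EM x₀ (B.proj u)), (chartAt EM x₀).symm y ∈ e.baseSet := by
    refine ((chartAt EM x₀).continuousAt_symm hy).eventually_mem (e.open_baseSet.mem_nhds ?_)
    rwa [(chartAt EM x₀).left_inv hu]
  refine ⟨fun y => e.toOpenPartialHomeomorph.symm ((chartAt EM x₀).symm y, (e u).2),
    fun u' => (e u).2⁻¹ * (e u').2, ?_, ?_, ?_, ?_, by simp, ?_⟩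
  · filter_upwards [hbase, (chartAt EM x₀).open_target.mem_nhds hy] with y hyb hyt
    have h1 : ContMDiffAt 𝓘(ℝ, EM) 𝓘(ℝ, EM) ∞ (chartAt EM x₀).symm y :=
      (contMDiffOn_chart_symm (I := 𝓘(ℝ, EM)) (x := x₀)).contMDiffAt
        ((chartAt EM x₀).open_target.mem_nhds hyt)
    have h2 : ContMDiffAt 𝓘(ℝ, EM) (𝓘(ℝ, EM).prod 𝓘(ℝ, EG)) ∞
        (fun y => ((chartAt EM x₀).symm y, (e u).2)) y := h1.prodMk contMDiffAt_const
    exact (het.contMDiffAt (e.open_target.mem_nhds (e.mem_target.2 hyb))).comp y h2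
  · simp only [(chartAt EM x₀).left_inv hu]
    have : (B.proj u, (e u).2) = e u := Prod.ext (e.coe_fst hus).symm rfl
    rw [this]
    exact e.toOpenPartialHomeomorph.left_inv hus
  · filter_upwards [hbase] with y hyb
    exact e.proj_symm_apply (e.mem_target.2 hyb)
  · have h1 : ContMDiffAt 𝓘(ℝ, EP) (𝓘(ℝ, EM).prod 𝓘(ℝ, EG)) ∞ e u :=
      hes.contMDiffAt (e.open_source.mem_nhds hus)
    have h2 : ContMDiffAt 𝓘(ℝ, EP) 𝓘(ℝ, EG) ∞ (fun u' => (e u).2⁻¹ * (e u').2) u :=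
      contMDiffAt_const.mul h1.snd
    exact h2.mdifferentiableAt (by simp)
  · have h1 : ∀ᶠ u' in nhds u, B.proj u' ∈ (chartAt EM x₀).source :=
      (B.contMDiff_proj u).continuousAt.eventually_mem ((chartAt EM x₀).open_source.mem_nhds hu)
    filter_upwards [h1, e.open_source.mem_nhds hus] with u' h1 hu's
    have hb : B.proj u' ∈ e.baseSet := e.mem_source.1 hu's
    rw [(chartAt EM x₀).left_inv h1]
    have hs : e.toOpenPartialHomeomorph.symm (B.proj u', (e u).2) ∈ e.source :=
      e.toOpenPartialHomeomorph.map_target (e.mem_target.2 hb)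
    have hr : e (e.toOpenPartialHomeomorph.symm (B.proj u', (e u).2)) = (B.proj u', (e u).2) :=
      e.toOpenPartialHomeomorph.right_inv (e.mem_target.2 hb)
    refine e.injOn (e.mem_source.2 ?_) hu's ?_
    · rw [B.proj_act]
      exact e.mem_source.1 hs
    · change e (B.act _ _) = e u'
      rw [hee _ hs, hr]
      refine Prod.ext (e.coe_fst hu's).symm ?_
      simp

theorem surjective_dproj [IsManifold 𝓘(ℝ, EM) ∞ M] (u : P) : Function.Surjective (B.dproj u) := by
  obtain ⟨s, -, hs, hsu, hp, -⟩ := B.exists_localSection u (mem_chart_source EM (B.proj u))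
  intro v
  have h1 := B.dproj_comp_tderiv hs hp
  have h2 := chartSymmDeriv_comp_chartDeriv (B.proj u) (mem_chart_source EM (B.proj u))
  rw [← h1, hsu] at h2
  exact ⟨_, congrArg (fun L => L v) h2⟩

/-- Vertical vectors are values of fundamental vector fields. -/
theorem exists_fundamental_eq [IsManifold 𝓘(ℝ, EM) ∞ M] {u : P} {X : EP} (hX : B.dproj u X = 0) :
    ∃ A, B.fundamental u A = X := by
  obtain ⟨s, h, hs, hsu, hp, hh, hu1, hact⟩ :=
    B.exists_localSection u (mem_chart_source EM (B.proj u))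
  have hσ : MDifferentiableAt 𝓘(ℝ, EP) 𝓘(ℝ, EM)
      (fun u' => chartAt EM (B.proj u) (B.proj u')) u :=
    ((contMDiffAt_chartAt (mem_chart_source EM (B.proj u))).mdifferentiableAt (by simp)).comp u
      (B.mdifferentiableAt_proj u)
  have h1 := mder_comp (E := EP) (E' := EM) (E'' := EM) (g := chartAt EM (B.proj u))
    (f := B.proj) (x := u)
    ((contMDiffAt_chartAt (mem_chart_source EM (B.proj u))).mdifferentiableAt (by simp))
    (B.mdifferentiableAt_proj u)
  have h2 := mder_comp (E := EP) (E' := EM) (E'' := EP) (g := s)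
    (f := fun u' => chartAt EM (B.proj u) (B.proj u')) (x := u) hs.mdifferentiableAt hσ
  have h3 := B.mder_act_comp (σ := fun u' => s (chartAt EM (B.proj u) (B.proj u')))
    (MDifferentiableAt.comp (I' := 𝓘(ℝ, EM)) u hs.mdifferentiableAt hσ) hh
  rw [mder_congr hact, h2, h1, hsu, hu1, B.act_one] at h3
  have h4 := congrArg (fun L => L X) h3
  have h5 : mder EP EM B.proj u X = 0 := hX
  simp only [add_apply, ContinuousLinearMap.comp_apply, h5, map_zero, zero_add] at h4
  exact ⟨_, h4.symm.trans (congrArg (fun L => L X) (mder_id (E := EP) u))⟩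

end PrincipalBundle

end Action

/-! ### One-forms and their quadratic expressions -/

section OneForms

variable {E F X : Type*} [NormedAddCommGroup E] [NormedSpace ℝ E]
  [NormedAddCommGroup F] [NormedSpace ℝ F] [NormedAddCommGroup X] [NormedSpace ℝ X]

/-- An alternating map of one variable, as a linear map. -/
def oneLin (E F : Type*) [NormedAddCommGroup E] [NormedSpace ℝ E] [NormedAddCommGroup F]
    [NormedSpace ℝ F] : (E [⋀^Fin 1]→L[ℝ] F) →L[ℝ] E →L[ℝ] F :=
  ((ContinuousAlternatingMap.ofSubsingletonLIE (𝕜 := ℝ) (E := E) (F := F)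
    (0 : Fin 1)).symm.toContinuousLinearEquiv : (E [⋀^Fin 1]→L[ℝ] F) →L[ℝ] E →L[ℝ] F)

theorem oneLin_apply (a : E [⋀^Fin 1]→L[ℝ] F) (v : E) : oneLin E F a v = a ![v] := by
  have h : ![v] = fun _ : Fin 1 => v := by funext i; fin_cases i; rfl
  rw [h]
  rfl

theorem oneForm_ext {a b : E [⋀^Fin 1]→L[ℝ] F} (h : ∀ v, a ![v] = b ![v]) : a = b := by
  ext X
  have hX : X = ![X 0] := by funext i; fin_cases i; rfl
  rw [hX]
  exact h _

theorem twoForm_ext {a b : E [⋀^Fin 2]→L[ℝ] F} (h : ∀ v w, a ![v, w] = b ![v, w]) : a = b := by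
  ext X
  have hX : X = ![X 0, X 1] := by funext i; fin_cases i <;> rfl
  rw [hX]
  exact h _ _

theorem compContinuousLinearMap_vec_one (a : E [⋀^Fin 1]→L[ℝ] F) (L : X →L[ℝ] E) (v : X) :
    a.compContinuousLinearMap L ![v] = a ![L v] := by
  rw [ContinuousAlternatingMap.compContinuousLinearMap_apply]
  congr 1
  funext i
  fin_cases i
  rfl

theorem compContinuousLinearMap_vec_two (a : E [⋀^Fin 2]→L[ℝ] F) (L : X →L[ℝ] E) (v w : X) :
    a.compContinuousLinearMap L ![v, w] = a ![L v, L w] := by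
  rw [ContinuousAlternatingMap.compContinuousLinearMap_apply]
  congr 1
  funext i
  fin_cases i <;> rfl

theorem extDeriv_vec_two {A : E → E [⋀^Fin 1]→L[ℝ] F} {x : E} (h : DifferentiableAt ℝ A x)
    (v w : E) : extDeriv A x ![v, w] =
      fderiv ℝ (fun y => A y ![w]) x v - fderiv ℝ (fun y => A y ![v]) x w := by
  have h0 : (0 : Fin 2).removeNth ![v, w] = ![w] := by funext i; fin_cases i; rfl
  have h1 : (1 : Fin 2).removeNth ![v, w] = ![v] := by funext i; fin_cases i; rfl
  rw [extDeriv_apply h, Fin.sum_univ_two, h0, h1]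
  simp [sub_eq_add_neg]

/-- The alternating map `(v, w) ↦ b(v, w) - b(w, v)` of a bilinear map `b`. -/
def skewBilin (E F : Type*) [NormedAddCommGroup E] [NormedSpace ℝ E] [NormedAddCommGroup F]
    [NormedSpace ℝ F] : (E →L[ℝ] E →L[ℝ] F) →L[ℝ] E [⋀^Fin 2]→L[ℝ] F :=
  (ContinuousAlternatingMap.alternatizeUncurryFinCLM ℝ E F).comp
    (((ContinuousAlternatingMap.ofSubsingletonLIE (𝕜 := ℝ) (E := E) (F := F)
      (0 : Fin 1)).toContinuousLinearEquiv : (E →L[ℝ] F) →L[ℝ] E [⋀^Fin 1]→L[ℝ] F).postcomp E)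

theorem skewBilin_apply (b : E →L[ℝ] E →L[ℝ] F) (v w : E) :
    skewBilin E F b ![v, w] = b v w - b w v := by
  have h0 : (0 : Fin 2).removeNth ![v, w] = ![w] := by funext i; fin_cases i; rfl
  have h1 : (1 : Fin 2).removeNth ![v, w] = ![v] := by funext i; fin_cases i; rfl
  change ContinuousAlternatingMap.alternatizeUncurryFin _ _ = _
  rw [ContinuousAlternatingMap.alternatizeUncurryFin_apply, Fin.sum_univ_two, h0, h1]
  simp only [Fin.val_zero, Fin.val_one, pow_zero, pow_one, one_smul, neg_smul]
  rw [sub_eq_add_neg]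
  rfl

/-- The two-form `(v, w) ↦ q(a(v), a(w)) - q(a(w), a(v))` of a one-form `a`. -/
def quadForm (q : F →L[ℝ] F →L[ℝ] F) (a : E [⋀^Fin 1]→L[ℝ] F) : E [⋀^Fin 2]→L[ℝ] F :=
  skewBilin E F (((ContinuousLinearMap.compL ℝ E F F).flip (oneLin E F a)).comp
    (q.comp (oneLin E F a)))

theorem quadForm_apply (q : F →L[ℝ] F →L[ℝ] F) (a : E [⋀^Fin 1]→L[ℝ] F) (v w : E) :
    quadForm q a ![v, w] = q (a ![v]) (a ![w]) - q (a ![w]) (a ![v]) := by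
  rw [quadForm, skewBilin_apply]
  simp only [ContinuousLinearMap.flip_apply, ContinuousLinearMap.comp_apply,
    ContinuousLinearMap.compL_apply, oneLin_apply]

theorem contDiff_quadForm {r : WithTop ℕ∞} (q : F →L[ℝ] F →L[ℝ] F) :
    ContDiff ℝ r (quadForm q : E [⋀^Fin 1]→L[ℝ] F → E [⋀^Fin 2]→L[ℝ] F) := by
  have h1 : ContDiff ℝ r (fun a : E [⋀^Fin 1]→L[ℝ] F => oneLin E F a) := (oneLin E F).contDiff
  have h2 : ContDiff ℝ r (fun a : E [⋀^Fin 1]→L[ℝ] F =>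
      (ContinuousLinearMap.compL ℝ E F F).flip (oneLin E F a)) :=
    ContDiff.comp (g := fun b : E →L[ℝ] F => (ContinuousLinearMap.compL ℝ E F F).flip b)
      (ContinuousLinearMap.contDiff _) h1
  exact (skewBilin E F).contDiff.comp (h2.clm_comp (contDiff_const.clm_comp h1))

theorem quadForm_smul (q : F →L[ℝ] F →L[ℝ] F) (t : ℝ) (a : E [⋀^Fin 1]→L[ℝ] F) :
    quadForm q (t • a) = t ^ 2 • quadForm q a := by
  refine twoForm_ext fun v w => ?_
  simp only [quadForm_apply, ContinuousAlternatingMap.smul_apply, map_smul,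
    smul_apply, smul_sub, smul_smul]
  ring_nf

/-- `quadForm` has a double zero at the origin. -/
theorem fderiv_quadForm_zero (q : F →L[ℝ] F →L[ℝ] F) :
    fderiv ℝ (quadForm q : E [⋀^Fin 1]→L[ℝ] F → E [⋀^Fin 2]→L[ℝ] F) 0 = 0 := by
  ext1 a
  have h1 : HasFDerivAt (quadForm q : E [⋀^Fin 1]→L[ℝ] F → E [⋀^Fin 2]→L[ℝ] F)
      (fderiv ℝ (quadForm q) 0) ((0 : ℝ) • a) := by
    rw [zero_smul]
    exact ((contDiff_quadForm (r := 1) q).differentiable (by simp) 0).hasFDerivAt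
  have h2 : HasDerivAt (fun t : ℝ => t • a) a 0 := by
    simpa using (hasDerivAt_id (0 : ℝ)).smul_const a
  have h3 := h1.comp_hasDerivAt (0 : ℝ) h2
  have h4 : HasDerivAt (fun t : ℝ => t ^ 2 • quadForm q a) 0 0 := by
    simpa using ((hasDerivAt_id (0 : ℝ)).pow 2).smul_const (quadForm q a)
  have h5 : (quadForm q ∘ fun t : ℝ => t • a) = fun t => t ^ 2 • quadForm q a :=
    funext fun t => quadForm_smul q t a
  rw [h5] at h3
  exact h3.unique h4

/-- At a zero of the one-form `A`, the quadratic expression in `A` has a double zero, so its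
derivative vanishes. -/
theorem extDeriv_quadForm_eq_zero (q : F →L[ℝ] F →L[ℝ] F) {A : E → E [⋀^Fin 1]→L[ℝ] F} {x : E}
    (hA : DifferentiableAt ℝ A x) (h0 : A x = 0) : extDeriv (fun y => quadForm q (A y)) x = 0 := by
  have h1 : fderiv ℝ (fun y => quadForm q (A y)) x = 0 := by
    have := fderiv_comp x (g := quadForm q) (f := A)
      ((contDiff_quadForm (r := 1) q).differentiable (by simp) _) hA
    rw [h0, fderiv_quadForm_zero, ContinuousLinearMap.zero_comp] at this
    exact this
  rw [extDeriv, h1]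
  exact map_zero (ContinuousAlternatingMap.alternatizeUncurryFinCLM ℝ E F)

end OneForms

/-! ### The structure equation -/

section GroupCharts

variable (EG : Type*) [NormedAddCommGroup EG]
  (G : Type*) [TopologicalSpace G] [ChartedSpace EG G] [Group G]

/-- The inverse of the chart of `G` around `1`. -/
def oneChartSymm (z : EG) : G := (chartAt EG (1 : G)).symm z

/-- The image of `1` under the chart of `G` around `1`. -/
def oneCoord : EG := chartAt EG (1 : G) 1

theorem oneChartSymm_oneCoord : oneChartSymm EG G (oneCoord EG G) = 1 :=
  (chartAt EG (1 : G)).left_inv (mem_chart_source EG 1)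

theorem oneCoord_mem_target : oneCoord EG G ∈ (chartAt EG (1 : G)).target :=
  mem_chart_target EG (1 : G)

variable [NormedSpace ℝ EG]

/-- The map `g ↦ Ad(g⁻¹)` in the chart around `1`. -/
def adInChart (z : EG) : EG →L[ℝ] EG := Ad (oneChartSymm EG G z)⁻¹

/-- The Maurer-Cartan form in the chart around `1`. -/
def mcInChart (z : EG) : EG →L[ℝ] EG :=
  (maurerCartan EG (oneChartSymm EG G z)).comp (chartSymmDeriv (1 : G) z)

theorem adInChart_oneCoord : adInChart EG G (oneCoord EG G) = ContinuousLinearMap.id ℝ EG := by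
  have h : (fun x : G => (1 : G) * x * (1 : G)⁻¹) = fun x => x := by funext x; simp
  rw [adInChart, oneChartSymm_oneCoord, inv_one, Ad, h]
  exact mder_id (E := EG) (1 : G)

/-- The bilinear map `q` with `q(a, b) - q(b, a) = [a, b]` that appears in the structure equation
`Ω = dω + [ω, ω]/2`; it is read off from the first derivatives of the Maurer-Cartan form and of
the adjoint representation in the chart around `1`. -/
def structureBilin : EG →L[ℝ] EG →L[ℝ] EG :=
  (fderiv ℝ (mcInChart EG G) (oneCoord EG G)).bilinearComp (chartDeriv (1 : G) (1 : G))
      (chartDeriv (1 : G) (1 : G)) -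
    (fderiv ℝ (adInChart EG G) (oneCoord EG G)).comp (chartDeriv (1 : G) (1 : G))

theorem structureBilin_apply (a b : EG) : structureBilin EG G a b =
    fderiv ℝ (mcInChart EG G) (oneCoord EG G) (chartDeriv (1 : G) (1 : G) a)
      (chartDeriv (1 : G) (1 : G) b) -
    fderiv ℝ (adInChart EG G) (oneCoord EG G) (chartDeriv (1 : G) (1 : G) a) b := rfl

variable [LieGroup 𝓘(ℝ, EG) ∞ G]

theorem chartSymmDeriv_oneCoord_comp :
    (chartSymmDeriv (1 : G) (oneCoord EG G)).comp (chartDeriv (1 : G) (1 : G)) =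
      ContinuousLinearMap.id ℝ EG := by
  have : IsManifold 𝓘(ℝ, EG) ∞ G := ContMDiffMul.toIsManifold (I := 𝓘(ℝ, EG)) (n := ∞)
  exact chartSymmDeriv_comp_chartDeriv (1 : G) (mem_chart_source EG (1 : G))

theorem contMDiffAt_oneChartSymm {z : EG} (hz : z ∈ (chartAt EG (1 : G)).target) :
    ContMDiffAt 𝓘(ℝ, EG) 𝓘(ℝ, EG) ∞ (oneChartSymm EG G) z :=
  (contMDiffOn_chart_symm (I := 𝓘(ℝ, EG)) (x := (1 : G))).contMDiffAt
    ((chartAt EG (1 : G)).open_target.mem_nhds hz)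

theorem smoothNear_oneChartSymm : SmoothNear EG (oneChartSymm EG G) (oneCoord EG G) := by
  filter_upwards [(chartAt EG (1 : G)).open_target.mem_nhds (oneCoord_mem_target EG G)] with z hz
  exact contMDiffAt_oneChartSymm EG G hz

/-- A family of maps of `G` to itself that depends smoothly on a parameter and fixes `1` at one
parameter value has, in the chart around `1`, a smooth derivative. -/
theorem differentiableAt_fderiv_chart {ψ : EG → EG → G} {z₀ : EG}
    (hψ : ContMDiffAt 𝓘(ℝ, EG × EG) 𝓘(ℝ, EG) ∞ (fun p : EG × EG => ψ p.1 p.2) (z₀, z₀))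
    (h1 : ψ z₀ z₀ = 1) {w : EG → EG} (hw : ContDiffAt ℝ ∞ w z₀) (hw0 : w z₀ = z₀) :
    DifferentiableAt ℝ (fun z => fderiv ℝ (fun v => chartAt EG (1 : G) (ψ z v)) (w z)) z₀ := by
  have : IsManifold 𝓘(ℝ, EG) ∞ G := ContMDiffMul.toIsManifold (I := 𝓘(ℝ, EG)) (n := ∞)
  have h2 : ContMDiffAt 𝓘(ℝ, EG × EG) 𝓘(ℝ, EG) ∞
      (fun p : EG × EG => chartAt EG (1 : G) (ψ p.1 p.2)) (z₀, z₀) := by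
    refine ContMDiffAt.comp (I' := 𝓘(ℝ, EG)) (g := chartAt EG (1 : G)) (z₀, z₀) ?_ hψ
    refine contMDiffAt_chartAt ?_
    simp only [h1]
    exact mem_chart_source EG (1 : G)
  have h3 : ContDiffAt ℝ ∞ (Function.uncurry fun z v => chartAt EG (1 : G) (ψ z v)) (z₀, w z₀) := by
    rw [hw0]
    exact h2.contDiffAt
  exact (ContDiffAt.fderiv (m := ∞) h3 hw (by simp)).differentiableAt (by simp)

theorem contMDiffAt_fst_snd {z₀ w₀ : EG} :
    ContMDiffAt 𝓘(ℝ, EG × EG) 𝓘(ℝ, EG) ∞ (fun p : EG × EG => p.1) (z₀, w₀) ∧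
    ContMDiffAt 𝓘(ℝ, EG × EG) 𝓘(ℝ, EG) ∞ (fun p : EG × EG => p.2) (z₀, w₀) :=
  ⟨contDiffAt_fst.contMDiffAt, contDiffAt_snd.contMDiffAt⟩

theorem differentiableAt_adInChart :
    DifferentiableAt ℝ (adInChart EG G) (oneCoord EG G) := by
  have : IsManifold 𝓘(ℝ, EG) ∞ G := ContMDiffMul.toIsManifold (I := 𝓘(ℝ, EG)) (n := ∞)
  set c := oneCoord EG G with hc
  have hs := contMDiffAt_oneChartSymm EG G (oneCoord_mem_target EG G)
  have h1 : ContMDiffAt 𝓘(ℝ, EG × EG) 𝓘(ℝ, EG) ∞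
      (fun p : EG × EG => oneChartSymm EG G p.1) (c, c) :=
    ContMDiffAt.comp (I' := 𝓘(ℝ, EG)) (g := oneChartSymm EG G) (c, c) hs
      (contMDiffAt_fst_snd EG).1
  have h2 : ContMDiffAt 𝓘(ℝ, EG × EG) 𝓘(ℝ, EG) ∞
      (fun p : EG × EG => oneChartSymm EG G p.2) (c, c) :=
    ContMDiffAt.comp (I' := 𝓘(ℝ, EG)) (g := oneChartSymm EG G) (c, c) hs
      (contMDiffAt_fst_snd EG).2
  have hd := differentiableAt_fderiv_chart EG G
    (ψ := fun z v => (oneChartSymm EG G z)⁻¹ * oneChartSymm EG G v * (oneChartSymm EG G z)⁻¹⁻¹)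
    (z₀ := c) ((h1.inv.mul h2).mul h1.inv.inv)
    (by simp [hc, oneChartSymm_oneCoord]) contDiffAt_const (w := fun _ => c) rfl
  have hK := chartSymmDeriv_oneCoord_comp EG G
  have heq : adInChart EG G = fun z => ((chartSymmDeriv (1 : G) c).comp
      (fderiv ℝ (fun v => chartAt EG (1 : G) ((oneChartSymm EG G z)⁻¹ * oneChartSymm EG G v *
        (oneChartSymm EG G z)⁻¹⁻¹)) c)).comp (chartDeriv (1 : G) (1 : G)) := by
    funext z
    set g := oneChartSymm EG G z
    have hconj : ContMDiff 𝓘(ℝ, EG) 𝓘(ℝ, EG) ∞ (fun x : G => g⁻¹ * x * g⁻¹⁻¹) :=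
      (contMDiff_const.mul contMDiff_id).mul contMDiff_const
    have hs' : MDifferentiableAt 𝓘(ℝ, EG) 𝓘(ℝ, EG) (oneChartSymm EG G) c :=
      hs.mdifferentiableAt (by simp)
    have e1 := mder_comp (g := fun x : G => g⁻¹ * x * g⁻¹⁻¹) (f := oneChartSymm EG G) (x := c)
      ((hconj _).mdifferentiableAt (by simp)) hs'
    have e2 := mder_comp (E := EG) (E' := EG) (E'' := EG) (g := chartAt EG (1 : G))
      (f := fun v => g⁻¹ * oneChartSymm EG G v * g⁻¹⁻¹) (x := c)
      ((contMDiffAt_chartAt (by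
        rw [hc, oneChartSymm_oneCoord]
        simp)).mdifferentiableAt (by simp))
      (((hconj _).mdifferentiableAt (by simp)).comp c hs')
    rw [e1, hc, oneChartSymm_oneCoord, mul_one, mul_inv_cancel] at e2
    have e3 : fderiv ℝ (fun v => chartAt EG (1 : G) (g⁻¹ * oneChartSymm EG G v * g⁻¹⁻¹)) c =
        (chartDeriv (1 : G) (1 : G)).comp ((Ad g⁻¹).comp (chartSymmDeriv (1 : G) c)) := by
      rw [← mfderiv_eq_fderiv]
      exact e2
    rw [e3]
    ext A
    have hK' : ∀ v, chartSymmDeriv (1 : G) c (chartDeriv (1 : G) (1 : G) v) = v := fun v =>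
      congrArg (fun L => L v) hK
    simp only [ContinuousLinearMap.comp_apply, hK']
    rfl
  rw [heq]
  exact ((differentiableAt_const _).clm_comp hd).clm_comp (differentiableAt_const _)

theorem differentiableAt_mcInChart :
    DifferentiableAt ℝ (mcInChart EG G) (oneCoord EG G) := by
  have : IsManifold 𝓘(ℝ, EG) ∞ G := ContMDiffMul.toIsManifold (I := 𝓘(ℝ, EG)) (n := ∞)
  set c := oneCoord EG G with hc
  have hs := contMDiffAt_oneChartSymm EG G (oneCoord_mem_target EG G)
  have h1 : ContMDiffAt 𝓘(ℝ, EG × EG) 𝓘(ℝ, EG) ∞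
      (fun p : EG × EG => oneChartSymm EG G p.1) (c, c) :=
    ContMDiffAt.comp (I' := 𝓘(ℝ, EG)) (g := oneChartSymm EG G) (c, c) hs
      (contMDiffAt_fst_snd EG).1
  have h2 : ContMDiffAt 𝓘(ℝ, EG × EG) 𝓘(ℝ, EG) ∞
      (fun p : EG × EG => oneChartSymm EG G p.2) (c, c) :=
    ContMDiffAt.comp (I' := 𝓘(ℝ, EG)) (g := oneChartSymm EG G) (c, c) hs
      (contMDiffAt_fst_snd EG).2
  have hd := differentiableAt_fderiv_chart EG G
    (ψ := fun z v => (oneChartSymm EG G z)⁻¹ * oneChartSymm EG G v)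
    (z₀ := c) (h1.inv.mul h2)
    (by simp [hc, oneChartSymm_oneCoord]) contDiffAt_id rfl
  have hK := chartSymmDeriv_oneCoord_comp EG G
  have heq : mcInChart EG G =ᶠ[nhds c] fun z => (chartSymmDeriv (1 : G) c).comp
      (fderiv ℝ (fun v => chartAt EG (1 : G) ((oneChartSymm EG G z)⁻¹ * oneChartSymm EG G v))
        (id z)) := by
    filter_upwards [(chartAt EG (1 : G)).open_target.mem_nhds (oneCoord_mem_target EG G)]
      with z hz
    set g := oneChartSymm EG G z with hg
    have hmul : ContMDiff 𝓘(ℝ, EG) 𝓘(ℝ, EG) ∞ (fun x : G => g⁻¹ * x) :=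
      contMDiff_const.mul contMDiff_id
    have hs' : MDifferentiableAt 𝓘(ℝ, EG) 𝓘(ℝ, EG) (oneChartSymm EG G) z :=
      (contMDiffAt_oneChartSymm EG G hz).mdifferentiableAt (by simp)
    have e1 := mder_comp (g := fun x : G => g⁻¹ * x) (f := oneChartSymm EG G) (x := z)
      ((hmul _).mdifferentiableAt (by simp)) hs'
    have e2 := mder_comp (E := EG) (E' := EG) (E'' := EG) (g := chartAt EG (1 : G))
      (f := fun v => g⁻¹ * oneChartSymm EG G v) (x := z)
      ((contMDiffAt_chartAt (by
        rw [← hg, inv_mul_cancel]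
        exact mem_chart_source EG (1 : G))).mdifferentiableAt (by simp))
      (((hmul _).mdifferentiableAt (by simp)).comp z hs')
    rw [e1, ← hg, inv_mul_cancel] at e2
    have e3 : fderiv ℝ (fun v => chartAt EG (1 : G) (g⁻¹ * oneChartSymm EG G v)) (id z) =
        (chartDeriv (1 : G) (1 : G)).comp (mcInChart EG G z) := by
      rw [← mfderiv_eq_fderiv]
      exact e2
    rw [e3]
    ext A
    exact (congrArg (fun L => L (mcInChart EG G z A)) hK).symm
  exact ((differentiableAt_const _).clm_comp hd).congr_of_eventuallyEq heq

end GroupCharts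

section Connections

variable {EM EP EG X : Type*}
  [NormedAddCommGroup EM] [NormedSpace ℝ EM] [NormedAddCommGroup EP] [NormedSpace ℝ EP]
  [NormedAddCommGroup EG] [NormedSpace ℝ EG] [NormedAddCommGroup X] [NormedSpace ℝ X]
  {M P G : Type*}
  [TopologicalSpace M] [ChartedSpace EM M]
  [TopologicalSpace P] [ChartedSpace EP P]
  [TopologicalSpace G] [ChartedSpace EG G] [Group G]
  {B : PrincipalBundle EM EP EG M P G} (γ : PrincipalConnection B)

theorem DiffForm.pullback_vec_one {E F N : Type*} [NormedAddCommGroup E] [NormedSpace ℝ E]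
    [NormedAddCommGroup F] [NormedSpace ℝ F] [TopologicalSpace N] [ChartedSpace E N]
    (α : DiffForm E N F 1) (s : X → N) (x v : X) :
    α.pullback s x ![v] = α (s x) ![tderiv E s x v] := compContinuousLinearMap_vec_one _ _ _

theorem DiffForm.pullback_vec_two {E F N : Type*} [NormedAddCommGroup E] [NormedSpace ℝ E]
    [NormedAddCommGroup F] [NormedSpace ℝ F] [TopologicalSpace N] [ChartedSpace E N]
    (α : DiffForm E N F 2) (s : X → N) (x v w : X) :
    α.pullback s x ![v, w] = α (s x) ![tderiv E s x v, tderiv E s x w] :=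
  compContinuousLinearMap_vec_two _ _ _ _

namespace PrincipalConnection

theorem horizontal_apply (u : P) (Y : EP) :
    γ.horizontal u Y = Y - B.fundamental u (γ.form u ![Y]) := by
  rw [← oneLin_apply]
  rfl

theorem horizontal_fundamental (u : P) (A : EG) : γ.horizontal u (B.fundamental u A) = 0 := by
  rw [horizontal_apply, γ.form_fundamental, sub_self]

theorem covDeriv_vec_two {F : Type*} [NormedAddCommGroup F] [NormedSpace ℝ F]
    (Ψ : DiffForm EP P F 1) (u : P) (Y Z : EP) :
    γ.covDeriv Ψ u ![Y, Z] = Ψ.d u ![γ.horizontal u Y, γ.horizontal u Z] :=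
  compContinuousLinearMap_vec_two _ _ _ _

theorem form_add (u : P) (Y Z : EP) : γ.form u ![Y + Z] = γ.form u ![Y] + γ.form u ![Z] := by
  simp only [← oneLin_apply, map_add]

variable [LieGroup 𝓘(ℝ, EG) ∞ G]

/-- The behaviour of the connection form under a change of gauge. -/
theorem form_tderiv_act {s : X → P} {h : X → G} {x : X} (hs : SmoothNear EP s x)
    (hh : SmoothNear EG h x) (v : X) :
    γ.form.pullback (fun y => B.act (s y) (h y)) x ![v] =
      Ad (h x)⁻¹ (γ.form.pullback s x ![v]) + maurerCartan EG (h x) (tderiv EG h x v) := by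
  have h1 : tderiv EP (fun y => B.act (s y) (h y)) x v = _ :=
    congrArg (fun L => L v) (B.mder_act_comp hs.mdifferentiableAt hh.mdifferentiableAt)
  rw [DiffForm.pullback_vec_one, h1]
  simp only [add_apply, ContinuousLinearMap.comp_apply]
  rw [form_add, γ.form_fundamental, γ.equivariant, DiffForm.pullback_vec_one]
  rfl

end PrincipalConnection

end Connections

section Structure

variable {EM EP EG X : Type*}
  [NormedAddCommGroup EM] [NormedSpace ℝ EM] [NormedAddCommGroup EP] [NormedSpace ℝ EP]
  [NormedAddCommGroup EG] [NormedSpace ℝ EG] [NormedAddCommGroup X] [NormedSpace ℝ X]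
  {M P G : Type*}
  [TopologicalSpace M] [ChartedSpace EM M]
  [TopologicalSpace P] [ChartedSpace EP P]
  [TopologicalSpace G] [ChartedSpace EG G] [Group G]
  {B : PrincipalBundle EM EP EG M P G} (γ : PrincipalConnection B)

theorem SmoothNear.comp_clm {E N Y : Type*} [NormedAddCommGroup E] [NormedSpace ℝ E]
    [TopologicalSpace N] [ChartedSpace E N] [NormedAddCommGroup Y] [NormedSpace ℝ Y]
    {s : X → N} (L : Y →L[ℝ] X) {y : Y} (hs : SmoothNear E s (L y)) :
    SmoothNear E (fun z => s (L z)) y := by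
  filter_upwards [L.continuous.continuousAt.eventually hs] with z hz
  exact ContMDiffAt.comp (I' := 𝓘(ℝ, X)) (g := s) z hz L.contDiff.contDiffAt.contMDiffAt

theorem tderiv_comp_clm {E N Y : Type*} [NormedAddCommGroup E] [NormedSpace ℝ E]
    [TopologicalSpace N] [ChartedSpace E N] [NormedAddCommGroup Y] [NormedSpace ℝ Y]
    {s : X → N} (L : Y →L[ℝ] X) {y : Y} (hs : SmoothNear E s (L y)) :
    tderiv E (fun z => s (L z)) y = (tderiv E s (L y)).comp L := by
  have h := mder_comp (E := Y) (E' := X) (E'' := E) (g := s) (f := L) (x := y) hs.mdifferentiableAt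
    (L.contDiff.contDiffAt.contMDiffAt (n := ∞) |>.mdifferentiableAt (by simp))
  have h2 : mder Y X L y = L := by
    rw [mder, mfderiv_eq_fderiv]
    exact L.fderiv
  rw [h2] at h
  exact h

theorem SmoothNear.act {s : X → P} {h : X → G} {x : X} (hs : SmoothNear EP s x)
    (hh : SmoothNear EG h x) : SmoothNear EP (fun y => B.act (s y) (h y)) x := by
  filter_upwards [hs, hh] with y hy hy'
  exact (B.contMDiff_act.contMDiffAt (x := (s y, h y))).comp y (hy.prodMk hy')

namespace PrincipalConnection

theorem differentiableAt_pullback_form {s : X → P} {y : X} [IsManifold 𝓘(ℝ, EP) ∞ P]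
    (hs : SmoothNear EP s y) :
    DifferentiableAt ℝ (γ.form.pullback s) y :=
  (γ.smooth.contDiffAt_pullback hs).differentiableAt (by simp)

variable [LieGroup 𝓘(ℝ, EG) ∞ G]

/-- The structure equation `Ω = dω + [ω, ω]/2` of Cartan, pulled back along a smooth map. The
curvature is `dω` evaluated at horizontal vectors; these are tangent to the map
`(y, z) ↦ s(y) z`, for which the pullback of `ω` is known explicitly. -/
theorem curvature_pullback [IsManifold 𝓘(ℝ, EP) ∞ P] {s : X → P} {y : X}
    (hs : SmoothNear EP s y) :
    γ.curvature.pullback s y = extDeriv (γ.form.pullback s) y +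
      quadForm (structureBilin EG G) (γ.form.pullback s y) := by
  set c := oneCoord EG G
  set A := γ.form.pullback s with hAdef
  have hA : DifferentiableAt ℝ A y := γ.differentiableAt_pullback_form hs
  have hgc : oneChartSymm EG G c = 1 := oneChartSymm_oneCoord EG G
  set Φ : X × EG → P := fun p => B.act (s p.1) (oneChartSymm EG G p.2) with hΦdef
  have hs1 : SmoothNear EP (fun p : X × EG => s p.1) (y, c) :=
    SmoothNear.comp_clm (ContinuousLinearMap.fst ℝ X EG) hs
  have hs2 : SmoothNear EG (fun p : X × EG => oneChartSymm EG G p.2) (y, c) :=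
    SmoothNear.comp_clm (ContinuousLinearMap.snd ℝ X EG) (smoothNear_oneChartSymm EG G)
  have hΦ : SmoothNear EP Φ (y, c) := hs1.act hs2
  have hs1' : ∀ᶠ p : X × EG in nhds (y, c), SmoothNear EP s p.1 :=
    (continuous_fst.tendsto (y, c)).eventually hs.eventually
  have hs2' : ∀ᶠ p : X × EG in nhds (y, c), SmoothNear EG (oneChartSymm EG G) p.2 :=
    (continuous_snd.tendsto (y, c)).eventually (smoothNear_oneChartSymm EG G).eventually
  -- `Φ^*ω = Ad(z⁻¹) s^*ω + z⁻¹ dz`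
  have hform : ∀ v a, (fun p => γ.form.pullback Φ p ![(v, a)]) =ᶠ[nhds (y, c)]
      fun p => adInChart EG G p.2 (A p.1 ![v]) + mcInChart EG G p.2 a := by
    intro v a
    filter_upwards [hs1', hs2'] with p h1 h2
    have k1 : SmoothNear EP (fun p : X × EG => s p.1) p :=
      SmoothNear.comp_clm (ContinuousLinearMap.fst ℝ X EG) h1
    have k2 : SmoothNear EG (fun p : X × EG => oneChartSymm EG G p.2) p :=
      SmoothNear.comp_clm (ContinuousLinearMap.snd ℝ X EG) h2
    have d1 : tderiv EP (fun p : X × EG => s p.1) p = _ :=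
      tderiv_comp_clm (ContinuousLinearMap.fst ℝ X EG) h1
    have d2 : tderiv EG (fun p : X × EG => oneChartSymm EG G p.2) p = _ :=
      tderiv_comp_clm (ContinuousLinearMap.snd ℝ X EG) h2
    rw [hΦdef, γ.form_tderiv_act k1 k2, DiffForm.pullback_vec_one, d1, d2, hAdef,
      DiffForm.pullback_vec_one]
    rfl
  have hder : ∀ v a w b, fderiv ℝ (fun p => γ.form.pullback Φ p ![(w, b)]) (y, c) (v, a) =
      fderiv ℝ (adInChart EG G) c a (A y ![w]) + fderiv ℝ (fun y => A y ![w]) y v +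
        fderiv ℝ (mcInChart EG G) c a b := by
    intro v a w b
    have hAw : DifferentiableAt ℝ (fun y => A y ![w]) y := by
      have := ((oneLin X EG).differentiableAt.comp y hA).clm_apply (differentiableAt_const w)
      simpa only [Function.comp_apply, oneLin_apply] using this
    have hA1 : HasFDerivAt (fun p : X × EG => A p.1 ![w])
        ((fderiv ℝ (fun y => A y ![w]) y).comp (ContinuousLinearMap.fst ℝ X EG)) (y, c) :=
      HasFDerivAt.comp (g := fun y => A y ![w]) (y, c) hAw.hasFDerivAt hasFDerivAt_fst
    have hC1 : HasFDerivAt (fun p : X × EG => adInChart EG G p.2)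
        ((fderiv ℝ (adInChart EG G) c).comp (ContinuousLinearMap.snd ℝ X EG)) (y, c) :=
      HasFDerivAt.comp (g := adInChart EG G) (y, c)
        (differentiableAt_adInChart EG G).hasFDerivAt hasFDerivAt_snd
    have hM1 : HasFDerivAt (fun p : X × EG => mcInChart EG G p.2)
        ((fderiv ℝ (mcInChart EG G) c).comp (ContinuousLinearMap.snd ℝ X EG)) (y, c) :=
      HasFDerivAt.comp (g := mcInChart EG G) (y, c)
        (differentiableAt_mcInChart EG G).hasFDerivAt hasFDerivAt_snd
    have h := (hC1.clm_apply hA1).add (hM1.clm_apply (hasFDerivAt_const b (y, c)))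
    rw [(hform w b).fderiv_eq]
    refine (congrArg (fun L => L (v, a)) h.fderiv).trans ?_
    have e1 : adInChart EG G (y, c).2 = ContinuousLinearMap.id ℝ EG := adInChart_oneCoord EG G
    simp only [e1]
    simp
    abel
  -- the horizontal lift of `v` is the derivative of `Φ` in the direction `(v, -ω(v))`
  have hlift : ∀ v, tderiv EP Φ (y, c) (v, -chartDeriv (1 : G) (1 : G) (A y ![v])) =
      γ.horizontal (s y) (tderiv EP s y v) := by
    intro v
    have d1 : mder (X × EG) EP (fun p : X × EG => s p.1) (y, c) = _ :=
      tderiv_comp_clm (ContinuousLinearMap.fst ℝ X EG) (y := (y, c)) hs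
    have d2 : mder (X × EG) EG (fun p : X × EG => oneChartSymm EG G p.2) (y, c) = _ :=
      tderiv_comp_clm (ContinuousLinearMap.snd ℝ X EG) (y := (y, c))
        (smoothNear_oneChartSymm EG G)
    have h := B.mder_act_comp hs1.mdifferentiableAt hs2.mdifferentiableAt
    rw [d1, d2, hgc, B.act_one, maurerCartan_one, B.dright_one] at h
    refine (congrArg (fun L => L (v, -chartDeriv (1 : G) (1 : G) (A y ![v]))) h).trans ?_
    rw [γ.horizontal_apply, ← DiffForm.pullback_vec_one, ← hAdef]
    have hK : chartSymmDeriv (1 : G) c (chartDeriv (1 : G) (1 : G) (A y ![v])) = A y ![v] :=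
      congrArg (fun L => L (A y ![v])) (chartSymmDeriv_oneCoord_comp EG G)
    have e : tderiv EG (oneChartSymm EG G) c = chartSymmDeriv (1 : G) c := rfl
    simp only [add_apply, ContinuousLinearMap.comp_apply, ContinuousLinearMap.coe_fst',
      ContinuousLinearMap.coe_snd', ContinuousLinearMap.id_apply]
    have e' : tderiv EG (oneChartSymm EG G) c (-chartDeriv (1 : G) (1 : G) (A y ![v])) =
        -A y ![v] := by rw [e, map_neg, hK]
    refine (congrArg (fun z => tderiv EP s y v + B.fundamental (s y) z) e').trans ?_
    rw [map_neg, sub_eq_add_neg]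
  have hΦ0 : Φ (y, c) = s y := by
    simp only [hΦdef, hgc, B.act_one]
  refine twoForm_ext fun v w => ?_
  rw [DiffForm.pullback_vec_two, curvature, covDeriv_vec_two, ← hlift, ← hlift, ← hΦ0,
    ← DiffForm.pullback_vec_two, ← γ.smooth.extDeriv_pullback hΦ,
    extDeriv_vec_two (γ.differentiableAt_pullback_form hΦ), hder, hder,
    ContinuousAlternatingMap.add_apply, quadForm_apply, extDeriv_vec_two hA,
    structureBilin_apply, structureBilin_apply]
  simp only [map_neg, neg_apply, neg_neg]
  abel

end PrincipalConnection

end Structure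

/-! ### Horizontality and equivariance -/

section Basic

variable {EM EP EG V X : Type*}
  [NormedAddCommGroup EM] [NormedSpace ℝ EM] [NormedAddCommGroup EP] [NormedSpace ℝ EP]
  [NormedAddCommGroup EG] [NormedSpace ℝ EG] [NormedAddCommGroup V] [NormedSpace ℝ V]
  [NormedAddCommGroup X] [NormedSpace ℝ X]
  {M P G : Type*}
  [TopologicalSpace M] [ChartedSpace EM M]
  [TopologicalSpace P] [ChartedSpace EP P]
  [TopologicalSpace G] [ChartedSpace EG G] [Group G]
  {B : PrincipalBundle EM EP EG M P G}

theorem smoothNear_chart_symm {E N : Type*} [NormedAddCommGroup E] [NormedSpace ℝ E]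
    [TopologicalSpace N] [ChartedSpace E N] [IsManifold 𝓘(ℝ, E) ∞ N] (u : N) :
    SmoothNear E (chartAt E u).symm (chartAt E u u) := by
  filter_upwards [(chartAt E u).open_target.mem_nhds (mem_chart_target E u)] with z hz
  exact (contMDiffOn_chart_symm (I := 𝓘(ℝ, E)) (x := u)).contMDiffAt
    ((chartAt E u).open_target.mem_nhds hz)

/-- The exterior derivative of an equivariant one-form is equivariant. -/
theorem d_act_of_equivariant [IsManifold 𝓘(ℝ, EP) ∞ P] {F : Type*} [NormedAddCommGroup F]
    [NormedSpace ℝ F] {Ψ : DiffForm EP P F 1} (hΨ : Ψ.IsSmooth) {g : G} {l : F →L[ℝ] F}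
    (h : ∀ u (Y : EP), Ψ (B.act u g) ![B.dright g u Y] = l (Ψ u ![Y])) (u : P) (Y Z : EP) :
    Ψ.d (B.act u g) ![B.dright g u Y, B.dright g u Z] = l (Ψ.d u ![Y, Z]) := by
  set σ : EP → P := ⇑(chartAt EP u).symm
  set x := chartAt EP u u
  have hσ : SmoothNear EP σ x := smoothNear_chart_symm u
  have hσu : σ x = u := (chartAt EP u).left_inv (mem_chart_source EP u)
  have hσg : SmoothNear EP (fun y => B.act (σ y) g) x := by
    filter_upwards [hσ] with y hy
    exact (B.contMDiff_act_left g (σ y)).comp y hy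
  have hd : ∀ y, SmoothNear EP σ y → tderiv EP (fun y => B.act (σ y) g) y =
      (B.dright g (σ y)).comp (tderiv EP σ y) := fun y hy =>
    mder_comp (g := fun u => B.act u g) (f := σ) (B.mdifferentiableAt_act_left g (σ y))
      hy.mdifferentiableAt
  have hpull : Ψ.pullback (fun y => B.act (σ y) g) =ᶠ[nhds x]
      fun y => l.compContinuousAlternatingMap (Ψ.pullback σ y) := by
    filter_upwards [hσ.eventually] with y hy
    refine oneForm_ext fun v => ?_
    rw [DiffForm.pullback_vec_one, hd y hy, ContinuousLinearMap.compContinuousAlternatingMap_coe,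
      Function.comp_apply, DiffForm.pullback_vec_one]
    exact h (σ y) _
  have hsurj : ∀ v : EP, tderiv EP σ x (chartDeriv u u v) = v := fun v =>
    congrArg (fun L => L v) (chartSymmDeriv_comp_chartDeriv u (mem_chart_source EP u))
  have h1 := hΨ.extDeriv_pullback hσg
  rw [hpull.extDeriv_eq, extDeriv_clm_comp l
    ((hΨ.contDiffAt_pullback hσ).differentiableAt (by simp)), hΨ.extDeriv_pullback hσ] at h1
  have h2 := congrArg (fun w => w ![chartDeriv u u Y, chartDeriv u u Z]) h1
  have e1 := DiffForm.pullback_vec_two Ψ.d (fun y => B.act (σ y) g) x (chartDeriv u u Y)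
    (chartDeriv u u Z)
  have e2 := DiffForm.pullback_vec_two Ψ.d σ x (chartDeriv u u Y) (chartDeriv u u Z)
  rw [hd x hσ, ContinuousLinearMap.comp_apply, ContinuousLinearMap.comp_apply, hsurj, hsurj] at e1
  rw [hsurj, hsurj] at e2
  simp only [hσu] at e1 e2
  exact e1.symm.trans (h2.symm.trans (congrArg l e2))

namespace PrincipalConnection

variable (γ : PrincipalConnection B)

theorem horizontal_of_form_eq_zero {u : P} {Y : EP} (h : γ.form u ![Y] = 0) :
    γ.horizontal u Y = Y := by
  rw [horizontal_apply, h, map_zero, sub_zero]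

/-- The exterior derivative of the pullback of a one-form along a map that is horizontal at a
point is the pullback of the covariant exterior derivative. -/
theorem covDeriv_pullback [IsManifold 𝓘(ℝ, EP) ∞ P] {F : Type*} [NormedAddCommGroup F]
    [NormedSpace ℝ F] {Ψ : DiffForm EP P F 1} (hΨ : Ψ.IsSmooth) {s : X → P} {x : X}
    (hs : SmoothNear EP s x) (h0 : γ.form.pullback s x = 0) :
    extDeriv (Ψ.pullback s) x = (γ.covDeriv Ψ).pullback s x := by
  refine twoForm_ext fun v w => ?_
  have h : ∀ v, γ.horizontal (s x) (tderiv EP s x v) = tderiv EP s x v := fun v =>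
    γ.horizontal_of_form_eq_zero (by rw [← DiffForm.pullback_vec_one, h0]; rfl)
  rw [DiffForm.pullback_vec_two, covDeriv_vec_two, h, h, ← DiffForm.pullback_vec_two,
    hΨ.extDeriv_pullback hs]

variable [LieGroup 𝓘(ℝ, EG) ∞ G]

theorem horizontal_act (g : G) (u : P) (Y : EP) :
    γ.horizontal (B.act u g) (B.dright g u Y) = B.dright g u (γ.horizontal u Y) := by
  rw [horizontal_apply, horizontal_apply, γ.equivariant, map_sub, B.dright_fundamental]

/-- The curvature is equivariant. -/
theorem curvature_act [IsManifold 𝓘(ℝ, EP) ∞ P] (g : G) (u : P) (Y Z : EP) :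
    γ.curvature (B.act u g) ![B.dright g u Y, B.dright g u Z] =
      Ad g⁻¹ (γ.curvature u ![Y, Z]) := by
  rw [curvature, covDeriv_vec_two, covDeriv_vec_two, horizontal_act, horizontal_act]
  exact d_act_of_equivariant γ.smooth (fun u Y => γ.equivariant u g Y) u _ _

/-- Every local section can be changed, without changing its value at a given point, into one that
is horizontal there. -/
theorem exists_gauge [IsManifold 𝓘(ℝ, EP) ∞ P] {s : X → P} {x : X} (hs : SmoothNear EP s x) :
    ∃ s' : X → P, SmoothNear EP s' x ∧ s' x = s x ∧ (∀ y, B.proj (s' y) = B.proj (s y)) ∧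
      γ.form.pullback s' x = 0 := by
  set c := oneCoord EG G
  set L : X →L[ℝ] EG := (chartDeriv (1 : G) (1 : G)).comp
    (oneLin X EG (γ.form.pullback s x)) with hL
  set ℓ : X → EG := fun y => c - L (y - x)
  have hℓx : ℓ x = c := by simp [ℓ]
  have hℓ : ContDiff ℝ ∞ ℓ := contDiff_const.sub (L.contDiff.comp (contDiff_id.sub contDiff_const))
  have hℓd : ∀ v, fderiv ℝ ℓ x v = -L v := fun v => by
    have h1 : HasFDerivAt ℓ (-L) x := by
      have := (HasFDerivAt.comp (g := L) x L.hasFDerivAt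
        ((hasFDerivAt_id x).sub_const x)).const_sub c
      rwa [ContinuousLinearMap.comp_id] at this
    rw [h1.fderiv]
    rfl
  have hg : SmoothNear EG (fun y => oneChartSymm EG G (ℓ y)) x := by
    have h1 : ∀ᶠ y in nhds x, ContMDiffAt 𝓘(ℝ, EG) 𝓘(ℝ, EG) ∞ (oneChartSymm EG G) (ℓ y) :=
      hℓ.continuous.continuousAt.eventually (by rw [hℓx]; exact smoothNear_oneChartSymm EG G)
    filter_upwards [h1] with y hy
    exact ContMDiffAt.comp (I' := 𝓘(ℝ, EG)) (g := oneChartSymm EG G) y hy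
      hℓ.contDiffAt.contMDiffAt
  have hgx : oneChartSymm EG G (ℓ x) = 1 := by rw [hℓx]; exact oneChartSymm_oneCoord EG G
  have hgd : ∀ v, tderiv EG (fun y => oneChartSymm EG G (ℓ y)) x v =
      -(γ.form.pullback s x ![v]) := fun v => by
    have h1 := mder_comp (E := X) (E' := EG) (E'' := EG) (g := oneChartSymm EG G) (f := ℓ) (x := x)
      (by rw [hℓx]; exact (smoothNear_oneChartSymm EG G).mdifferentiableAt)
      (hℓ.contDiffAt.contMDiffAt.mdifferentiableAt (by simp))
    have h2 : mder X EG ℓ x = fderiv ℝ ℓ x := mfderiv_eq_fderiv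
    rw [h2, hℓx] at h1
    refine (congrArg (fun L => L v) h1).trans ?_
    rw [ContinuousLinearMap.comp_apply, hℓd, map_neg, hL, ← oneLin_apply]
    exact congrArg (fun K => -K (oneLin X EG (γ.form.pullback s x) v))
      (chartSymmDeriv_oneCoord_comp EG G)
  refine ⟨fun y => B.act (s y) (oneChartSymm EG G (ℓ y)), hs.act hg, ?_, fun y => B.proj_act _ _,
    oneForm_ext fun v => ?_⟩
  · simp only [hgx, B.act_one]
  · have hAd : Ad (1 : G)⁻¹ = ContinuousLinearMap.id ℝ EG := by
      have := adInChart_oneCoord EG G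
      rwa [adInChart, oneChartSymm_oneCoord] at this
    rw [γ.form_tderiv_act hs hg, hgd, hgx, hAd, maurerCartan_one]
    simp

variable [IsManifold 𝓘(ℝ, EM) ∞ M]

theorem horizontal_congr {u : P} {Y Z : EP} (h : B.dproj u Y = B.dproj u Z) :
    γ.horizontal u Y = γ.horizontal u Z := by
  obtain ⟨A, hA⟩ := B.exists_fundamental_eq (u := u) (X := Y - Z) (by rw [map_sub, h, sub_self])
  rw [← sub_eq_zero, ← map_sub, ← hA, horizontal_fundamental]

/-- The curvature is horizontal. -/
theorem curvature_congr {u : P} {Y Y' Z Z' : EP} (hY : B.dproj u Y = B.dproj u Y')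
    (hZ : B.dproj u Z = B.dproj u Z') : γ.curvature u ![Y, Z] = γ.curvature u ![Y', Z'] := by
  rw [curvature, covDeriv_vec_two, covDeriv_vec_two, γ.horizontal_congr hY,
    γ.horizontal_congr hZ]

end PrincipalConnection

/-! ### The affine space of connections -/

namespace PrincipalConnection

/-- The connection `(1 - t) ω₀ + t ω₁`. -/
def segment (γ₀ γ₁ : PrincipalConnection B) (t : ℝ) : PrincipalConnection B where
  form := γ₀.form + t • (γ₁.form - γ₀.form)
  smooth := by
    rw [sub_eq_add_neg, ← neg_one_smul ℝ γ₀.form]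
    exact γ₀.smooth.add ((γ₁.smooth.add (γ₀.smooth.smul (-1))).smul t)
  form_fundamental u A := by
    change γ₀.form u _ + t • (γ₁.form u _ - γ₀.form u _) = A
    rw [γ₀.form_fundamental, γ₁.form_fundamental, sub_self, smul_zero, add_zero]
  equivariant u g Y := by
    change γ₀.form _ _ + t • (γ₁.form _ _ - γ₀.form _ _) =
      Ad g⁻¹ (γ₀.form u _ + t • (γ₁.form u _ - γ₀.form u _))
    rw [γ₀.equivariant, γ₁.equivariant, map_add, map_smul, map_sub]

variable (γ₀ γ₁ : PrincipalConnection B)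

theorem segment_zero : segment γ₀ γ₁ 0 = γ₀ := by
  have h : (segment γ₀ γ₁ 0).form = γ₀.form := by
    change γ₀.form + (0 : ℝ) • (γ₁.form - γ₀.form) = γ₀.form
    rw [zero_smul, add_zero]
  cases h' : segment γ₀ γ₁ 0
  cases γ₀
  simp only [h'] at h
  subst h
  rfl

theorem segment_one : segment γ₀ γ₁ 1 = γ₁ := by
  have h : (segment γ₀ γ₁ 1).form = γ₁.form := by
    change γ₀.form + (1 : ℝ) • (γ₁.form - γ₀.form) = γ₁.form
    rw [one_smul, add_sub_cancel]
  cases h' : segment γ₀ γ₁ 1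
  cases γ₁
  simp only [h'] at h
  subst h
  rfl

theorem segment_form_vec (t : ℝ) (u : P) (Y : EP) : (segment γ₀ γ₁ t).form u ![Y] =
    γ₀.form u ![Y] + t • (γ₁.form u ![Y] - γ₀.form u ![Y]) := rfl

theorem segment_horizontal (t : ℝ) (u : P) (Y : EP) : (segment γ₀ γ₁ t).horizontal u Y =
    γ₀.horizontal u Y + t • (γ₁.horizontal u Y - γ₀.horizontal u Y) := by
  simp only [horizontal_apply, segment_form_vec, map_add, map_smul, map_sub]
  module

variable (S : GStructure V B)

theorem torsion_eq_zero_iff (γ : PrincipalConnection B) : S.torsion γ = 0 ↔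
    ∀ u Y Z, S.θ.d u ![γ.horizontal u Y, γ.horizontal u Z] = 0 := by
  constructor
  · intro h u Y Z
    rw [← covDeriv_vec_two]
    exact congrArg (fun w => w u ![Y, Z]) h
  · intro h
    funext u
    refine twoForm_ext fun Y Z => ?_
    exact (γ.covDeriv_vec_two S.θ u Y Z).trans (h u Y Z)

variable [LieGroup 𝓘(ℝ, EG) ∞ G]

/-- The derivative of the displacement form vanishes on pairs of vertical vectors, since the form
vanishes on the fibres. -/
theorem _root_.GenChernWeil.GStructure.d_θ_fundamental [IsManifold 𝓘(ℝ, EP) ∞ P] (u : P)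
    (a b : EG) : S.θ.d u ![B.fundamental u a, B.fundamental u b] = 0 := by
  set c := oneCoord EG G
  set s : EG → P := fun z => B.act u (oneChartSymm EG G z)
  have hd : ∀ z ∈ (chartAt EG (1 : G)).target, tderiv EP s z =
      (B.fundamental (s z)).comp ((maurerCartan EG (oneChartSymm EG G z)).comp
        (mder EG EG (oneChartSymm EG G) z)) := fun z hz => by
    have h := mder_comp (E := EG) (E' := EG) (E'' := EP) (g := B.act u)
      (f := oneChartSymm EG G) (x := z) (B.mdifferentiableAt_act_right _ _)
      ((contMDiffAt_oneChartSymm EG G hz).mdifferentiableAt (by simp))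
    rw [B.mder_act_right] at h
    exact h
  have hs : SmoothNear EP s c := by
    filter_upwards [smoothNear_oneChartSymm EG G] with z hz
    exact ContMDiffAt.comp (I' := 𝓘(ℝ, EG)) (g := B.act u) z
      (B.contMDiff_act_right u _) hz
  have h0 : S.θ.pullback s =ᶠ[nhds c] fun _ => 0 := by
    filter_upwards [(chartAt EG (1 : G)).open_target.mem_nhds (oneCoord_mem_target EG G)] with z hz
    refine oneForm_ext fun v => ?_
    rw [DiffForm.pullback_vec_one, hd z hz]
    exact (S.kernel _ _).2 (B.dproj_fundamental _ _)
  have h1 := S.smooth_θ.extDeriv_pullback hs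
  rw [h0.extDeriv_eq, extDeriv_const] at h1
  have hsc : s c = u := by
    simp only [s, c, oneChartSymm_oneCoord, B.act_one]
  have h2 : ∀ a, tderiv EP s c (chartDeriv (1 : G) (1 : G) a) = B.fundamental u a := fun a => by
    rw [hd c (oneCoord_mem_target EG G), hsc, oneChartSymm_oneCoord, maurerCartan_one]
    exact congrArg (fun L => B.fundamental u (L a)) (chartSymmDeriv_oneCoord_comp EG G)
  have h3 := congrArg (fun w => w ![chartDeriv (1 : G) (1 : G) a, chartDeriv (1 : G) (1 : G) b]) h1
  refine (Eq.trans ?_ h3.symm)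
  refine Eq.trans ?_ (DiffForm.pullback_vec_two (S.θ.d) s c _ _).symm
  rw [h2, h2, hsc]

/-- The torsion-free connections form an affine space: the horizontal lifts for two connections
differ by vertical vectors, so by `GStructure.d_θ_fundamental` the torsion of
`(1 - t) ω₀ + t ω₁` is affine in `t`. -/
theorem torsion_segment [IsManifold 𝓘(ℝ, EP) ∞ P] (h₀ : S.torsion γ₀ = 0)
    (h₁ : S.torsion γ₁ = 0) (t : ℝ) : S.torsion (segment γ₀ γ₁ t) = 0 := by
  rw [torsion_eq_zero_iff] at h₀ h₁ ⊢
  intro u Y Z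
  set Y₀ := γ₀.horizontal u Y
  set Z₀ := γ₀.horizontal u Z
  have hY : γ₁.horizontal u Y = Y₀ + B.fundamental u (γ₀.form u ![Y] - γ₁.form u ![Y]) := by
    simp only [Y₀, horizontal_apply, map_sub]
    abel
  have hZ : γ₁.horizontal u Z = Z₀ + B.fundamental u (γ₀.form u ![Z] - γ₁.form u ![Z]) := by
    simp only [Z₀, horizontal_apply, map_sub]
    abel
  have e0 := h₀ u Y Z
  have e1 := h₁ u Y Z
  rw [segment_horizontal, segment_horizontal]
  rw [hY, hZ] at e1 ⊢
  have e2 := S.d_θ_fundamental u (γ₀.form u ![Y] - γ₁.form u ![Y])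
    (γ₀.form u ![Z] - γ₁.form u ![Z])
  rw [add_sub_cancel_left, add_sub_cancel_left]
  have key : ∀ a b, S.θ.d u ![a, b] = twoFormBilin (S.θ.d u) a b := fun _ _ => rfl
  rw [key] at e0 e1 e2 ⊢
  simp only [map_add, map_smul, LinearMap.add_apply, LinearMap.smul_apply] at e1 ⊢
  rw [e0, e2, zero_add, add_zero] at e1
  rw [e0, e2, smul_zero, zero_add, add_zero, ← smul_add]
  exact (congrArg (t • ·) e1).trans (smul_zero t)

end PrincipalConnection

end Basic

/-! ### The curvature of a segment of connections on the product with the line -/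

section DtWedge

variable {F X Y : Type*} [NormedAddCommGroup F] [NormedSpace ℝ F]
  [NormedAddCommGroup X] [NormedSpace ℝ X] [NormedAddCommGroup Y] [NormedSpace ℝ Y]

theorem contDiffAt_extDeriv {k : ℕ} {A : X → X [⋀^Fin k]→L[ℝ] F} {x : X}
    (hA : ContDiffAt ℝ ∞ A x) : ContDiffAt ℝ ∞ (extDeriv A) x :=
  ContDiffAt.comp (g := fun L => ContinuousAlternatingMap.alternatizeUncurryFinCLM ℝ X F L) x
    (ContinuousLinearMap.contDiff _).contDiffAt (hA.fderiv_right (by simp))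

theorem compContinuousLinearMap_comp {Z : Type*} [NormedAddCommGroup Z] [NormedSpace ℝ Z] {k : ℕ}
    (a : X [⋀^Fin k]→L[ℝ] F) (L : Y →L[ℝ] X) (K : Z →L[ℝ] Y) :
    a.compContinuousLinearMap (L.comp K) =
      (a.compContinuousLinearMap L).compContinuousLinearMap K := rfl

/-- The two-form `dt ∧ a` on `X × ℝ`, for a one-form `a` on `X`. -/
def dtWedge (a : X [⋀^Fin 1]→L[ℝ] F) : (X × ℝ) [⋀^Fin 2]→L[ℝ] F :=
  skewBilin (X × ℝ) F ((ContinuousLinearMap.snd ℝ X ℝ).smulRight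
    ((oneLin X F a).comp (ContinuousLinearMap.fst ℝ X ℝ)))

theorem dtWedge_apply (a : X [⋀^Fin 1]→L[ℝ] F) (p q : X × ℝ) :
    dtWedge a ![p, q] = p.2 • a ![q.1] - q.2 • a ![p.1] := by
  rw [dtWedge, skewBilin_apply]
  simp [oneLin_apply]

/-- The exterior derivative of a time dependent one-form without `dt`-component. -/
theorem extDeriv_segment {A D : X → X [⋀^Fin 1]→L[ℝ] F} {p : X × ℝ}
    (hA : DifferentiableAt ℝ A p.1) (hD : DifferentiableAt ℝ D p.1) :
    extDeriv (fun p : X × ℝ => (A p.1 + p.2 • D p.1).compContinuousLinearMap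
      (ContinuousLinearMap.fst ℝ X ℝ)) p =
    (extDeriv (fun y => A y + p.2 • D y) p.1).compContinuousLinearMap
      (ContinuousLinearMap.fst ℝ X ℝ) + dtWedge (D p.1) := by
  have hvec : ∀ {C : X → X [⋀^Fin 1]→L[ℝ] F}, DifferentiableAt ℝ C p.1 → ∀ w,
      DifferentiableAt ℝ (fun y => C y ![w]) p.1 := fun {C} hC w => by
    have := ((oneLin X F).differentiableAt.comp p.1 hC).clm_apply (differentiableAt_const w)
    simpa only [Function.comp_apply, oneLin_apply] using this
  have hfst : ∀ {C : X → X [⋀^Fin 1]→L[ℝ] F}, DifferentiableAt ℝ C p.1 → ∀ w,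
      HasFDerivAt (fun p : X × ℝ => C p.1 ![w])
        ((fderiv ℝ (fun y => C y ![w]) p.1).comp (ContinuousLinearMap.fst ℝ X ℝ)) p :=
    fun {C} hC w =>
      HasFDerivAt.comp (g := fun y => C y ![w]) p (hvec hC w).hasFDerivAt hasFDerivAt_fst
  have hdiff : DifferentiableAt ℝ (fun p : X × ℝ => (A p.1 + p.2 • D p.1).compContinuousLinearMap
      (ContinuousLinearMap.fst ℝ X ℝ)) p := by
    have h1 : DifferentiableAt ℝ (fun p : X × ℝ => A p.1 + p.2 • D p.1) p :=
      (DifferentiableAt.comp (g := A) p hA differentiableAt_fst).add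
        (differentiableAt_snd.smul (DifferentiableAt.comp (g := D) p hD differentiableAt_fst))
    exact (ContinuousAlternatingMap.compContinuousLinearMapCLM (F := F)
      (ContinuousLinearMap.fst ℝ X ℝ)).differentiableAt.comp p h1
  have hsum : DifferentiableAt ℝ (fun y => A y + p.2 • D y) p.1 := hA.add (hD.const_smul p.2)
  refine twoForm_ext fun v w => ?_
  have hd : ∀ v w : X × ℝ, fderiv ℝ (fun p : X × ℝ =>
      (A p.1 + p.2 • D p.1).compContinuousLinearMap (ContinuousLinearMap.fst ℝ X ℝ) ![w]) p v =
      fderiv ℝ (fun y => A y ![w.1]) p.1 v.1 +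
        (p.2 • fderiv ℝ (fun y => D y ![w.1]) p.1 v.1 + v.2 • D p.1 ![w.1]) := by
    intro v w
    have h := (hfst hA w.1).add ((hasFDerivAt_snd (𝕜 := ℝ) (p := p)).smul (hfst hD w.1))
    have e : (fun p : X × ℝ =>
      (A p.1 + p.2 • D p.1).compContinuousLinearMap (ContinuousLinearMap.fst ℝ X ℝ) ![w]) =
      fun p : X × ℝ => A p.1 ![w.1] + p.2 • D p.1 ![w.1] := by
      funext p
      rw [compContinuousLinearMap_vec_one]
      rfl
    rw [e]
    exact congrArg (fun L => L v) h.fderiv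
  have hd' : ∀ v w : X, fderiv ℝ (fun y => (A y + p.2 • D y) ![w]) p.1 v =
      fderiv ℝ (fun y => A y ![w]) p.1 v + p.2 • fderiv ℝ (fun y => D y ![w]) p.1 v := by
    intro v w
    have h := (hvec hA w).hasFDerivAt.add ((hvec hD w).hasFDerivAt.const_smul p.2)
    exact congrArg (fun L => L v) h.fderiv
  rw [extDeriv_vec_two hdiff, hd, hd, ContinuousAlternatingMap.add_apply,
    compContinuousLinearMap_vec_two, extDeriv_vec_two hsum,
    dtWedge_apply]
  change _ = fderiv ℝ (fun y => (A y + p.2 • D y) ![w.1]) p.1 v.1 -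
    fderiv ℝ (fun y => (A y + p.2 • D y) ![v.1]) p.1 w.1 + _
  rw [hd', hd']
  abel

end DtWedge

section Total

variable {EM EP EG V X Y : Type*}
  [NormedAddCommGroup EM] [NormedSpace ℝ EM] [NormedAddCommGroup EP] [NormedSpace ℝ EP]
  [NormedAddCommGroup EG] [NormedSpace ℝ EG] [NormedAddCommGroup V] [NormedSpace ℝ V]
  [NormedAddCommGroup X] [NormedSpace ℝ X] [NormedAddCommGroup Y] [NormedSpace ℝ Y]
  {M P G : Type*}
  [TopologicalSpace M] [ChartedSpace EM M]
  [TopologicalSpace P] [ChartedSpace EP P]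
  [TopologicalSpace G] [ChartedSpace EG G] [Group G]
  {B : PrincipalBundle EM EP EG M P G} (S : GStructure V B) (γ₀ γ₁ : PrincipalConnection B)

namespace PrincipalConnection

/-- The curvature at `(u, t)` of the connection on `P × ℝ` that is `ω_t = (1 - t) ω₀ + t ω₁` on the
slice `P × {t}`: it is `Ω_t + dt ∧ (ω₁ - ω₀)`. -/
def totalCurvature (u : P) (t : ℝ) : (EP × ℝ) [⋀^Fin 2]→L[ℝ] EG :=
  ((segment γ₀ γ₁ t).curvature u).compContinuousLinearMap (ContinuousLinearMap.fst ℝ EP ℝ) +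
    dtWedge (γ₁.form u - γ₀.form u)

theorem totalCurvature_vec (u : P) (t : ℝ) (p q : EP × ℝ) :
    totalCurvature γ₀ γ₁ u t ![p, q] = (segment γ₀ γ₁ t).curvature u ![p.1, q.1] +
      (p.2 • (γ₁.form u ![q.1] - γ₀.form u ![q.1]) -
        q.2 • (γ₁.form u ![p.1] - γ₀.form u ![p.1])) := by
  rw [totalCurvature, ContinuousAlternatingMap.add_apply, compContinuousLinearMap_vec_two,
    dtWedge_apply]
  rfl

/-- The pullback of `ω_t` along `s × id`. -/
def segmentPullback (s : X → P) (p : X × ℝ) : (X × ℝ) [⋀^Fin 1]→L[ℝ] EG :=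
  (γ₀.form.pullback s p.1 + p.2 • (γ₁.form.pullback s p.1 - γ₀.form.pullback s p.1)
    ).compContinuousLinearMap (ContinuousLinearMap.fst ℝ X ℝ)

theorem segment_form_pullback (t : ℝ) (s : X → P) (x : X) :
    (segment γ₀ γ₁ t).form.pullback s x =
      γ₀.form.pullback s x + t • (γ₁.form.pullback s x - γ₀.form.pullback s x) := rfl

theorem contDiffAt_segmentPullback [IsManifold 𝓘(ℝ, EP) ∞ P] {s : X → P} {p : X × ℝ}
    (hs : SmoothNear EP s p.1) : ContDiffAt ℝ ∞ (segmentPullback γ₀ γ₁ s) p := by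
  have h0 : ContDiffAt ℝ ∞ (fun p : X × ℝ => γ₀.form.pullback s p.1) p :=
    (γ₀.smooth.contDiffAt_pullback hs).comp p contDiffAt_fst
  have h1 : ContDiffAt ℝ ∞ (fun p : X × ℝ => γ₁.form.pullback s p.1) p :=
    (γ₁.smooth.contDiffAt_pullback hs).comp p contDiffAt_fst
  exact contDiffAt_compContinuousLinearMap (h0.add (contDiffAt_snd.smul (h1.sub h0)))
    contDiffAt_const

variable [LieGroup 𝓘(ℝ, EG) ∞ G]

/-- The structure equation for the connection on `P × ℝ`. -/
theorem totalCurvature_pullback [IsManifold 𝓘(ℝ, EP) ∞ P] {s : X → P} {p : X × ℝ}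
    (hs : SmoothNear EP s p.1) :
    (totalCurvature γ₀ γ₁ (s p.1) p.2).compContinuousLinearMap
      ((tderiv EP s p.1).prodMap (ContinuousLinearMap.id ℝ ℝ)) =
    extDeriv (segmentPullback γ₀ γ₁ s) p +
      quadForm (structureBilin EG G) (segmentPullback γ₀ γ₁ s p) := by
  have h0 := γ₀.differentiableAt_pullback_form hs
  have h1 := γ₁.differentiableAt_pullback_form hs
  have he : extDeriv (segmentPullback γ₀ γ₁ s) p = _ :=
    extDeriv_segment (A := γ₀.form.pullback s)
      (D := fun y => γ₁.form.pullback s y - γ₀.form.pullback s y) h0 (h1.sub h0)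
  have hc := (segment γ₀ γ₁ p.2).curvature_pullback hs
  rw [he]
  refine twoForm_ext fun v w => ?_
  rw [compContinuousLinearMap_vec_two, totalCurvature_vec, ContinuousAlternatingMap.add_apply,
    ContinuousAlternatingMap.add_apply, compContinuousLinearMap_vec_two, dtWedge_apply,
    quadForm_apply, segmentPullback, compContinuousLinearMap_vec_one,
    compContinuousLinearMap_vec_one]
  have hc' : (segment γ₀ γ₁ p.2).curvature (s p.1) ![tderiv EP s p.1 v.1, tderiv EP s p.1 w.1] = _ :=
    (DiffForm.pullback_vec_two _ s p.1 v.1 w.1).symm.trans (congrArg (fun a => a ![v.1, w.1]) hc)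
  refine (congrArg (· + _) hc').trans ?_
  rw [ContinuousAlternatingMap.add_apply, quadForm_apply]
  have e : ∀ (γ : PrincipalConnection B) y, γ.form (s p.1) ![tderiv EP s p.1 y] =
      γ.form.pullback s p.1 ![y] := fun γ y => (DiffForm.pullback_vec_one _ _ _ _).symm
  have e2 : ∀ y : X × ℝ, (tderiv EP s p.1).prodMap (ContinuousLinearMap.id ℝ ℝ) y =
      (tderiv EP s p.1 y.1, y.2) := fun _ => rfl
  simp only [e2, e]
  exact add_right_comm _ _ _

end PrincipalConnection

end Total

/-! ### Characteristic forms -/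

section Characteristic

variable {EM EP EG V X Y Z : Type*}
  [NormedAddCommGroup EM] [NormedSpace ℝ EM] [NormedAddCommGroup EP] [NormedSpace ℝ EP]
  [NormedAddCommGroup EG] [NormedSpace ℝ EG]
  [NormedAddCommGroup V] [NormedSpace ℝ V]
  [NormedAddCommGroup X] [NormedSpace ℝ X]
  [NormedAddCommGroup Y] [NormedSpace ℝ Y]
  [NormedAddCommGroup Z] [NormedSpace ℝ Z]
  {M P G : Type*}
  [TopologicalSpace M] [ChartedSpace EM M]
  [TopologicalSpace P] [ChartedSpace EP P]
  [TopologicalSpace G] [ChartedSpace EG G] [Group G]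
  {B : PrincipalBundle EM EP EG M P G} (S : GStructure V B) (γ γ₀ γ₁ : PrincipalConnection B)
  (f : AAlg EG V) (n : ℕ)

namespace GStructure

theorem action_eq_of_mem {f : AAlg EG V} (hf : f ∈ S.invariants) (g : G) : S.action g f = f := by
  rw [invariants, Algebra.mem_iInf] at hf
  exact hf g

theorem θ_congr {u : P} {Y Z : EP} (h : B.dproj u Y = B.dproj u Z) :
    S.θ u ![Y] = S.θ u ![Z] := by
  rw [← sub_eq_zero, ← oneLin_apply, ← oneLin_apply, ← map_sub, oneLin_apply, S.kernel, map_sub, h,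
    sub_self]

section

variable [IsManifold 𝓘(ℝ, EP) ∞ P]

theorem contDiffAt_extDeriv_add_quadForm {s : X → P} {p : X × ℝ} (hs : SmoothNear EP s p.1) :
    ContDiffAt ℝ ∞ (fun p => extDeriv (PrincipalConnection.segmentPullback γ₀ γ₁ s) p +
        quadForm (structureBilin EG G) (PrincipalConnection.segmentPullback γ₀ γ₁ s p)) p := by
  have hA := PrincipalConnection.contDiffAt_segmentPullback γ₀ γ₁ hs
  exact (contDiffAt_extDeriv hA).add ((contDiff_quadForm _).contDiffAt.comp p hA)

theorem contDiffAt_θ_pullback_fst {s : X → P} {p : X × ℝ} (hs : SmoothNear EP s p.1) :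
    ContDiffAt ℝ ∞ (fun p : X × ℝ => (S.θ.pullback s p.1).compContinuousLinearMap
      (ContinuousLinearMap.fst ℝ X ℝ)) p :=
  contDiffAt_compContinuousLinearMap ((S.smooth_θ.contDiffAt_pullback hs).comp p contDiffAt_fst)
    contDiffAt_const

end

section

variable [LieGroup 𝓘(ℝ, EG) ∞ G] [IsManifold 𝓘(ℝ, EM) ∞ M]

theorem form_sub_congr {u : P} {Y Z : EP} (h : B.dproj u Y = B.dproj u Z) :
    γ₁.form u ![Y] - γ₀.form u ![Y] = γ₁.form u ![Z] - γ₀.form u ![Z] := by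
  obtain ⟨A, hA⟩ := B.exists_fundamental_eq (u := u) (X := Y - Z) (by rw [map_sub, h, sub_self])
  obtain rfl : Y = Z + B.fundamental u A := by rw [hA]; abel
  rw [γ₁.form_add, γ₀.form_add, γ₁.form_fundamental, γ₀.form_fundamental]
  abel

end

variable [FiniteDimensional ℝ EG] [FiniteDimensional ℝ V] [FiniteDimensional ℝ X]
  [FiniteDimensional ℝ Y] [FiniteDimensional ℝ Z]

theorem substForm_congr {W W' : Y [⋀^Fin 2]→L[ℝ] EG} {θ θ' : Y [⋀^Fin 1]→L[ℝ] V} (hW : W = W')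
    (hθ : θ = θ') (n : ℕ) (f : AAlg EG V) : substForm W θ n f = substForm W' θ' n f := by
  rw [hW, hθ]

/-- The component of degree `n` of `f(Ω, …, Ω, θ, …, θ)` at `u`, evaluated at tangent vectors that
are given by a linear map `h`. -/
def charAt (u : P) (h : Y →L[ℝ] EP) : Y [⋀^Fin n]→L[ℝ] ℝ :=
  substForm ((γ.curvature u).compContinuousLinearMap h) ((S.θ u).compContinuousLinearMap h) n f

/-- The analogue of `charAt` on `P × ℝ`, with the connection that is `(1 - t) ω₀ + t ω₁` on the
slice `P × {t}`. -/
def totalCharAt (u : P) (h : Y →L[ℝ] EP) (t : ℝ) : (Y × ℝ) [⋀^Fin n]→L[ℝ] ℝ :=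
  substForm ((PrincipalConnection.totalCurvature γ₀ γ₁ u t).compContinuousLinearMap
      (h.prodMap (ContinuousLinearMap.id ℝ ℝ)))
    ((S.θ u).compContinuousLinearMap (h.comp (ContinuousLinearMap.fst ℝ Y ℝ))) n f

theorem charAt_comp (u : P) (h : Y →L[ℝ] EP) (L : Z →L[ℝ] Y) :
    S.charAt γ f n u (h.comp L) = (S.charAt γ f n u h).compContinuousLinearMap L := by
  rw [charAt, charAt, compContinuousLinearMap_comp, compContinuousLinearMap_comp, substForm_comp]

theorem totalCharAt_comp (u : P) (h : Y →L[ℝ] EP) (t : ℝ) (L : Z →L[ℝ] Y) :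
    S.totalCharAt γ₀ γ₁ f n u (h.comp L) t = (S.totalCharAt γ₀ γ₁ f n u h t
      ).compContinuousLinearMap (L.prodMap (ContinuousLinearMap.id ℝ ℝ)) := by
  rw [totalCharAt, totalCharAt, ← substForm_comp]
  rfl

theorem totalCharAt_comp_inl (u : P) (h : Y →L[ℝ] EP) (t : ℝ) :
    (S.totalCharAt γ₀ γ₁ f n u h t).compContinuousLinearMap (ContinuousLinearMap.inl ℝ Y ℝ) =
      S.charAt (PrincipalConnection.segment γ₀ γ₁ t) f n u h := by
  rw [totalCharAt, charAt, ← substForm_comp]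
  refine substForm_congr ?_ rfl n f
  refine twoForm_ext fun v w => ?_
  rw [compContinuousLinearMap_vec_two, compContinuousLinearMap_vec_two,
    compContinuousLinearMap_vec_two, PrincipalConnection.totalCurvature_vec]
  change (PrincipalConnection.segment γ₀ γ₁ t).curvature u ![h v, h w] +
    ((0 : ℝ) • _ - (0 : ℝ) • _) = _
  rw [zero_smul, zero_smul, sub_zero, add_zero]

/-- The pullback of the characteristic form on `P × ℝ` along `s × id`. -/
def totalCharPullback (s : X → P) (p : X × ℝ) : (X × ℝ) [⋀^Fin n]→L[ℝ] ℝ :=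
  S.totalCharAt γ₀ γ₁ f n (s p.1) (tderiv EP s p.1) p.2

variable [IsManifold 𝓘(ℝ, EP) ∞ P] [LieGroup 𝓘(ℝ, EG) ∞ G]

theorem totalCharPullback_eventuallyEq {s : X → P} {p : X × ℝ} (hs : SmoothNear EP s p.1) :
    S.totalCharPullback γ₀ γ₁ f n s =ᶠ[nhds p] fun p => substForm
      (extDeriv (PrincipalConnection.segmentPullback γ₀ γ₁ s) p +
        quadForm (structureBilin EG G) (PrincipalConnection.segmentPullback γ₀ γ₁ s p))
      ((S.θ.pullback s p.1).compContinuousLinearMap (ContinuousLinearMap.fst ℝ X ℝ)) n f := by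
  filter_upwards [(continuous_fst.tendsto p).eventually hs.eventually] with q hq
  rw [totalCharPullback, totalCharAt, PrincipalConnection.totalCurvature_pullback γ₀ γ₁ hq]
  rfl

theorem contDiffAt_totalCharPullback {s : X → P} {p : X × ℝ} (hs : SmoothNear EP s p.1) :
    ContDiffAt ℝ ∞ (S.totalCharPullback γ₀ γ₁ f n s) p :=
  (contDiffAt_substForm (contDiffAt_extDeriv_add_quadForm γ₀ γ₁ hs)
    (S.contDiffAt_θ_pullback_fst hs) n f).congr_of_eventuallyEq
      (S.totalCharPullback_eventuallyEq γ₀ γ₁ f n hs)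

variable [IsManifold 𝓘(ℝ, EM) ∞ M]

/-- For invariant `f`, the characteristic form on `P × ℝ` descends to `M × ℝ`: its value depends
only on the projection of the tangent vectors to the base. -/
theorem totalCharAt_congr {f : AAlg EG V} (hf : f ∈ S.invariants) {u u' : P}
    (hu : B.proj u = B.proj u') {h h' : Y →L[ℝ] EP}
    (hh : (B.dproj u).comp h = (B.dproj u').comp h') (t : ℝ) :
    S.totalCharAt γ₀ γ₁ f n u h t = S.totalCharAt γ₀ γ₁ f n u' h' t := by
  obtain ⟨g, rfl⟩ := B.exists_act_eq hu
  have hd : ∀ y, B.dproj (B.act u g) (h' y) = B.dproj (B.act u g) (B.dright g u (h y)) := fun y => by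
    rw [B.dproj_dright]
    exact (congrArg (fun L => L y) hh).symm
  rw [totalCharAt, totalCharAt]
  conv_lhs => rw [← S.action_eq_of_mem hf g, action, substForm_subst]
  refine substForm_congr ?_ ?_ n f
  · refine twoForm_ext fun p q => ?_
    rw [compContinuousLinearMap_vec_two, PrincipalConnection.totalCurvature_vec]
    refine Eq.trans ?_ (congrArg₂ (· + ·) ((PrincipalConnection.segment γ₀ γ₁ t).curvature_congr
      (hd p.1) (hd q.1)) (congrArg₂ (fun a b => p.2 • a - q.2 • b)
        (form_sub_congr γ₀ γ₁ (hd q.1)) (form_sub_congr γ₀ γ₁ (hd p.1)))).symm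
    rw [PrincipalConnection.curvature_act, γ₀.equivariant, γ₁.equivariant, γ₀.equivariant,
      γ₁.equivariant, ← map_sub, ← map_sub, ← map_smul, ← map_smul, ← map_sub, ← map_add,
      ContinuousLinearMap.compContinuousAlternatingMap_coe, Function.comp_apply,
      compContinuousLinearMap_vec_two, PrincipalConnection.totalCurvature_vec]
    rfl
  · refine oneForm_ext fun p => ?_
    rw [compContinuousLinearMap_vec_one]
    refine Eq.trans ?_ (S.θ_congr (hd p.1)).symm
    rw [S.equivariant, ContinuousLinearMap.compContinuousAlternatingMap_coe, Function.comp_apply,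
      compContinuousLinearMap_vec_one]
    rfl

theorem charAt_congr {f : AAlg EG V} (hf : f ∈ S.invariants) {u u' : P}
    (hu : B.proj u = B.proj u') {h h' : Y →L[ℝ] EP}
    (hh : (B.dproj u).comp h = (B.dproj u').comp h') :
    S.charAt γ f n u h = S.charAt γ f n u' h' := by
  rw [← PrincipalConnection.segment_zero γ γ, ← totalCharAt_comp_inl, ← totalCharAt_comp_inl,
    S.totalCharAt_congr γ γ n hf hu hh]

/-- For torsion-free connections the characteristic form on `P × ℝ` is closed. At a given point the
section can be taken horizontal; then the pullbacks of `Ω` and `θ` are closed at this point, the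
former by the structure equation (the Bianchi identity), the latter since the torsion vanishes. -/
theorem extDeriv_totalCharPullback {f : AAlg EG V} (hf : f ∈ S.invariants)
    (h₀ : S.torsion γ₀ = 0) (h₁ : S.torsion γ₁ = 0) {s : X → P} {p : X × ℝ}
    (hs : SmoothNear EP s p.1) : extDeriv (S.totalCharPullback γ₀ γ₁ f n s) p = 0 := by
  obtain ⟨s', hs', -, hproj, hform⟩ :=
    (PrincipalConnection.segment γ₀ γ₁ p.2).exists_gauge hs
  have heq : S.totalCharPullback γ₀ γ₁ f n s =ᶠ[nhds p] S.totalCharPullback γ₀ γ₁ f n s' := by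
    filter_upwards [(continuous_fst.tendsto p).eventually hs.eventually,
      (continuous_fst.tendsto p).eventually hs'.eventually] with q hq hq'
    refine S.totalCharAt_congr γ₀ γ₁ n hf (hproj q.1).symm ?_ q.2
    have e1 := mder_comp (E'' := EM) (g := B.proj) (f := s) (x := q.1)
      (B.mdifferentiableAt_proj _) hq.mdifferentiableAt
    have e2 := mder_comp (E'' := EM) (g := B.proj) (f := s') (x := q.1)
      (B.mdifferentiableAt_proj _) hq'.mdifferentiableAt
    simp only [hproj] at e2
    exact e1.symm.trans e2
  have hA := PrincipalConnection.contDiffAt_segmentPullback γ₀ γ₁ hs'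
  have hA0 : PrincipalConnection.segmentPullback γ₀ γ₁ s' p = 0 := by
    rw [PrincipalConnection.segmentPullback, ← PrincipalConnection.segment_form_pullback, hform]
    rfl
  have hq : DifferentiableAt ℝ (fun p => quadForm (structureBilin EG G)
      (PrincipalConnection.segmentPullback γ₀ γ₁ s' p)) p :=
    (((contDiff_quadForm (r := ∞) _).contDiffAt.comp p hA)).differentiableAt (by simp)
  have hθ : DifferentiableAt ℝ (S.θ.pullback s') p.1 :=
    (S.smooth_θ.contDiffAt_pullback hs').differentiableAt (by simp)
  -- the section `s'` is horizontal at `p.1` for the connection at time `p.2`, and replacing `s` by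
  -- `s'` does not change the pullback since `f` is invariant
  rw [heq.extDeriv_eq, (S.totalCharPullback_eventuallyEq γ₀ γ₁ f n hs').extDeriv_eq]
  refine (extDeriv_substForm_eq_zero
    ((contDiffAt_extDeriv_add_quadForm γ₀ γ₁ hs').differentiableAt (by simp))
    ((S.contDiffAt_θ_pullback_fst hs').differentiableAt (by simp)) ?_ ?_ n f).2
  · rw [extDeriv_fun_add ((contDiffAt_extDeriv hA).differentiableAt (by simp)) hq,
      extDeriv_quadForm_eq_zero _ (hA.differentiableAt (by simp)) hA0, add_zero]
    exact extDeriv_extDeriv_apply hA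
      (by rw [minSmoothness_of_isRCLikeNormedField]; exact WithTop.coe_le_coe.2 le_top)
  · have hτ := (PrincipalConnection.segment γ₀ γ₁ p.2).covDeriv_pullback S.smooth_θ hs' hform
    have h0 : (PrincipalConnection.segment γ₀ γ₁ p.2).covDeriv S.θ = 0 :=
      PrincipalConnection.torsion_segment γ₀ γ₁ S h₀ h₁ p.2
    have e : extDeriv (fun p : X × ℝ => (S.θ.pullback s' p.1).compContinuousLinearMap
        (ContinuousLinearMap.fst ℝ X ℝ)) p = (extDeriv (S.θ.pullback s') p.1
          ).compContinuousLinearMap (fderiv ℝ Prod.fst p) := by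
      rw [← _root_.extDeriv_pullback (f := (Prod.fst : X × ℝ → X)) hθ
        (contDiffAt_fst (n := ∞)) (by
          rw [minSmoothness_of_isRCLikeNormedField]; exact WithTop.coe_le_coe.2 le_top)]
      have : ∀ q : X × ℝ, fderiv ℝ Prod.fst q = ContinuousLinearMap.fst ℝ X ℝ := fun q => fderiv_fst
      simp only [this]
    rw [e, hτ, h0]
    rfl

end GStructure

end Characteristic

/-! ### Contraction with the direction of time -/

section Contraction

variable {F X Y : Type*} [NormedAddCommGroup F] [NormedSpace ℝ F]
  [NormedAddCommGroup X] [NormedSpace ℝ X] [NormedAddCommGroup Y] [NormedSpace ℝ Y]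

/-- Restriction of alternating maps to the slice `X × {0}` of `X × ℝ`. -/
def restrictSlice (X : Type*) [NormedAddCommGroup X] [NormedSpace ℝ X] (n : ℕ) :
    ((X × ℝ) [⋀^Fin n]→L[ℝ] ℝ) →L[ℝ] X [⋀^Fin n]→L[ℝ] ℝ :=
  ContinuousAlternatingMap.compContinuousLinearMapCLM (ContinuousLinearMap.inl ℝ X ℝ)

theorem restrictSlice_apply {n : ℕ} (a : (X × ℝ) [⋀^Fin n]→L[ℝ] ℝ) :
    restrictSlice X n a = a.compContinuousLinearMap (ContinuousLinearMap.inl ℝ X ℝ) := rfl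

/-- Contraction of alternating maps on `X × ℝ` with the unit vector of `ℝ`, restricted to `X`. -/
def contractTime (X : Type*) [NormedAddCommGroup X] [NormedSpace ℝ X] (n : ℕ) :
    ((X × ℝ) [⋀^Fin (n + 1)]→L[ℝ] ℝ) →L[ℝ] X [⋀^Fin n]→L[ℝ] ℝ :=
  (restrictSlice X n).comp
    ((ContinuousLinearMap.apply ℝ ((X × ℝ) [⋀^Fin n]→L[ℝ] ℝ) ((0, 1) : X × ℝ)).comp
      ContinuousAlternatingMap.curryLeftLI.toContinuousLinearMap)

theorem contractTime_apply {n : ℕ} (a : (X × ℝ) [⋀^Fin (n + 1)]→L[ℝ] ℝ) (v : Fin n → X) :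
    contractTime X n a v = a (Matrix.vecCons (0, 1) fun i => (v i, 0)) := rfl

theorem contractTime_comp {n : ℕ} (a : (X × ℝ) [⋀^Fin (n + 1)]→L[ℝ] ℝ) (L : Y →L[ℝ] X) :
    contractTime Y n (a.compContinuousLinearMap (L.prodMap (ContinuousLinearMap.id ℝ ℝ))) =
      (contractTime X n a).compContinuousLinearMap L := by
  ext v
  rw [contractTime_apply, ContinuousAlternatingMap.compContinuousLinearMap_apply,
    ContinuousAlternatingMap.compContinuousLinearMap_apply, contractTime_apply]
  congr 1
  funext i
  refine Fin.cases ?_ (fun j => ?_) i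
  · exact Prod.ext (map_zero L) rfl
  · rfl

/-- For a closed form `T` on `X × ℝ`, the derivative with respect to time of the restriction of `T`
to the slices is the exterior derivative of the contraction of `T` with the direction of time. -/
theorem hasDerivAt_restrictSlice {n : ℕ} {T : X × ℝ → (X × ℝ) [⋀^Fin (n + 1)]→L[ℝ] ℝ} {x : X}
    {t : ℝ} (hT : DifferentiableAt ℝ T (x, t)) (h0 : extDeriv T (x, t) = 0) :
    HasDerivAt (fun τ => restrictSlice X (n + 1) (T (x, τ)))
      (extDeriv (fun y => contractTime X n (T (y, t))) x) t := by
  have h1 : HasDerivAt (fun τ : ℝ => (x, τ)) ((0, 1) : X × ℝ) t :=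
    (hasDerivAt_const t x).prodMk (hasDerivAt_id t)
  have h2 : HasDerivAt (fun τ => restrictSlice X (n + 1) (T (x, τ)))
      (restrictSlice X (n + 1) (fderiv ℝ T (x, t) (0, 1))) t :=
    (restrictSlice X (n + 1)).hasFDerivAt.comp_hasDerivAt t (hT.hasFDerivAt.comp_hasDerivAt t h1)
  have h3 : HasFDerivAt (fun y => contractTime X n (T (y, t)))
      ((contractTime X n).comp ((fderiv ℝ T (x, t)).comp (ContinuousLinearMap.inl ℝ X ℝ))) x := by
    have h4 : HasFDerivAt (fun y : X => (y, t)) (ContinuousLinearMap.inl ℝ X ℝ) x :=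
      (hasFDerivAt_id x).prodMk (hasFDerivAt_const t x)
    exact (contractTime X n).hasFDerivAt.comp x (HasFDerivAt.comp (g := T) x hT.hasFDerivAt h4)
  convert h2 using 1
  ext v
  have h5 := congrArg (fun a => a (Matrix.vecCons (0, 1) fun i => (v i, 0))) h0
  simp only [extDeriv, ContinuousAlternatingMap.alternatizeUncurryFin_apply,
    Fin.sum_univ_succ (n := n + 1)] at h5
  rw [extDeriv, h3.fderiv, ContinuousAlternatingMap.alternatizeUncurryFin_apply]
  have e0 : (0 : Fin (n + 2)).removeNth (Matrix.vecCons ((0, 1) : X × ℝ) fun i => (v i, 0)) =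
      fun i => (v i, 0) := by
    funext i
    simp [Fin.removeNth]
  have e1 : ∀ j : Fin (n + 1),
      j.succ.removeNth (Matrix.vecCons ((0, 1) : X × ℝ) fun i => (v i, 0)) =
        Matrix.vecCons (0, 1) fun i => (j.removeNth v i, 0) := by
    intro j
    funext i
    refine Fin.cases ?_ (fun i => ?_) i
    · simp [Fin.removeNth]
    · simp [Fin.removeNth]
  simp only [e0, e1] at h5
  simp only [Fin.val_zero, pow_zero, one_smul, Matrix.cons_val_zero, Matrix.cons_val_succ,
    Fin.val_succ, pow_succ, mul_neg, mul_one, neg_smul, Finset.sum_neg_distrib] at h5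
  exact (sub_eq_zero.1 ((sub_eq_add_neg _ _).trans h5)).symm

/-- A closed function on `X × ℝ` does not depend on time. -/
theorem hasDerivAt_restrictSlice_zero {T : X × ℝ → (X × ℝ) [⋀^Fin 0]→L[ℝ] ℝ} {x : X} {t : ℝ}
    (hT : DifferentiableAt ℝ T (x, t)) (h0 : extDeriv T (x, t) = 0) :
    HasDerivAt (fun τ => restrictSlice X 0 (T (x, τ))) 0 t := by
  have h1 : HasDerivAt (fun τ : ℝ => (x, τ)) ((0, 1) : X × ℝ) t :=
    (hasDerivAt_const t x).prodMk (hasDerivAt_id t)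
  have h2 : HasDerivAt (fun τ => restrictSlice X 0 (T (x, τ)))
      (restrictSlice X 0 (fderiv ℝ T (x, t) (0, 1))) t :=
    (restrictSlice X 0).hasFDerivAt.comp_hasDerivAt t (hT.hasFDerivAt.comp_hasDerivAt t h1)
  convert h2 using 1
  ext v
  have h5 := congrArg (fun a => a fun _ => (0, 1)) h0
  simp only [extDeriv, ContinuousAlternatingMap.alternatizeUncurryFin_apply] at h5
  have h6 := (Fin.sum_univ_one _).symm.trans h5
  simp only [Fin.val_zero, pow_zero, one_smul] at h6
  exact h6.symm.trans (congrArg (fderiv ℝ T (x, t) (0, 1)) (Subsingleton.elim _ _))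

/-- The restriction of a closed form to a slice is closed. -/
theorem extDeriv_restrictSlice {n : ℕ} {T : X × ℝ → (X × ℝ) [⋀^Fin n]→L[ℝ] ℝ} {x : X} {t : ℝ}
    (hT : DifferentiableAt ℝ T (x, t)) (h0 : extDeriv T (x, t) = 0) :
    extDeriv (fun y => restrictSlice X n (T (y, t))) x = 0 := by
  have hd : ∀ y : X, HasFDerivAt (fun y : X => (y, t)) (ContinuousLinearMap.inl ℝ X ℝ) y :=
    fun y => (hasFDerivAt_id y).prodMk (hasFDerivAt_const t y)
  have h1 := _root_.extDeriv_pullback (f := fun y : X => (y, t)) (x := x) hT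
    (contDiffAt_id.prodMk contDiffAt_const) (r := ∞)
    (by rw [minSmoothness_of_isRCLikeNormedField]; exact WithTop.coe_le_coe.2 le_top)
  simp only [(hd _).fderiv, h0] at h1
  exact h1

end Contraction

/-! ### Descent to the base -/

section Descent

variable {EM EP EG V Y : Type*}
  [NormedAddCommGroup EM] [NormedSpace ℝ EM] [FiniteDimensional ℝ EM]
  [NormedAddCommGroup EP] [NormedSpace ℝ EP]
  [NormedAddCommGroup EG] [NormedSpace ℝ EG]
  [NormedAddCommGroup V] [NormedSpace ℝ V] [FiniteDimensional ℝ V]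
  [NormedAddCommGroup Y] [NormedSpace ℝ Y] [FiniteDimensional ℝ Y]
  {M P G : Type*}
  [TopologicalSpace M] [ChartedSpace EM M]
  [TopologicalSpace P] [ChartedSpace EP P]
  [TopologicalSpace G] [ChartedSpace EG G] [Group G] [LieGroup 𝓘(ℝ, EG) ∞ G]
  {B : PrincipalBundle EM EP EG M P G} (S : GStructure V B) (γ γ₀ γ₁ : PrincipalConnection B)
  {f : AAlg EG V} (n : ℕ)

theorem GStructure.contDiffAt_totalCharPullback_slice [FiniteDimensional ℝ EG]
    [IsManifold 𝓘(ℝ, EP) ∞ P]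
    {s : EM → P} {y : EM} (hs : SmoothNear EP s y) (t : ℝ) :
    ContDiffAt ℝ ∞ (fun y => S.totalCharPullback γ₀ γ₁ f n s (y, t)) y :=
  ContDiffAt.comp (g := S.totalCharPullback γ₀ γ₁ f n s) y
    (S.contDiffAt_totalCharPullback γ₀ γ₁ f n (p := (y, t)) hs)
    (contDiffAt_id.prodMk contDiffAt_const)

variable [IsManifold 𝓘(ℝ, EM) ∞ M]

theorem PrincipalBundle.exists_lift (B : PrincipalBundle EM EP EG M P G) (x : M) :
    ∃ (u : P) (h : EM →L[ℝ] EP), B.proj u = x ∧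
      (B.dproj u).comp h = ContinuousLinearMap.id ℝ EM := by
  obtain ⟨u, hu⟩ := B.surjective_proj x
  obtain ⟨h, hh⟩ := (B.dproj u).toLinearMap.exists_rightInverse_of_surjective
    (LinearMap.range_eq_top.2 (B.surjective_dproj u))
  refine ⟨u, LinearMap.toContinuousLinearMap h, hu, ?_⟩
  ext v
  exact congrArg (fun L => L v) hh

/-- A point of the fibre over `x`. -/
def PrincipalBundle.liftPt (B : PrincipalBundle EM EP EG M P G) (x : M) : P :=
  (B.exists_lift x).choose

/-- A right inverse of the derivative of the projection at the chosen point over `x`. -/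
def PrincipalBundle.liftVec (B : PrincipalBundle EM EP EG M P G) (x : M) : EM →L[ℝ] EP :=
  (B.exists_lift x).choose_spec.choose

theorem PrincipalBundle.proj_liftPt (x : M) : B.proj (B.liftPt x) = x :=
  (B.exists_lift x).choose_spec.choose_spec.1

theorem PrincipalBundle.dproj_comp_liftVec (x : M) :
    (B.dproj (B.liftPt x)).comp (B.liftVec x) = ContinuousLinearMap.id ℝ EM :=
  (B.exists_lift x).choose_spec.choose_spec.2

variable [FiniteDimensional ℝ EG]

namespace GStructure

variable (f) in
/-- The component of degree `n` of the form `f(Ω, …, Ω, θ, …, θ)` on `M`, computed at an arbitrary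
point of the fibre; it is meaningful for invariant `f`. -/
def baseForm : DiffForm EM M ℝ n :=
  fun x => S.charAt γ f n (B.liftPt x) (B.liftVec x)

variable (f) in
/-- The form on `M × ℝ` given by the connection on `P × ℝ` joining two connections. -/
def totalBaseForm (x : M) (t : ℝ) : (EM × ℝ) [⋀^Fin n]→L[ℝ] ℝ :=
  S.totalCharAt γ₀ γ₁ f n (B.liftPt x) (B.liftVec x) t

variable (f) in
/-- The transgression form: the contraction of the form on `M × ℝ` with the direction of time,
restricted to the slice `M × {t}`. -/
def transgression (t : ℝ) : DiffForm EM M ℝ n :=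
  fun x => contractTime EM n (S.totalBaseForm γ₀ γ₁ f (n + 1) x t)

theorem restrictSlice_totalBaseForm (x : M) (t : ℝ) :
    restrictSlice EM n (S.totalBaseForm γ₀ γ₁ f n x t) =
      S.baseForm (PrincipalConnection.segment γ₀ γ₁ t) f n x :=
  S.totalCharAt_comp_inl γ₀ γ₁ f n _ _ t

theorem inChart_baseForm_segment (x₀ : M) (y : EM) (t : ℝ) :
    (S.baseForm (PrincipalConnection.segment γ₀ γ₁ t) f n).inChart x₀ y =
      restrictSlice EM n ((S.totalBaseForm γ₀ γ₁ f n ((chartAt EM x₀).symm y) t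
        ).compContinuousLinearMap
          ((chartSymmDeriv x₀ y).prodMap (ContinuousLinearMap.id ℝ ℝ))) := by
  rw [DiffForm.inChart_apply, ← restrictSlice_totalBaseForm, restrictSlice_apply,
    restrictSlice_apply, ← compContinuousLinearMap_comp, ← compContinuousLinearMap_comp]
  rfl

theorem inChart_transgression (x₀ : M) (y : EM) (t : ℝ) :
    (S.transgression γ₀ γ₁ f n t).inChart x₀ y =
      contractTime EM n ((S.totalBaseForm γ₀ γ₁ f (n + 1) ((chartAt EM x₀).symm y) t
        ).compContinuousLinearMap
          ((chartSymmDeriv x₀ y).prodMap (ContinuousLinearMap.id ℝ ℝ))) := by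
  rw [DiffForm.inChart_apply, contractTime_comp]
  rfl

variable [IsManifold 𝓘(ℝ, EP) ∞ P]

/-- The form on `P` is the pullback of the form on `M`. -/
theorem charAt_eq_baseForm_comp (hf : f ∈ S.invariants) (u : P) (h : Y →L[ℝ] EP) :
    S.charAt γ f n u h =
      (S.baseForm γ f n (B.proj u)).compContinuousLinearMap ((B.dproj u).comp h) := by
  rw [baseForm, ← charAt_comp]
  refine S.charAt_congr γ n hf (B.proj_liftPt _).symm ?_
  rw [← ContinuousLinearMap.comp_assoc, B.dproj_comp_liftVec, ContinuousLinearMap.id_comp]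

theorem totalCharAt_eq_totalBaseForm_comp (hf : f ∈ S.invariants) (u : P) (h : Y →L[ℝ] EP)
    (t : ℝ) :
    S.totalCharAt γ₀ γ₁ f n u h t = (S.totalBaseForm γ₀ γ₁ f n (B.proj u) t
      ).compContinuousLinearMap (((B.dproj u).comp h).prodMap (ContinuousLinearMap.id ℝ ℝ)) := by
  rw [totalBaseForm, ← totalCharAt_comp]
  refine S.totalCharAt_congr γ₀ γ₁ n hf (B.proj_liftPt _).symm ?_ t
  rw [← ContinuousLinearMap.comp_assoc, B.dproj_comp_liftVec, ContinuousLinearMap.id_comp]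

/-- In a chart, the form on `M × ℝ` is the pullback of the form on `P × ℝ` along a section. -/
theorem exists_totalCharPullback_eq (hf : f ∈ S.invariants) {x₀ : M} {y : EM}
    (hy : y ∈ (chartAt EM x₀).target) :
    ∃ s : EM → P, SmoothNear EP s y ∧ ∀ᶠ y' in nhds y, ∀ n t,
      (S.totalBaseForm γ₀ γ₁ f n ((chartAt EM x₀).symm y') t).compContinuousLinearMap
        ((chartSymmDeriv x₀ y').prodMap (ContinuousLinearMap.id ℝ ℝ)) =
      S.totalCharPullback γ₀ γ₁ f n s (y', t) := by
  obtain ⟨u, hu⟩ := B.surjective_proj ((chartAt EM x₀).symm y)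
  have hux : B.proj u ∈ (chartAt EM x₀).source := by
    rw [hu]; exact (chartAt EM x₀).map_target hy
  obtain ⟨s, -, hs, -, hp, -⟩ := B.exists_localSection u hux
  rw [hu, (chartAt EM x₀).right_inv hy] at hs hp
  refine ⟨s, hs, ?_⟩
  filter_upwards [hs.eventually, hp, hp.eventually_nhds] with y' hy' hpy hpn n t
  rw [totalCharPullback, S.totalCharAt_eq_totalBaseForm_comp γ₀ γ₁ n hf,
    B.dproj_comp_tderiv hy' hpn, hpy]

theorem isSmooth_baseForm_segment (hf : f ∈ S.invariants) (t : ℝ) :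
    (S.baseForm (PrincipalConnection.segment γ₀ γ₁ t) f n).IsSmooth := by
  intro x₀ y hy
  obtain ⟨s, hs, he⟩ := S.exists_totalCharPullback_eq γ₀ γ₁ hf hy
  refine ContDiffAt.contDiffWithinAt (ContDiffAt.congr_of_eventuallyEq
    (ContDiffAt.comp (g := fun a => restrictSlice EM n a) y
      (ContinuousLinearMap.contDiff _).contDiffAt
      (S.contDiffAt_totalCharPullback_slice γ₀ γ₁ n (f := f) hs t)) ?_)
  filter_upwards [he] with y' hy'
  rw [inChart_baseForm_segment, hy']
  rfl

end GStructure

end Descent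

/-! ### Dependence on the connection -/

section Transgression

variable {EM EP EG V : Type*}
  [NormedAddCommGroup EM] [NormedSpace ℝ EM] [NormedAddCommGroup EP] [NormedSpace ℝ EP]
  [NormedAddCommGroup EG] [NormedSpace ℝ EG]
  [NormedAddCommGroup V] [NormedSpace ℝ V]
  {M P G : Type*}
  [TopologicalSpace M] [ChartedSpace EM M]
  [TopologicalSpace P] [ChartedSpace EP P] [IsManifold 𝓘(ℝ, EP) ∞ P]
  [TopologicalSpace G] [ChartedSpace EG G] [Group G] [LieGroup 𝓘(ℝ, EG) ∞ G]
  {B : PrincipalBundle EM EP EG M P G} (S : GStructure V B) (γ γ₀ γ₁ : PrincipalConnection B)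

theorem quadForm_add_smul {E F : Type*} [NormedAddCommGroup E] [NormedSpace ℝ E]
    [NormedAddCommGroup F] [NormedSpace ℝ F] (q : F →L[ℝ] F →L[ℝ] F) (a d : E [⋀^Fin 1]→L[ℝ] F)
    (t : ℝ) : quadForm q (a + t • d) = quadForm q a +
      t • (quadForm q (a + d) - quadForm q a - quadForm q d) + t ^ 2 • quadForm q d := by
  refine twoForm_ext fun v w => ?_
  simp only [ContinuousAlternatingMap.add_apply, ContinuousAlternatingMap.smul_apply,
    ContinuousAlternatingMap.sub_apply, quadForm_apply, map_add, map_smul, add_apply,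
    smul_apply]
  module

/-- The curvature of `(1 - t) ω₀ + t ω₁` is a quadratic polynomial in `t`. -/
theorem PrincipalConnection.exists_curvature_segment (u : P) :
    ∃ w : ℕ → EP [⋀^Fin 2]→L[ℝ] EG, ∀ t : ℝ,
      (segment γ₀ γ₁ t).curvature u = ∑ i ∈ Finset.range 3, t ^ i • w i := by
  -- apply the structure equation to the inverse of a chart of `P`
  set σ : EP → P := ⇑(chartAt EP u).symm
  set x := chartAt EP u u
  have hσ : SmoothNear EP σ x := smoothNear_chart_symm u
  have hσu : σ x = u := (chartAt EP u).left_inv (mem_chart_source EP u)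
  have hsurj : (tderiv EP σ x).comp (chartDeriv u u) = ContinuousLinearMap.id ℝ EP :=
    chartSymmDeriv_comp_chartDeriv u (mem_chart_source EP u)
  set A := γ₀.form.pullback σ
  set D := fun y => γ₁.form.pullback σ y - γ₀.form.pullback σ y
  set q := structureBilin EG G
  have hA : DifferentiableAt ℝ A x := γ₀.differentiableAt_pullback_form hσ
  have hD : DifferentiableAt ℝ D x := (γ₁.differentiableAt_pullback_form hσ).sub hA
  obtain ⟨dA, hdA⟩ : ∃ a : EP [⋀^Fin 2]→L[ℝ] EG, extDeriv A x = a := ⟨_, rfl⟩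
  obtain ⟨dD, hdD⟩ : ∃ a : EP [⋀^Fin 2]→L[ℝ] EG, extDeriv D x = a := ⟨_, rfl⟩
  have hc : ∀ t : ℝ, (segment γ₀ γ₁ t).curvature u = ((dA + t • dD) +
      (quadForm q (A x) + t • (quadForm q (A x + D x) - quadForm q (A x) - quadForm q (D x)) +
        t ^ 2 • quadForm q (D x))).compContinuousLinearMap (chartDeriv u u) := by
    intro t
    have h1 := (segment γ₀ γ₁ t).curvature_pullback hσ
    have h2 : (segment γ₀ γ₁ t).form.pullback σ = fun y => A y + t • D y := rfl
    have h3 : extDeriv (fun y => t • D y) x = t • extDeriv D x := extDeriv_fun_smul t D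
    have h4 : extDeriv (fun y => A y + t • D y) x = extDeriv A x + extDeriv (fun y => t • D y) x :=
      extDeriv_fun_add hA (hD.const_smul t)
    rw [h2, h4, h3, quadForm_add_smul, hdA, hdD] at h1
    rw [← h1, DiffForm.pullback, ← compContinuousLinearMap_comp, hsurj, hσu]
    rfl
  refine ⟨fun i => (match i with
    | 0 => dA + quadForm q (A x)
    | 1 => dD + (quadForm q (A x + D x) - quadForm q (A x) - quadForm q (D x))
    | _ => quadForm q (D x)).compContinuousLinearMap (chartDeriv u u), fun t => ?_⟩
  rw [hc]
  refine twoForm_ext fun v w => ?_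
  simp only [Finset.sum_range_succ, Finset.sum_range_zero, zero_add, pow_zero, pow_one, one_smul,
    ContinuousAlternatingMap.add_apply, ContinuousAlternatingMap.smul_apply,
    ContinuousAlternatingMap.sub_apply, compContinuousLinearMap_vec_two]
  module

variable [FiniteDimensional ℝ EM] [FiniteDimensional ℝ EG] [FiniteDimensional ℝ V]
  [IsManifold 𝓘(ℝ, EM) ∞ M] {f : AAlg EG V} (n : ℕ)

namespace GStructure

theorem isSmooth_baseForm (hf : f ∈ S.invariants) : (S.baseForm γ f n).IsSmooth := by
  have := S.isSmooth_baseForm_segment γ γ n hf 0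
  rwa [PrincipalConnection.segment_zero] at this

theorem inChart_transgression_eventuallyEq (hf : f ∈ S.invariants) {x₀ : M} {y : EM}
    (hy : y ∈ (chartAt EM x₀).target) : ∃ s : EM → P, SmoothNear EP s y ∧
      (∀ n t, (S.transgression γ₀ γ₁ f n t).inChart x₀ =ᶠ[nhds y]
        fun y => contractTime EM n (S.totalCharPullback γ₀ γ₁ f (n + 1) s (y, t))) ∧
      ∀ n t, (S.baseForm (PrincipalConnection.segment γ₀ γ₁ t) f n).inChart x₀ =ᶠ[nhds y]
        fun y => restrictSlice EM n (S.totalCharPullback γ₀ γ₁ f n s (y, t)) := by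
  obtain ⟨s, hs, he⟩ := S.exists_totalCharPullback_eq γ₀ γ₁ hf hy
  refine ⟨s, hs, fun n t => ?_, fun n t => ?_⟩
  · filter_upwards [he] with y' hy'
    rw [inChart_transgression, hy']
  · filter_upwards [he] with y' hy'
    rw [inChart_baseForm_segment, hy']

theorem isSmooth_transgression (hf : f ∈ S.invariants) (t : ℝ) :
    (S.transgression γ₀ γ₁ f n t).IsSmooth := by
  intro x₀ y hy
  obtain ⟨s, hs, he, -⟩ := S.inChart_transgression_eventuallyEq γ₀ γ₁ hf hy
  exact (ContDiffAt.congr_of_eventuallyEq (ContDiffAt.comp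
    (g := fun a => contractTime EM n a) y (ContinuousLinearMap.contDiff _).contDiffAt
    (S.contDiffAt_totalCharPullback_slice γ₀ γ₁ (n + 1) (f := f) hs t)) (he n t)).contDiffWithinAt

/-- For torsion-free connections the characteristic forms are closed. -/
theorem d_baseForm (hf : f ∈ S.invariants) (hγ : S.torsion γ = 0) :
    (S.baseForm γ f n).d = 0 := by
  funext x
  obtain ⟨s, hs, -, he⟩ := S.inChart_transgression_eventuallyEq γ γ hf (mem_chart_target EM x)
  have h1 := he n 0
  rw [PrincipalConnection.segment_zero] at h1
  have hp : SmoothNear EP s (chartAt EM x x, (0 : ℝ)).1 := hs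
  rw [DiffForm.d_apply, h1.extDeriv_eq, extDeriv_restrictSlice
    ((S.contDiffAt_totalCharPullback γ γ f n hp).differentiableAt (by simp))
    (S.extDeriv_totalCharPullback γ γ n hf hγ hγ hp)]
  rfl

/-- The derivative of the characteristic forms along a segment of torsion-free connections is the
exterior derivative of the transgression forms. -/
theorem hasDerivAt_baseForm (hf : f ∈ S.invariants) (h₀ : S.torsion γ₀ = 0)
    (h₁ : S.torsion γ₁ = 0) (x : M) (t : ℝ) :
    HasDerivAt (fun t => S.baseForm (PrincipalConnection.segment γ₀ γ₁ t) f (n + 1) x)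
      ((S.transgression γ₀ γ₁ f n t).d x) t := by
  obtain ⟨s, hs, hβ, he⟩ := S.inChart_transgression_eventuallyEq γ₀ γ₁ hf (mem_chart_target EM x)
  have hp : SmoothNear EP s (chartAt EM x x, t).1 := hs
  have h1 := hasDerivAt_restrictSlice
    ((S.contDiffAt_totalCharPullback γ₀ γ₁ f (n + 1) hp).differentiableAt (by simp))
    (S.extDeriv_totalCharPullback γ₀ γ₁ (n + 1) hf h₀ h₁ hp)
  have h2 := (ContinuousAlternatingMap.compContinuousLinearMapCLM (F := ℝ) (ι := Fin (n + 1))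
    (chartDeriv x x)).hasFDerivAt.comp_hasDerivAt t h1
  rw [DiffForm.d_apply, (hβ n t).extDeriv_eq]
  refine h2.congr_of_eventuallyEq (Filter.Eventually.of_forall fun τ => ?_)
  exact (DiffForm.inChart_comp_chartDeriv _ x (mem_chart_source EM x)).symm.trans
    (congrArg (fun a => a.compContinuousLinearMap (chartDeriv x x)) (he (n + 1) τ).self_of_nhds)

/-- In degree zero the characteristic forms are functions that do not depend on the connection. -/
theorem hasDerivAt_baseForm_zero (hf : f ∈ S.invariants) (h₀ : S.torsion γ₀ = 0)
    (h₁ : S.torsion γ₁ = 0) (x : M) (t : ℝ) :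
    HasDerivAt (fun t => S.baseForm (PrincipalConnection.segment γ₀ γ₁ t) f 0 x) 0 t := by
  obtain ⟨s, hs, -, he⟩ := S.inChart_transgression_eventuallyEq γ₀ γ₁ hf (mem_chart_target EM x)
  have hp : SmoothNear EP s (chartAt EM x x, t).1 := hs
  have h1 := hasDerivAt_restrictSlice_zero
    ((S.contDiffAt_totalCharPullback γ₀ γ₁ f 0 hp).differentiableAt (by simp))
    (S.extDeriv_totalCharPullback γ₀ γ₁ 0 hf h₀ h₁ hp)
  have h2 := (ContinuousAlternatingMap.compContinuousLinearMapCLM (F := ℝ) (ι := Fin 0)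
    (chartDeriv x x)).hasFDerivAt.comp_hasDerivAt t h1
  rw [map_zero] at h2
  refine h2.congr_of_eventuallyEq (Filter.Eventually.of_forall fun τ => ?_)
  exact (DiffForm.inChart_comp_chartDeriv _ x (mem_chart_source EM x)).symm.trans
    (congrArg (fun a => a.compContinuousLinearMap (chartDeriv x x)) (he 0 τ).self_of_nhds)

variable (f) in
/-- The characteristic forms depend polynomially on the parameter of a segment of connections, with
a bound on the degree that is the same at all points. -/
theorem exists_baseForm_polynomial : ∃ N : ℕ, ∀ (n : ℕ) (x : M), ∃ c : ℕ → EM [⋀^Fin n]→L[ℝ] ℝ,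
    ∀ t : ℝ, S.baseForm (PrincipalConnection.segment γ₀ γ₁ t) f n x =
      ∑ i ∈ Finset.range (N + 1), t ^ i • c i := by
  obtain ⟨N, hN⟩ := exists_substForm_polynomial EM 3 f
  refine ⟨N, fun n x => ?_⟩
  obtain ⟨w, hw⟩ := PrincipalConnection.exists_curvature_segment γ₀ γ₁ (B.liftPt x)
  obtain ⟨c, hc⟩ := hN (fun i => (w i).compContinuousLinearMap (B.liftVec x))
    ((S.θ (B.liftPt x)).compContinuousLinearMap (B.liftVec x)) n
  obtain ⟨d, hd⟩ := exists_coeff_mono (Nat.le_succ N) c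
  refine ⟨d, fun t => ?_⟩
  rw [← hd, ← hc, baseForm, charAt, hw]
  refine substForm_congr ?_ rfl n f
  refine twoForm_ext fun v w => ?_
  simp only [Finset.sum_range_succ, Finset.sum_range_zero, compContinuousLinearMap_vec_two,
    ContinuousAlternatingMap.add_apply, ContinuousAlternatingMap.smul_apply]
  rfl

end GStructure

theorem DiffForm.d_sum {E M ι : Type*} [NormedAddCommGroup E] [NormedSpace ℝ E]
    [TopologicalSpace M] [ChartedSpace E M] {k : ℕ} (s : Finset ι) {α : ι → DiffForm E M ℝ k}
    (hα : ∀ i, (α i).IsSmooth) :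
    DiffForm.IsSmooth (∑ i ∈ s, α i) ∧ DiffForm.d (∑ i ∈ s, α i) = ∑ i ∈ s, (α i).d := by
  classical
  induction s using Finset.induction_on with
  | empty => exact ⟨DiffForm.isSmooth_zero, DiffForm.d_zero⟩
  | insert i s hi h =>
    rw [Finset.sum_insert hi, Finset.sum_insert hi, DiffForm.d_add (hα i) h.1, h.2]
    exact ⟨(hα i).add h.1, rfl⟩

/-! ### The homomorphism -/

namespace GStructure

/-- The linear map `f ↦ f(Ω, …, Ω, θ, …, θ)` into the forms on `M`. -/
def charMap : S.invariants →ₗ[ℝ] smoothForms EM M where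
  toFun f := ⟨fun n => S.baseForm γ f n, fun n => S.isSmooth_baseForm γ n f.2⟩
  map_add' _ _ := Subtype.ext (funext fun n => funext fun _ => map_add (substForm _ _ n) _ _)
  map_smul' c _ := Subtype.ext (funext fun n => funext fun _ => map_smul (substForm _ _ n) c _)

theorem charMap_apply (f : S.invariants) (n : ℕ) (x : M) :
    (S.charMap γ f : TotalForm EM M) n x = S.charAt γ f n (B.liftPt x) (B.liftVec x) := rfl

theorem isCharMap_charMap [FiniteDimensional ℝ EP] : S.IsCharMap γ (S.charMap γ) := by
  intro p q t ht
  refine ⟨fun u X => ?_, fun k hk => funext fun x => substForm_tensorClass_of_ne _ _ hk t⟩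
  have h := S.charAt_eq_baseForm_comp γ (2 * p + q) ht u (ContinuousLinearMap.id ℝ EP)
  refine (congrArg (fun a => a X) h).symm.trans ?_
  exact substForm_tensorClass _ _ t X

theorem isFormsAlgHom_charMap : IsFormsAlgHom (S.charMap γ) where
  map_one := by
    funext n x
    have h1 : ((1 : S.invariants) : AAlg EG V) = algebraMap ℝ _ 1 := (map_one _).symm
    rw [charMap_apply, charAt, h1]
    cases n with
    | zero => exact substForm_algebraMap_zero _ _ 1
    | succ n => exact substForm_algebraMap_of_ne _ _ 1 (Nat.succ_ne_zero n)
  map_mul f g := by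
    funext n x
    rw [TotalForm.wedge_apply]
    exact substForm_mul _ _ n _ _

theorem charMap_mem_closedForms (hγ : S.torsion γ = 0) (f : S.invariants) :
    S.charMap γ f ∈ closedForms EM M := fun n => S.d_baseForm γ n f.2 hγ

/-- The characteristic forms of two torsion-free connections differ by an exact form. The primitive
is a finite combination of transgression forms: as everything is polynomial in the parameter, a
quadrature formula replaces the integral over the parameter. -/
theorem deRhamClass_charMap_eq (h₀ : S.torsion γ₀ = 0) (h₁ : S.torsion γ₁ = 0) (f : S.invariants) :
    deRhamClass ⟨S.charMap γ₁ f, S.charMap_mem_closedForms γ₁ h₁ f⟩ =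
      deRhamClass ⟨S.charMap γ₀ f, S.charMap_mem_closedForms γ₀ h₀ f⟩ := by
  obtain ⟨N, hN⟩ := S.exists_baseForm_polynomial γ₀ γ₁ (f : AAlg EG V)
  obtain ⟨w, hw⟩ := exists_quadrature_sub N
  have hs : ∀ n (j : Fin N),
      DiffForm.IsSmooth (w j • S.transgression γ₀ γ₁ (f : AAlg EG V) n (j : ℝ)) :=
    fun n j => (S.isSmooth_transgression γ₀ γ₁ n f.2 (j : ℝ)).smul (w j)
  refine deRhamClass_eq_iff.2 ⟨⟨fun n => ∑ j : Fin N, w j •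
    S.transgression γ₀ γ₁ (f : AAlg EG V) n (j : ℝ), fun n => (DiffForm.d_sum _ (hs n)).1⟩, ?_⟩
  funext n x
  change S.baseForm γ₁ f n x = S.baseForm γ₀ f n x + TotalForm.d _ n x
  refine sub_eq_iff_eq_add'.1 ?_
  obtain ⟨c, hc⟩ := hN n x
  cases n with
  | zero =>
    have h := hw _ _ (S.hasDerivAt_baseForm_zero γ₀ γ₁ f.2 h₀ h₁ x) c hc
    rw [PrincipalConnection.segment_zero, PrincipalConnection.segment_one] at h
    rw [h]
    simp only [smul_zero, Finset.sum_const_zero]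
    rfl
  | succ n =>
    have h := hw _ _ (S.hasDerivAt_baseForm γ₀ γ₁ n f.2 h₀ h₁ x) c hc
    rw [PrincipalConnection.segment_zero, PrincipalConnection.segment_one] at h
    rw [h]
    change _ = DiffForm.d (∑ j : Fin N, w j • S.transgression γ₀ γ₁ (f : AAlg EG V) n (j : ℝ)) x
    rw [(DiffForm.d_sum _ (hs n)).2, Finset.sum_apply]
    refine Finset.sum_congr rfl fun j _ => ?_
    rw [DiffForm.d_smul]
    rfl

end GStructure

end Transgression

end GenChernWeil

end

theorem theorem3p4
    {EM EP EG V : Type*}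
    [NormedAddCommGroup EM] [NormedSpace ℝ EM] [FiniteDimensional ℝ EM]
    [NormedAddCommGroup EP] [NormedSpace ℝ EP] [FiniteDimensional ℝ EP]
    [NormedAddCommGroup EG] [NormedSpace ℝ EG] [FiniteDimensional ℝ EG]
    [NormedAddCommGroup V] [NormedSpace ℝ V] [FiniteDimensional ℝ V]
    {M P G : Type*}
    [TopologicalSpace M] [ChartedSpace EM M] [IsManifold 𝓘(ℝ, EM) ∞ M]
    [TopologicalSpace P] [ChartedSpace EP P] [IsManifold 𝓘(ℝ, EP) ∞ P]
    [TopologicalSpace G] [ChartedSpace EG G] [Group G] [LieGroup 𝓘(ℝ, EG) ∞ G]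
    (B : GenChernWeil.PrincipalBundle EM EP EG M P G) (S : GenChernWeil.GStructure V B) :
    ∃ μ : GenChernWeil.PrincipalConnection B →
        S.invariants →ₗ[ℝ] GenChernWeil.smoothForms EM M,
      (∀ γ, S.IsCharMap γ (μ γ) ∧ GenChernWeil.IsFormsAlgHom (μ γ)) ∧
      (∀ γ, S.torsion γ = 0 → ∀ f, μ γ f ∈ GenChernWeil.closedForms EM M) ∧
      ∀ γ₀, S.torsion γ₀ = 0 →
        ∃ μ' : S.invariants →ₗ[ℝ] GenChernWeil.DeRham EM M,
          GenChernWeil.IsDeRhamAlgHom μ' ∧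
          ∀ γ, S.torsion γ = 0 →
            ∀ f (hf : μ γ f ∈ GenChernWeil.closedForms EM M),
              GenChernWeil.deRhamClass ⟨μ γ f, hf⟩ = μ' f :=
  ⟨fun γ => S.charMap γ, fun γ => ⟨S.isCharMap_charMap γ, S.isFormsAlgHom_charMap γ⟩,
    fun γ hγ => S.charMap_mem_closedForms γ hγ, fun γ₀ h₀ =>
      ⟨_, GenChernWeil.isDeRhamAlgHom_of_isFormsAlgHom (S.isFormsAlgHom_charMap γ₀)
        (S.charMap_mem_closedForms γ₀ h₀),
        fun γ hγ f _ => S.deRhamClass_charMap_eq γ₀ γ h₀ hγ f⟩⟩
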